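/- **Setting.** Let $\Sigma$ be a Riemann surface, $n\ge 0$ an integer (the interesting case is $n\ge 3$), and let $\underline{\mathbb C}^{n+2}=\Sigma\times\mathbb C^{n+2}$ carry the complex bilinear extension $(\cdot,\cdot)$ of the metric of $\mathbb R^{n+1,1}$, complex conjugation, and the trivial connection $d$. All bundles are smooth subbundles of $\underline{\mathbb C}^{n+2}$ and all forms are smooth. Write $u\wedge v$ for $w\mapsto (u,w)v-(v,w)u$ and $\mathrm{Ad}_T\,\xi=T\xi T^{-1}$; $A^{1,0},A^{0,1}$ are the parts of a 1-form $A$. A *surface* is a pair $(\Lambda^{1,0},\Lambda^{0,1})$ of isotropic rank $2$ bundles meeting in a rank $1$ bundle $\Lambda$ with $d^{1,0}\Gamma\Lambda\subset\Omega^{1,0}\Lambda^{1,0}$ and $d^{0,1}\Gamma\Lambda\subset\Omega^{0,1}\Lambda^{0,1}$; it is *real* if $\overline\Lambda=\Lambda$. For a non-degenerate bundle $V$ with orthogonal projections $\pi_V,\pi_{V^\perp}$, put $\rho=\pi_V-\pi_{V^\perp}$, $\mathcal D_V=\pi_V\circ d\circ\pi_V+\pi_{V^\perp}\circ d\circ\pi_{V^\perp}$,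 $\mathcal N_V=d-\mathcal D_V$, and, for a 1-form $q$ with values in $\wedge^2V\oplus\wedge^2V^\perp$ and $\lambda\in\mathbb C\setminus\{0\}$, $$d^{\lambda,q}_V=\mathcal D_V+\lambda^{-1}\mathcal N_V^{1,0}+\lambda\mathcal N_V^{0,1}+(\lambda^{-2}-1)q^{1,0}+(\lambda^2-1)q^{0,1}.$$ $V$ is *$q$-constrained harmonic* if $d^{\lambda,q}_V$ is flat for all $\lambda\ne0$. A non-degenerate rank $4$ bundle $V$ is a *central sphere congruence* of the surface if $\Lambda^{1,0}+\Lambda^{0,1}\subset V$ and $\mathcal N_V^{1,0}\Lambda^{0,1}=0=\mathcal N_V^{0,1}\Lambda^{1,0}$. The surface is *$q$-constrained Willmore, by means of $V$*, if $V$ is a $q$-constrained harmonic central sphere congruence of it and $q^{1,0}\in\Omega^{1,0}(\wedge^2\Lambda^{0,1})$, $q^{0,1}\in\Omega^{0,1}(\wedge^2\Lambda^{1,0})$; it is a *real $q$-constrained Willmore surface* if moreover the surface and $q$ are real. **Bäcklund transformation.** For a null line bundle $L$ with $\rho L\cap L^\perp=0$ and $c\in\mathbb C\setminus\{0\}$,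 let $T_L(c)$ be $c$ on $L$, $1$ on $(L\oplus\rho L)^\perp$ and $c^{-1}$ on $\rho L$, and put $p_{\alpha,L}(\lambda)=T_L\big(\tfrac{\alpha-\lambda}{\alpha+\lambda}\big)$, $q_{\alpha,L}(\lambda)=T_L\big(\tfrac{\lambda-\alpha}{\lambda+\alpha}\big)$, with $p_{\alpha,L}(\infty)=T_L(-1)$, $q_{\alpha,L}(\infty)=T_L(1)=I$. Let $\alpha\in\mathbb C\setminus(S^1\cup\{0\})$, let $L^\alpha$ be a $d^{\alpha,q}_V$-parallel null line bundle, and set $\beta=\overline\alpha^{-1}$, $L^\beta=\overline{L^\alpha}$, $\hat L=p_{\alpha,L^\alpha}(\beta)L^\beta$. Assume $\rho L^\alpha\cap(L^\alpha)^\perp=0$ and $\rho\hat L\cap\hat L^\perp=0$ everywhere. Put $r^*=q_{\beta,\hat L}\,p_{\alpha,L^\alpha}$ and $$V^*=r^*(1)^{-1}V,\quad (\Lambda^*)^{1,0}=r^*(1)^{-1}r^*(\infty)\Lambda^{1,0},\quad (\Lambda^*)^{0,1}=r^*(1)^{-1}r^*(0)\Lambda^{0,1},$$ $$q^*=\mathrm{Ad}_{r^*(1)^{-1}}\big(\mathrm{Ad}_{r^*(0)}q^{1,0}+\mathrm{Ad}_{r^*(\infty)}q^{0,1}\big).$$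 **Theorem.** Let $(\Lambda^{1,0},\Lambda^{0,1})$ be a real $q$-constrained Willmore surface by means of $V$, and suppose that $\Lambda$ is an immersion (that is, $\langle\sigma,d\sigma(T\Sigma)\rangle$ has rank $3$ for every nowhere zero local section $\sigma$ of $\Lambda$) or, alternatively, that $V$ is real. Then, for all parameters $\alpha,L^\alpha$ as above, the Bäcklund transform $((\Lambda^*)^{1,0},(\Lambda^*)^{0,1})$ is a real $q^*$-constrained Willmore surface by means of $V^*$, and $V^*$ is real. -/

import Mathlib

open scoped Manifold ContDiff

noncomputable section

namespace Backlund

/-! ### Linear algebra of the complexified Lorentzian space -/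

/-- The complexification `ℂ^{n+2}` of `ℝ^{n+1,1}`. The library's Hermitian structure on it serves
only as an auxiliary norm; the metric of interest is `lor` below. -/
abbrev Cn (n : ℕ) := EuclideanSpace ℂ (Fin (n + 2))

/-- Endomorphisms of `ℂ^{n+2}`. -/
abbrev Endo (n : ℕ) := Cn n →L[ℂ] Cn n

/-- The complex bilinear extension of the Lorentzian metric
`x₀y₀ + ⋯ + xₙyₙ - xₙ₊₁yₙ₊₁`. -/
def lor (n : ℕ) : LinearMap.BilinForm ℂ (Cn n) :=
  LinearMap.mk₂ ℂ
    (fun x y => (∑ i : Fin (n + 1), x i.castSucc * y i.castSucc)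
      - x (Fin.last (n + 1)) * y (Fin.last (n + 1)))
    (fun x x' y => by simp only [PiLp.add_apply, add_mul, Finset.sum_add_distrib]; ring)
    (fun c x y => by simp only [PiLp.smul_apply, smul_eq_mul, mul_sub, Finset.mul_sum, mul_assoc])
    (fun x y y' => by simp only [PiLp.add_apply, mul_add, Finset.sum_add_distrib]; ring)
    (fun c x y => by
      simp only [PiLp.smul_apply, smul_eq_mul, mul_sub, Finset.mul_sum, mul_left_comm])

variable {n : ℕ}

/-- The orthogonal complement `F^⊥` with respect to the complex bilinear metric. -/
def perp (F : Submodule ℂ (Cn n)) : Submodule ℂ (Cn n) := (lor n).orthogonal F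

def IsIsotropic (F : Submodule ℂ (Cn n)) : Prop := ∀ x ∈ F, ∀ y ∈ F, lor n x y = 0

/-- `F` is non-degenerate: the metric restricts to a non-degenerate form on `F`. -/
def IsNondeg (F : Submodule ℂ (Cn n)) : Prop := F ⊓ perp F = ⊥

/-- The complex conjugation of `ℂ^{n+2}`. -/
def conjE (n : ℕ) : Cn n ≃ₗ⋆[ℂ] Cn n where
  toFun x := WithLp.toLp 2 fun i => star (x i)
  invFun x := WithLp.toLp 2 fun i => star (x i)
  map_add' x y := by ext i; simp
  map_smul' c x := by ext i; simp
  left_inv x := by ext i; simp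
  right_inv x := by ext i; simp

/-- The complex conjugate of a subspace. -/
def conjSub (F : Submodule ℂ (Cn n)) : Submodule ℂ (Cn n) :=
  F.map (conjE n : Cn n →ₗ⋆[ℂ] Cn n)

/-- The image of a subspace under an endomorphism. -/
def image (T : Endo n) (F : Submodule ℂ (Cn n)) : Submodule ℂ (Cn n) :=
  F.map (T : Cn n →ₗ[ℂ] Cn n)

open Classical in
/-- The projection onto `F` along `G`, meaningful when `ℂ^{n+2} = F ⊕ G`. -/
def projAlong (F G : Submodule ℂ (Cn n)) : Endo n :=
  if h : IsCompl F G then LinearMap.toContinuousLinearMap (F.projection G h) else 0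

/-- The orthogonal projection onto a non-degenerate subspace. -/
def orthProj (V : Submodule ℂ (Cn n)) : Endo n := projAlong V (perp V)

/-- The orthogonal projection onto the complement of a non-degenerate subspace. -/
def orthProjPerp (V : Submodule ℂ (Cn n)) : Endo n := projAlong (perp V) V

/-- The reflection `ρ = π_V - π_{V^⊥}` across `V`. -/
def refl (V : Submodule ℂ (Cn n)) : Endo n := orthProj V - orthProjPerp V

/-- `u ∧ v`, as the skew endomorphism `w ↦ (u,w) v - (v,w) u`. -/
def wedge (u v : Cn n) : Endo n :=
  LinearMap.toContinuousLinearMap ((lor n u).smulRight v - (lor n v).smulRight u)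

/-- `∧²F`, inside the endomorphisms. -/
def wedge2 (F : Submodule ℂ (Cn n)) : Submodule ℂ (Endo n) :=
  Submodule.span ℂ {T | ∃ u ∈ F, ∃ v ∈ F, T = wedge u v}

/-- For a null line `L` with `ρL ∩ L^⊥ = 0`: the map equal to `c` on `L`, to `1` on
`(L ⊕ ρL)^⊥` and to `c⁻¹` on `ρL`. -/
def dress (V L : Submodule ℂ (Cn n)) (c : ℂ) : Endo n :=
  c • projAlong L (image (refl V) L ⊔ perp (L ⊔ image (refl V) L))
    + projAlong (perp (L ⊔ image (refl V) L)) (L ⊔ image (refl V) L)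
    + c⁻¹ • projAlong (image (refl V) L) (L ⊔ perp (L ⊔ image (refl V) L))

/-- `p_{α,L}(l)` for finite `l ≠ ±α`. -/
def pMap (V : Submodule ℂ (Cn n)) (α : ℂ) (L : Submodule ℂ (Cn n)) (l : ℂ) : Endo n :=
  dress V L ((α - l) / (α + l))

/-- `p_{α,L}(∞)`. -/
def pInf (V L : Submodule ℂ (Cn n)) : Endo n := dress V L (-1)

/-- `q_{α,L}(l)` for finite `l ≠ ±α`. -/
def qMap (V : Submodule ℂ (Cn n)) (α : ℂ) (L : Submodule ℂ (Cn n)) (l : ℂ) : Endo n :=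
  dress V L ((l - α) / (l + α))

/-- `q_{α,L}(∞)`, the identity. -/
def qInf (V L : Submodule ℂ (Cn n)) : Endo n := dress V L 1

/-- `L̂ = p_{α,Lα}(β) Lβ`. -/
def hatL (V : Submodule ℂ (Cn n)) (α β : ℂ) (Lα Lβ : Submodule ℂ (Cn n)) :
    Submodule ℂ (Cn n) :=
  image (pMap V α Lα β) Lβ

/-- `r*(l) = q_{β,L̂}(l) p_{α,Lα}(l)` for finite `l ≠ ±α, ±β`. -/
def rStar (V : Submodule ℂ (Cn n)) (α β : ℂ) (Lα Lβ : Submodule ℂ (Cn n)) (l : ℂ) : Endo n :=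
  qMap V β (hatL V α β Lα Lβ) l * pMap V α Lα l

/-- `r*(∞) = q_{β,L̂}(∞) p_{α,Lα}(∞)`. -/
def rStarInf (V : Submodule ℂ (Cn n)) (α β : ℂ) (Lα Lβ : Submodule ℂ (Cn n)) : Endo n :=
  qInf V (hatL V α β Lα Lβ) * pInf V Lα

/-! ### Covectors with values in a complex space, on a tangent space identified with `ℂ` -/

section Parts

variable {W : Type*} [NormedAddCommGroup W] [NormedSpace ℂ W]

/-- `A ∘ J`, where the complex structure `J` is multiplication by `i`. -/
def compJ (A : ℂ →L[ℝ] W) : ℂ →L[ℝ] W :=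
  A.comp ((ContinuousLinearMap.mul ℝ ℂ) Complex.I)

/-- The `(1,0)`-part `(A - i A ∘ J) / 2`. -/
def part10 (A : ℂ →L[ℝ] W) : ℂ →L[ℝ] W := (1 / 2 : ℂ) • (A - Complex.I • compJ A)

/-- The `(0,1)`-part `(A + i A ∘ J) / 2`. -/
def part01 (A : ℂ →L[ℝ] W) : ℂ →L[ℝ] W := (1 / 2 : ℂ) • (A + Complex.I • compJ A)

end Parts

/-- `Ad_T` applied to an endomorphism-valued covector: `v ↦ T A(v) T⁻¹`. -/
def adCov (T : Endo n) (A : ℂ →L[ℝ] Endo n) : ℂ →L[ℝ] Endo n :=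
  ((ContinuousLinearMap.mulLeftRight ℂ (Endo n) T (Ring.inverse T)).restrictScalars ℝ).comp A

/-! ### Bundles, connections and surfaces over an open set `U ⊆ ℂ`

Connections are written `d + A`, with `d` the trivial connection. -/

/-- A smooth subbundle of rank `k` of the trivial bundle over `U`. -/
def IsSubbundleOn (k : ℕ) (U : Set ℂ) (F : ℂ → Submodule ℂ (Cn n)) : Prop :=
  ∀ z ∈ U, ∃ O : Set ℂ, IsOpen O ∧ z ∈ O ∧ O ⊆ U ∧ ∃ s : Fin k → ℂ → Cn n,
    (∀ i, ContDiffOn ℝ ∞ (s i) O) ∧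
    ∀ w ∈ O, LinearIndependent ℂ (fun i => s i w) ∧
      Submodule.span ℂ (Set.range fun i => s i w) = F w

/-- A smooth section of `F` over the open set `O`. -/
structure IsSectionOn (F : ℂ → Submodule ℂ (Cn n)) (O : Set ℂ) (s : ℂ → Cn n) : Prop where
  isOpen : IsOpen O
  smooth : ContDiffOn ℝ ∞ s O
  mem : ∀ z ∈ O, s z ∈ F z

/-- The connection `d + A` is flat over `U`: its curvature `dA + A ∧ A` vanishes. -/
def IsFlatOn (U : Set ℂ) (A : ℂ → ℂ →L[ℝ] Endo n) : Prop :=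
  ∀ z ∈ U, ∀ u v : ℂ,
    fderiv ℝ A z u v - fderiv ℝ A z v u + (A z u * A z v - A z v * A z u) = 0

/-- `F` is parallel for `d + A` over `U`. -/
def IsParallelOn (U : Set ℂ) (A : ℂ → ℂ →L[ℝ] Endo n) (F : ℂ → Submodule ℂ (Cn n)) : Prop :=
  ∀ (O : Set ℂ) (s : ℂ → Cn n), O ⊆ U → IsSectionOn F O s →
    ∀ z ∈ O, ∀ v : ℂ, fderiv ℝ s z v + A z v (s z) ∈ F z

/-- The connection form of `𝒟_V = π_V ∘ d ∘ π_V + π_{V^⊥} ∘ d ∘ π_{V^⊥}`, that is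
`𝒟_V - d = π_V dπ_V + π_{V^⊥} dπ_{V^⊥}`. -/
def formD (V : ℂ → Submodule ℂ (Cn n)) (z : ℂ) : ℂ →L[ℝ] Endo n :=
  ((ContinuousLinearMap.mul ℂ (Endo n) (orthProj (V z))).restrictScalars ℝ).comp
      (fderiv ℝ (fun w => orthProj (V w)) z)
    + ((ContinuousLinearMap.mul ℂ (Endo n) (orthProjPerp (V z))).restrictScalars ℝ).comp
      (fderiv ℝ (fun w => orthProjPerp (V w)) z)

/-- The form `𝒩_V = d - 𝒟_V`. -/
def formN (V : ℂ → Submodule ℂ (Cn n)) (z : ℂ) : ℂ →L[ℝ] Endo n := -formD V z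

/-- The connection form of
`d_V^{l,q} = 𝒟_V + l⁻¹ 𝒩_V^{1,0} + l 𝒩_V^{0,1} + (l⁻² - 1) q^{1,0} + (l² - 1) q^{0,1}`. -/
def formLoop (V : ℂ → Submodule ℂ (Cn n)) (q : ℂ → ℂ →L[ℝ] Endo n) (l : ℂ) (z : ℂ) :
    ℂ →L[ℝ] Endo n :=
  formD V z + l⁻¹ • part10 (formN V z) + l • part01 (formN V z)
    + ((l ^ 2)⁻¹ - 1) • part10 (q z) + (l ^ 2 - 1) • part01 (q z)

/-- A (complexified) surface: isotropic rank 2 bundles meeting in a rank 1 bundle `Λ`, with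
`d^{1,0} ΓΛ ⊆ Ω^{1,0} Λ^{1,0}` and `d^{0,1} ΓΛ ⊆ Ω^{0,1} Λ^{0,1}`. -/
structure IsSurfaceOn (U : Set ℂ) (L10 L01 : ℂ → Submodule ℂ (Cn n)) : Prop where
  bundle10 : IsSubbundleOn 2 U L10
  bundle01 : IsSubbundleOn 2 U L01
  isotropic10 : ∀ z ∈ U, IsIsotropic (L10 z)
  isotropic01 : ∀ z ∈ U, IsIsotropic (L01 z)
  bundle_inter : IsSubbundleOn 1 U (fun z => L10 z ⊓ L01 z)
  deriv10 : ∀ (O : Set ℂ) (s : ℂ → Cn n), O ⊆ U → IsSectionOn (fun z => L10 z ⊓ L01 z) O s →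
    ∀ z ∈ O, ∀ v : ℂ, part10 (fderiv ℝ s z) v ∈ L10 z
  deriv01 : ∀ (O : Set ℂ) (s : ℂ → Cn n), O ⊆ U → IsSectionOn (fun z => L10 z ⊓ L01 z) O s →
    ∀ z ∈ O, ∀ v : ℂ, part01 (fderiv ℝ s z) v ∈ L01 z

/-- `V` is a central sphere congruence of the surface `(Λ^{1,0}, Λ^{0,1})`. -/
structure IsCentralOn (U : Set ℂ) (L10 L01 V : ℂ → Submodule ℂ (Cn n)) : Prop where
  bundle : IsSubbundleOn 4 U V
  nondeg : ∀ z ∈ U, IsNondeg (V z)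
  le : ∀ z ∈ U, L10 z ⊔ L01 z ≤ V z
  central10 : ∀ z ∈ U, ∀ v : ℂ, ∀ x ∈ L01 z, part10 (formN V z) v x = 0
  central01 : ∀ z ∈ U, ∀ v : ℂ, ∀ x ∈ L10 z, part01 (formN V z) v x = 0

/-- The non-degenerate bundle `V` is `q`-constrained harmonic. -/
structure IsConstrainedHarmonicOn (U : Set ℂ) (V : ℂ → Submodule ℂ (Cn n))
    (q : ℂ → ℂ →L[ℝ] Endo n) : Prop where
  smooth : ContDiffOn ℝ ∞ q U
  mem : ∀ z ∈ U, ∀ v : ℂ, q z v ∈ wedge2 (V z) ⊔ wedge2 (perp (V z))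
  flat : ∀ l : ℂ, l ≠ 0 → IsFlatOn U (formLoop V q l)

/-- `(Λ^{1,0}, Λ^{0,1})` is a `q`-constrained Willmore surface, by means of the
`q`-constrained harmonic central sphere congruence `V`. -/
structure IsConstrainedWillmoreOn (U : Set ℂ) (L10 L01 V : ℂ → Submodule ℂ (Cn n))
    (q : ℂ → ℂ →L[ℝ] Endo n) : Prop where
  surface : IsSurfaceOn U L10 L01
  central : IsCentralOn U L10 L01 V
  harmonic : IsConstrainedHarmonicOn U V q
  multiplier10 : ∀ z ∈ U, ∀ v : ℂ, part10 (q z) v ∈ wedge2 (L01 z)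
  multiplier01 : ∀ z ∈ U, ∀ v : ℂ, part01 (q z) v ∈ wedge2 (L10 z)

/-- `Λ` is immersed over `U`: for every nowhere zero local section `s` of `Λ`, the bundle
`Λ^{(1)}`, spanned by `s` and `ds`, has rank 3. -/
def IsImmersedOn (U : Set ℂ) (L : ℂ → Submodule ℂ (Cn n)) : Prop :=
  ∀ (O : Set ℂ) (s : ℂ → Cn n), O ⊆ U → IsSectionOn L O s → (∀ z ∈ O, s z ≠ 0) →
    ∀ z ∈ O, Module.finrank ℂ
      (Submodule.span ℂ (insert (s z) (Set.range fun v : ℂ => fderiv ℝ s z v))) = 3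

/-! ### The same notions on a Riemann surface `M`

Conditions are imposed in the holomorphic charts. -/

section Global

variable {M : Type*} [TopologicalSpace M] [ChartedSpace ℂ M]

variable (n M) in
/-- A field of subspaces of `ℂ^{n+2}` over `M`. -/
abbrev SubField := M → Submodule ℂ (Cn n)

variable (n M) in
/-- A field of endomorphism-valued covectors over `M`. The real tangent space at each point is,
by definition in the library, a copy of `ℂ`, by means of the preferred chart at the point; its
complex structure is multiplication by `i`. -/
abbrev FormField := (p : M) → TangentSpace 𝓘(ℝ, ℂ) p →L[ℝ] Endo n

/-- The field of subspaces, read in a chart. -/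
def inChart (e : OpenPartialHomeomorph M ℂ) (F : SubField n M) (z : ℂ) : Submodule ℂ (Cn n) :=
  F (e.symm z)

/-- The pull-back of a 1-form to a chart. -/
def formInChart (e : OpenPartialHomeomorph M ℂ) (q : FormField n M) (z : ℂ) :
    ℂ →L[ℝ] Endo n :=
  (q (e.symm z)).comp (mfderiv 𝓘(ℝ, ℂ) 𝓘(ℝ, ℂ) e.symm z)

/-- The bundle is real, i.e. invariant under complex conjugation. -/
def IsRealField (F : SubField n M) : Prop := ∀ p, conjSub (F p) = F p

/-- The 1-form is real: its values on real tangent vectors commute with complex conjugation. -/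
def IsRealForm (q : FormField n M) : Prop :=
  ∀ (p : M) (v : TangentSpace 𝓘(ℝ, ℂ) p) (x : Cn n), q p v (conjE n x) = conjE n (q p v x)

/-- `Λ` is an immersion. -/
def IsImmersed (L : SubField n M) : Prop :=
  ∀ e ∈ atlas ℂ M, IsImmersedOn e.target (inChart e L)

/-- `(Λ^{1,0}, Λ^{0,1})` is a real `q`-constrained Willmore surface, by means of the
`q`-constrained harmonic central sphere congruence `V`: a `q`-constrained Willmore surface such
that both the bundle `Λ = Λ^{1,0} ∩ Λ^{0,1}` and the form `q` are real. -/
structure IsRealConstrainedWillmore (L10 L01 V : SubField n M) (q : FormField n M) : Prop where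
  willmore : ∀ e ∈ atlas ℂ M, IsConstrainedWillmoreOn e.target
    (inChart e L10) (inChart e L01) (inChart e V) (formInChart e q)
  real_surface : IsRealField (fun p => L10 p ⊓ L01 p)
  real_form : IsRealForm q

/-- `α, L` are parameters of a real Bäcklund transformation: `α` is neither `0` nor of modulus
one, `L` is a `d_V^{α,q}`-parallel null line bundle with `ρL ∩ L^⊥ = 0`, and
`L̂ = p_{α,L}(β) L̄`, `β = ᾱ⁻¹`, satisfies `ρL̂ ∩ L̂^⊥ = 0`. -/
structure IsBacklundParameter (V : SubField n M) (q : FormField n M) (α : ℂ)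
    (L : SubField n M) : Prop where
  ne_zero : α ≠ 0
  not_unit : ‖α‖ ≠ 1
  bundle : ∀ e ∈ atlas ℂ M, IsSubbundleOn 1 e.target (inChart e L)
  null : ∀ p, IsIsotropic (L p)
  parallel : ∀ e ∈ atlas ℂ M, IsParallelOn e.target
    (formLoop (inChart e V) (formInChart e q) α) (inChart e L)
  transverse : ∀ p, image (refl (V p)) (L p) ⊓ perp (L p) = ⊥
  transverse_hat : ∀ p,
    image (refl (V p)) (hatL (V p) α (star α)⁻¹ (L p) (conjSub (L p)))
      ⊓ perp (hatL (V p) α (star α)⁻¹ (L p) (conjSub (L p))) = ⊥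

/-- `r*(l)` for the parameters `α, β = ᾱ⁻¹, L^α = L, L^β = L̄`. -/
def realR (V L : SubField n M) (α l : ℂ) (p : M) : Endo n :=
  rStar (V p) α (star α)⁻¹ (L p) (conjSub (L p)) l

/-- `r*(∞)` for the parameters `α, β = ᾱ⁻¹, L^α = L, L^β = L̄`. -/
def realRInf (V L : SubField n M) (α : ℂ) (p : M) : Endo n :=
  rStarInf (V p) α (star α)⁻¹ (L p) (conjSub (L p))

/-- `V* = r*(1)⁻¹ V`. -/
def transformV (V L : SubField n M) (α : ℂ) : SubField n M := fun p =>
  image (Ring.inverse (realR V L α 1 p)) (V p)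

/-- `(Λ*)^{1,0} = r*(1)⁻¹ r*(∞) Λ^{1,0}`. -/
def transform10 (V L : SubField n M) (α : ℂ) (L10 : SubField n M) : SubField n M := fun p =>
  image (Ring.inverse (realR V L α 1 p) * realRInf V L α p) (L10 p)

/-- `(Λ*)^{0,1} = r*(1)⁻¹ r*(0) Λ^{0,1}`. -/
def transform01 (V L : SubField n M) (α : ℂ) (L01 : SubField n M) : SubField n M := fun p =>
  image (Ring.inverse (realR V L α 1 p) * realR V L α 0 p) (L01 p)

/-- `q* = Ad_{r*(1)⁻¹} (Ad_{r*(0)} q^{1,0} + Ad_{r*(∞)} q^{0,1})`. -/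
def transformQ (V L : SubField n M) (α : ℂ) (q : FormField n M) : FormField n M := fun p =>
  adCov (Ring.inverse (realR V L α 1 p))
    (adCov (realR V L α 0 p) (part10 (q p)) + adCov (realRInf V L α p) (part01 (q p)))

end Global

end Backlund

end

noncomputable section

namespace Backlund

variable {n : ℕ}

/-! ### The metric and the conjugation -/

/-! The transform is a dressing: gauging `d_V^{λ,q}` by `r*(λ)` gives a loop of flat connections of
the same shape, and its member at `λ = 1` is trivialised by `r*(1)`. So conjugation by `r*(1)⁻¹`
turns the gauged loop into the loop of `V*` and `q*`.

The parts of type (1,0) and (0,1) are treated alike: each is a polynomial `a + μ b + μ² c`, with `μ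
= λ⁻¹` or `μ = λ`, and a sign `η = ±1` records the type. A simple factor grades skew endomorphisms
by degrees `1, 0, -1` only, because `L` is a null line. Gauging by it could create simple poles at
`μ = ±m`, where `m` is the value of `μ` at the spectral parameter of `L`. The residues vanish
because `L` is parallel at `m` and hence `ρL` is parallel at `-m`, so the result is again quadratic
in `μ` (`gauge_simple`, `IsHalfLoop.gauge`). The relations with `ρ`, with `Λ^{1,0}` and `Λ^{0,1}`
and with the multiplier survive (`IsHalfLoop.step`). The line `L̂` is parallel for the once-gauged
loop, so the step can be repeated (`exists_twoStep`). Flatness of the new loop holds away from `±α,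
±β`, hence everywhere by continuity in `λ`.

For the surface condition, `𝒟_V - q` preserves `Λ^{1,0}` in (1,0)-directions and `Λ^{0,1}` in
(0,1)-directions (`IsHalfWillmore.covariant_mem`), and this is carried over by `r*(∞)` and `r*(0)`.
On the space `V` of dimension four both of these are reflections in a vector. Isotropic planes of
`V` fall into two families exchanged by such a reflection, and planes of different families meet in
a line; so the transformed planes still do (`finrank_dress_inf`).

Reality rests on Bianchi permutability (`dress_permute`): since `κ = (α-β)/(α+β)` is real for `β =
1/ᾱ`, conjugation sends `r*(λ)` to `K r*(1/conj λ)` with `K` independent of `λ`. This fixes `r*(1)`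
and exchanges `r*(0)` with `r*(∞)`, up to `K`, which cancels against `r*(1)⁻¹`. It remains to know
that `V` is real, which follows for an immersed surface from a frame of `V` built from derivatives
of a section of `Λ` (`real_of_immersed`), and that the planes `Λ^{1,0}` and `Λ^{0,1}` are conjugate,
which uses the Lorentzian signature (`conjSub_isotropic`). -/

theorem lor_apply (x y : Cn n) : lor n x y = (∑ i : Fin (n + 1), x i.castSucc * y i.castSucc)
    - x (Fin.last (n + 1)) * y (Fin.last (n + 1)) := rfl

theorem lor_symm (x y : Cn n) : lor n x y = lor n y x := by
  simp only [lor_apply, mul_comm]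

theorem lor_isRefl : (lor n).IsRefl := fun x y h => by rw [lor_symm, h]

theorem eq_zero_of_lor {x : Cn n} (h : ∀ y, lor n x y = 0) : x = 0 := by
  ext i
  refine Fin.lastCases ?_ (fun j => ?_) i
  · have := h (EuclideanSpace.single (Fin.last (n + 1)) 1)
    simpa [lor_apply, Fin.castSucc_ne_last] using this
  · have := h (EuclideanSpace.single j.castSucc 1)
    simpa [lor_apply, (Fin.castSucc_ne_last j).symm, Pi.single_apply] using this

theorem lor_nondegenerate : (lor n).Nondegenerate := by
  refine ⟨fun x h => eq_zero_of_lor h, fun x h => eq_zero_of_lor fun y => ?_⟩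
  rw [lor_symm]; exact h y

theorem ext_lor {x y : Cn n} (h : ∀ w, lor n x w = lor n y w) : x = y := by
  refine sub_eq_zero.1 (eq_zero_of_lor fun w => ?_)
  simp [h w]

@[simp] theorem conjE_apply (x : Cn n) (i : Fin (n + 2)) : conjE n x i = star (x i) := rfl

@[simp] theorem conjE_conjE (x : Cn n) : conjE n (conjE n x) = x := by ext i; simp

theorem lor_conjE (x y : Cn n) : lor n (conjE n x) (conjE n y) = star (lor n x y) := by
  simp [lor_apply]

/-- Without a time component, `(x, x̄)` is a sum of squared moduli. This is where the signature
enters. -/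
theorem eq_zero_of_lor_conjE {x : Cn n} (h : lor n x (conjE n x) = 0)
    (h0 : x (Fin.last (n + 1)) = 0) : x = 0 := by
  have h1 : ∑ i : Fin (n + 1), ‖x i.castSucc‖ ^ 2 = 0 := by
    have : ((∑ i : Fin (n + 1), ‖x i.castSucc‖ ^ 2 : ℝ) : ℂ) = 0 := by
      rw [← h]; simp [lor_apply, h0, Complex.mul_conj, Complex.normSq_eq_norm_sq]
    exact_mod_cast this
  rw [Finset.sum_eq_zero_iff_of_nonneg (fun _ _ => by positivity)] at h1
  ext i
  refine Fin.lastCases ?_ (fun j => ?_) i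
  · simpa using h0
  · simpa using h1 j (Finset.mem_univ _)

theorem mem_conjSub {F : Submodule ℂ (Cn n)} {x : Cn n} : x ∈ conjSub F ↔ conjE n x ∈ F := by
  constructor
  · rintro ⟨y, hy, rfl⟩
    simpa using hy
  · intro h
    exact ⟨conjE n x, h, by simp⟩

theorem conjSub_conjSub (F : Submodule ℂ (Cn n)) : conjSub (conjSub F) = F := by
  ext x; simp [mem_conjSub]

theorem mem_perp {F : Submodule ℂ (Cn n)} {x : Cn n} : x ∈ perp F ↔ ∀ y ∈ F, lor n y x = 0 := by
  rw [perp, LinearMap.BilinForm.mem_orthogonal_iff]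

theorem mem_perp' {F : Submodule ℂ (Cn n)} {x : Cn n} : x ∈ perp F ↔ ∀ y ∈ F, lor n x y = 0 := by
  rw [mem_perp]; simp only [lor_symm]

theorem mem_image {T : Endo n} {F : Submodule ℂ (Cn n)} {x : Cn n} :
    x ∈ image T F ↔ ∃ y ∈ F, T y = x := Iff.rfl

theorem image_mul (S T : Endo n) (F : Submodule ℂ (Cn n)) :
    image (S * T) F = image S (image T F) := by
  ext x; simp [mem_image]

theorem image_span_singleton (T : Endo n) (x : Cn n) :
    image T (Submodule.span ℂ {x}) = Submodule.span ℂ {T x} := by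
  rw [image, Submodule.map_span]; simp

theorem conjSub_span_singleton (x : Cn n) :
    conjSub (Submodule.span ℂ {x}) = Submodule.span ℂ {conjE n x} := by
  rw [conjSub, Submodule.map_span]; simp

theorem finrank_perp (F : Submodule ℂ (Cn n)) :
    Module.finrank ℂ (perp F) = n + 2 - Module.finrank ℂ F := by
  rw [perp, LinearMap.BilinForm.finrank_orthogonal lor_nondegenerate]
  simp

theorem finrank_le_dim (F : Submodule ℂ (Cn n)) : Module.finrank ℂ F ≤ n + 2 := by
  simpa using F.finrank_le

theorem perp_sup (F G : Submodule ℂ (Cn n)) : perp (F ⊔ G) = perp F ⊓ perp G := by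
  ext x
  simp only [Submodule.mem_inf, mem_perp]
  constructor
  · exact fun h => ⟨fun y hy => h y (Submodule.mem_sup_left hy),
      fun y hy => h y (Submodule.mem_sup_right hy)⟩
  · rintro ⟨h1, h2⟩ y hy
    obtain ⟨u, hu, v, hv, rfl⟩ := Submodule.mem_sup.1 hy
    simp [h1 u hu, h2 v hv]

theorem perp_perp (F : Submodule ℂ (Cn n)) : perp (perp F) = F :=
  LinearMap.BilinForm.orthogonal_orthogonal lor_nondegenerate lor_isRefl F

theorem IsNondeg.isCompl {V : Submodule ℂ (Cn n)} (h : IsNondeg V) : IsCompl V (perp V) :=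
  (LinearMap.BilinForm.isCompl_orthogonal_iff_disjoint lor_isRefl).2 (disjoint_iff.2 h)

theorem isotropic_perp_eq {V F : Submodule ℂ (Cn n)} (hV : IsNondeg V)
    (h4 : Module.finrank ℂ V = 4) (hF : IsIsotropic F) (h2 : Module.finrank ℂ F = 2)
    (hle : F ≤ V) : V ⊓ perp F = F := by
  symm
  apply Submodule.eq_of_le_of_finrank_eq
  · exact le_inf hle fun x hx => mem_perp.2 fun y hy => hF y hy x hx
  · have h1 : V ⊓ perp F = perp (perp V ⊔ F) := by rw [perp_sup, perp_perp]
    have h3 : perp V ⊓ F = ⊥ := by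
      rw [eq_bot_iff]; exact (inf_le_inf_left _ hle).trans (by rw [inf_comm, hV])
    have h5 := Submodule.finrank_sup_add_finrank_inf_eq (perp V) F
    rw [h3, finrank_bot, finrank_perp, h4, h2] at h5
    have h6 := finrank_le_dim V
    rw [h1, finrank_perp, h2]
    omega

/-- Here `V^⊥ ⊕ F` lies inside `F^⊥`, so `(n - 2) + dim F ≤ (n + 2) - dim F`. -/
theorem finrank_isotropic_le {V F : Submodule ℂ (Cn n)} (hV : IsNondeg V)
    (h4 : Module.finrank ℂ V = 4) (hF : IsIsotropic F) (hle : F ≤ V) :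
    Module.finrank ℂ F ≤ 2 := by
  have h3 : perp V ⊓ F = ⊥ := by
    rw [eq_bot_iff]; exact (inf_le_inf_left _ hle).trans (by rw [inf_comm, hV])
  have h5 := Submodule.finrank_sup_add_finrank_inf_eq (perp V) F
  have h7 : perp V ⊔ F ≤ perp F := by
    refine sup_le (fun x hx => mem_perp.2 fun y hy => mem_perp.1 hx y (hle hy)) ?_
    exact fun x hx => mem_perp.2 fun y hy => hF y hy x hx
  have h8 := Submodule.finrank_mono h7
  rw [h3, finrank_bot, finrank_perp, h4] at h5
  rw [finrank_perp] at h8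
  have h6 := finrank_le_dim V
  omega

/-! ### Projections and the reflection -/

/-- The four conditions already force `F` and `G` to be complementary, so the default value `0` of
`projAlong` is not met. -/
theorem projAlong_eq {F G : Submodule ℂ (Cn n)} (T : Endo n) (h1 : ∀ x, T x ∈ F)
    (h2 : ∀ x, x - T x ∈ G) (h3 : ∀ x ∈ F, T x = x) (h4 : ∀ x ∈ G, T x = 0) :
    projAlong F G = T := by
  have hc : IsCompl F G := by
    refine IsCompl.of_eq ?_ ?_
    · rw [eq_bot_iff]
      rintro x ⟨hx, hy⟩
      rw [Submodule.mem_bot, ← h3 x hx, h4 x hy]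
    · rw [eq_top_iff]
      intro x _
      exact Submodule.mem_sup.2 ⟨T x, h1 x, x - T x, h2 x, by abel⟩
  rw [projAlong, dif_pos hc]
  ext1 x
  have e : x = T x + (x - T x) := by abel
  have h5 : F.projection G hc (T x) = T x := by
    simpa using Submodule.projection_apply_left hc ⟨T x, h1 x⟩
  have h6 : F.projection G hc (x - T x) = 0 :=
    (Submodule.projection_apply_eq_zero_iff hc).2 (h2 x)
  change F.projection G hc x = T x
  conv_lhs => rw [e]
  rw [map_add, h5, h6, add_zero]

section Refl

variable {V : Submodule ℂ (Cn n)}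

theorem orthProj_apply_eq (hV : IsNondeg V) (x : Cn n) :
    orthProj V x = V.projection (perp V) hV.isCompl x := by
  rw [orthProj, projAlong, dif_pos hV.isCompl]; rfl

theorem orthProj_mem (hV : IsNondeg V) (x : Cn n) : orthProj V x ∈ V := by
  rw [orthProj_apply_eq hV]
  exact Submodule.projection_apply_mem hV.isCompl x

theorem orthProj_of_mem (hV : IsNondeg V) {x : Cn n} (hx : x ∈ V) : orthProj V x = x := by
  rw [orthProj_apply_eq hV]
  simpa using Submodule.projection_apply_left hV.isCompl ⟨x, hx⟩

theorem orthProj_of_mem_perp (hV : IsNondeg V) {x : Cn n} (hx : x ∈ perp V) :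
    orthProj V x = 0 := by
  rw [orthProj_apply_eq hV]
  exact (Submodule.projection_apply_eq_zero_iff hV.isCompl).2 hx

theorem sub_orthProj_mem (hV : IsNondeg V) (x : Cn n) : x - orthProj V x ∈ perp V := by
  rw [← Submodule.projection_apply_eq_zero_iff hV.isCompl, ← orthProj_apply_eq hV, map_sub,
    orthProj_of_mem hV (orthProj_mem hV x), sub_self]

theorem orthProjPerp_eq (hV : IsNondeg V) : orthProjPerp V = 1 - orthProj V := by
  refine projAlong_eq _ (fun x => sub_orthProj_mem hV x) (fun x => ?_) (fun x hx => ?_)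
    (fun x hx => ?_)
  · simpa using orthProj_mem hV x
  · simp [orthProj_of_mem_perp hV hx]
  · simp [orthProj_of_mem hV hx]

theorem refl_eq (hV : IsNondeg V) : refl V = (2 : ℂ) • orthProj V - 1 := by
  rw [refl, orthProjPerp_eq hV]; module

theorem refl_of_mem (hV : IsNondeg V) {x : Cn n} (hx : x ∈ V) : refl V x = x := by
  simp [refl_eq hV, orthProj_of_mem hV hx, two_smul]

theorem refl_of_mem_perp (hV : IsNondeg V) {x : Cn n} (hx : x ∈ perp V) : refl V x = -x := by
  simp [refl_eq hV, orthProj_of_mem_perp hV hx]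

theorem refl_refl (hV : IsNondeg V) (x : Cn n) : refl V (refl V x) = x := by
  have h := orthProj_of_mem hV (orthProj_mem hV x)
  simp only [refl_eq hV, sub_apply, smul_apply, map_sub,
    map_smul, h, one_apply_eq_self]
  module

theorem refl_mul_refl (hV : IsNondeg V) : refl V * refl V = 1 := by
  ext1 x; exact refl_refl hV x

theorem mem_iff_refl (hV : IsNondeg V) {x : Cn n} : x ∈ V ↔ refl V x = x := by
  refine ⟨refl_of_mem hV, fun h => ?_⟩
  have : orthProj V x = x := by
    have h1 : (2 : ℂ) • orthProj V x = (2 : ℂ) • x := by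
      rw [refl_eq hV] at h
      simp only [sub_apply, smul_apply,
        one_apply_eq_self, sub_eq_iff_eq_add] at h
      rw [h, two_smul]
    exact smul_right_injective _ (two_ne_zero' ℂ) h1
  rw [← this]; exact orthProj_mem hV x

theorem mem_perp_iff_refl (hV : IsNondeg V) {x : Cn n} : x ∈ perp V ↔ refl V x = -x := by
  refine ⟨refl_of_mem_perp hV, fun h => ?_⟩
  have : orthProj V x = 0 := by
    rw [refl_eq hV] at h
    simpa using h
  have h2 := sub_orthProj_mem hV x
  rwa [this, sub_zero] at h2

theorem lor_orthProj (hV : IsNondeg V) (x y : Cn n) :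
    lor n (orthProj V x) y = lor n x (orthProj V y) := by
  have h1 := mem_perp.1 (sub_orthProj_mem hV y) _ (orthProj_mem hV x)
  have h2 := mem_perp'.1 (sub_orthProj_mem hV x) _ (orthProj_mem hV y)
  simp only [map_sub, LinearMap.sub_apply, sub_eq_zero] at h1 h2
  rw [h1, h2]

theorem lor_refl (hV : IsNondeg V) (x y : Cn n) : lor n (refl V x) y = lor n x (refl V y) := by
  simp [refl_eq hV, lor_orthProj hV]

theorem lor_refl_refl (hV : IsNondeg V) (x y : Cn n) :
    lor n (refl V x) (refl V y) = lor n x y := by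
  rw [lor_refl hV, refl_refl hV]

theorem conjSub_perp (V : Submodule ℂ (Cn n)) : conjSub (perp V) = perp (conjSub V) := by
  ext x
  simp only [mem_conjSub, mem_perp]
  constructor
  · intro h y hy
    have := h _ hy
    rw [lor_conjE] at this
    simpa using this
  · intro h y hy
    have := h (conjE n y) (by simpa using hy)
    have h2 := lor_conjE y (conjE n x)
    rw [conjE_conjE, this] at h2
    simpa using h2.symm

theorem conjE_orthProj (hV : IsNondeg V) (hr : conjSub V = V) (x : Cn n) :
    conjE n (orthProj V x) = orthProj V (conjE n x) := by
  have h1 : conjE n (orthProj V x) ∈ V := by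
    have := orthProj_mem hV x
    rwa [← conjE_conjE (orthProj V x), ← mem_conjSub, hr] at this
  have h2 : conjE n (x - orthProj V x) ∈ perp V := by
    have := sub_orthProj_mem hV x
    rwa [← conjE_conjE (x - orthProj V x), ← mem_conjSub, conjSub_perp, hr] at this
  have h3 : conjE n x = conjE n (orthProj V x) + conjE n (x - orthProj V x) := by
    rw [← map_add]; congr 1; abel
  rw [h3, map_add, orthProj_of_mem hV h1, orthProj_of_mem_perp hV h2, add_zero]

theorem conjE_refl (hV : IsNondeg V) (hr : conjSub V = V) (x : Cn n) :
    conjE n (refl V x) = refl V (conjE n x) := by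
  simp [refl_eq hV, conjE_orthProj hV hr, LinearEquiv.map_smulₛₗ, Complex.conj_ofNat]

end Refl

/-! ### Null lines and their dressing endomorphisms -/

/-- The endomorphism `x ↦ (w, x) u`. -/
def rankOne (u w : Cn n) : Endo n := LinearMap.toContinuousLinearMap ((lor n w).smulRight u)

@[simp] theorem rankOne_apply (u w x : Cn n) : rankOne u w x = lor n w x • u := rfl

/-- The endomorphism equal to `c` on the image of `P`, to `c⁻¹` on that of `Q`, and to `1` on the
common kernel, when `P` and `Q` are complementary idempotents. -/
def tw {R : Type*} [Ring R] [Algebra ℂ R] (P Q : R) (c : ℂ) : R :=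
  1 + (c - 1) • P + (c⁻¹ - 1) • Q

/-- The projection onto `L` in the decomposition `L ⊕ (L ⊕ ρL)^⊥ ⊕ ρL`. -/
def lineProj (V L : Submodule ℂ (Cn n)) : Endo n :=
  projAlong L (image (refl V) L ⊔ perp (L ⊔ image (refl V) L))

/-- The projection onto `ρL` in the decomposition `L ⊕ (L ⊕ ρL)^⊥ ⊕ ρL`. -/
def coProj (V L : Submodule ℂ (Cn n)) : Endo n :=
  projAlong (image (refl V) L) (L ⊔ perp (L ⊔ image (refl V) L))

/-- `L` is spanned by a null vector `l` with `(l, ρ l) ≠ 0`. -/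
def IsDressing (V L : Submodule ℂ (Cn n)) : Prop :=
  ∃ l, L = Submodule.span ℂ {l} ∧ lor n l l = 0 ∧ lor n l (refl V l) ≠ 0

section Line

variable {V L : Submodule ℂ (Cn n)} {l : Cn n}

theorem mem_perp_span_pair {x l m : Cn n} :
    x ∈ perp (Submodule.span ℂ {l} ⊔ Submodule.span ℂ {m}) ↔ lor n l x = 0 ∧ lor n m x = 0 := by
  rw [perp_sup, Submodule.mem_inf, mem_perp, mem_perp]
  refine and_congr ?_ ?_
  all_goals
    constructor
    · exact fun h => h _ (Submodule.mem_span_singleton_self _)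
    · intro h y hy
      obtain ⟨c, rfl⟩ := Submodule.mem_span_singleton.1 hy
      simp [h]

/-- Null vectors with `(l, m) ≠ 0` form a hyperbolic pair, so all projections are rational in the
metric. Later smoothness and permutability proofs use only these formulas. -/
theorem proj_span_aux {l m : Cn n} (h1 : lor n l l = 0) (h2 : lor n m m = 0)
    (h3 : lor n l m ≠ 0) :
    projAlong (Submodule.span ℂ {l}) (Submodule.span ℂ {m} ⊔
      perp (Submodule.span ℂ {l} ⊔ Submodule.span ℂ {m})) = (lor n l m)⁻¹ • rankOne l m := by
  refine projAlong_eq _ (fun x => ?_) (fun x => ?_) (fun x hx => ?_) (fun x hx => ?_)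
  · exact Submodule.smul_mem _ _ (Submodule.smul_mem _ _ (Submodule.mem_span_singleton_self _))
  · refine Submodule.mem_sup.2 ⟨((lor n l m)⁻¹ * lor n l x) • m,
      Submodule.smul_mem _ _ (Submodule.mem_span_singleton_self _),
      x - ((lor n l m)⁻¹ * lor n m x) • l - ((lor n l m)⁻¹ * lor n l x) • m, ?_, ?_⟩
    · rw [mem_perp_span_pair]
      simp only [map_sub, map_smul, h1, h2, smul_eq_mul, lor_symm m l]
      constructor <;> field_simp <;> ring
    · simp only [smul_apply, rankOne_apply]; module
  · obtain ⟨c, rfl⟩ := Submodule.mem_span_singleton.1 hx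
    simp only [smul_apply, rankOne_apply, map_smul, lor_symm m l, smul_smul]
    congr 1; field_simp
  · obtain ⟨u, hu, v, hv, rfl⟩ := Submodule.mem_sup.1 hx
    obtain ⟨c, rfl⟩ := Submodule.mem_span_singleton.1 hu
    rw [mem_perp_span_pair] at hv
    simp [h2, hv.2]

theorem proj_span_mid_aux {l m : Cn n} (h1 : lor n l l = 0) (h2 : lor n m m = 0)
    (h3 : lor n l m ≠ 0) :
    projAlong (perp (Submodule.span ℂ {l} ⊔ Submodule.span ℂ {m}))
      (Submodule.span ℂ {l} ⊔ Submodule.span ℂ {m}) =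
      1 - (lor n l m)⁻¹ • rankOne l m - (lor n l m)⁻¹ • rankOne m l := by
  refine projAlong_eq _ (fun x => ?_) (fun x => ?_) (fun x hx => ?_) (fun x hx => ?_)
  · rw [mem_perp_span_pair]
    simp only [sub_apply, one_apply_eq_self, smul_apply, rankOne_apply, map_sub, map_smul, h1, h2,
      smul_eq_mul, lor_symm m l]
    constructor <;> field_simp <;> ring
  · refine Submodule.mem_sup.2 ⟨((lor n l m)⁻¹ * lor n m x) • l,
      Submodule.smul_mem _ _ (Submodule.mem_span_singleton_self _), ((lor n l m)⁻¹ * lor n l x) • m,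
      Submodule.smul_mem _ _ (Submodule.mem_span_singleton_self _), ?_⟩
    simp only [sub_apply, one_apply_eq_self, smul_apply, rankOne_apply]; module
  · rw [mem_perp_span_pair] at hx
    simp [hx.1, hx.2]
  · obtain ⟨u, hu, v, hv, rfl⟩ := Submodule.mem_sup.1 hx
    obtain ⟨c, rfl⟩ := Submodule.mem_span_singleton.1 hu
    obtain ⟨d, rfl⟩ := Submodule.mem_span_singleton.1 hv
    simp only [sub_apply, one_apply_eq_self, smul_apply, rankOne_apply, map_add, map_smul, h1, h2,
      lor_symm m l, smul_smul, mul_zero, inv_mul_cancel₀ h3]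
    module

variable (hV : IsNondeg V)

include hV

theorem lor_refl_self (h : lor n l l = 0) : lor n (refl V l) (refl V l) = 0 := by
  rw [lor_refl_refl hV, h]

theorem lineProj_span (h1 : lor n l l = 0) (h3 : lor n l (refl V l) ≠ 0) :
    lineProj V (Submodule.span ℂ {l}) =
      (lor n l (refl V l))⁻¹ • rankOne l (refl V l) := by
  rw [lineProj, image_span_singleton, proj_span_aux h1 (lor_refl_self hV h1) h3]

theorem coProj_span (h1 : lor n l l = 0) (h3 : lor n l (refl V l) ≠ 0) :
    coProj V (Submodule.span ℂ {l}) =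
      (lor n l (refl V l))⁻¹ • rankOne (refl V l) l := by
  rw [coProj, image_span_singleton, sup_comm (Submodule.span ℂ {l}) (Submodule.span ℂ {refl V l}),
    proj_span_aux (lor_refl_self hV h1) h1 (by rwa [lor_symm]), lor_symm]

theorem dress_eq (hL : IsDressing V L) (c : ℂ) :
    dress V L c = tw (lineProj V L) (coProj V L) c := by
  obtain ⟨l, rfl, h1, h3⟩ := hL
  have h4 : projAlong (perp (Submodule.span ℂ {l} ⊔ image (refl V) (Submodule.span ℂ {l})))
      (Submodule.span ℂ {l} ⊔ image (refl V) (Submodule.span ℂ {l})) =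
      1 - lineProj V (Submodule.span ℂ {l}) - coProj V (Submodule.span ℂ {l}) := by
    rw [lineProj_span hV h1 h3, coProj_span hV h1 h3, image_span_singleton,
      proj_span_mid_aux h1 (lor_refl_self hV h1) h3]
  rw [dress, h4, ← lineProj, ← coProj, tw]
  module

theorem dress_span_apply (h1 : lor n l l = 0) (h3 : lor n l (refl V l) ≠ 0) (c : ℂ) (x : Cn n) :
    dress V (Submodule.span ℂ {l}) c x =
      x + ((c - 1) * (lor n l (refl V l))⁻¹ * lor n (refl V l) x) • l
        + ((c⁻¹ - 1) * (lor n l (refl V l))⁻¹ * lor n l x) • refl V l := by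
  rw [dress_eq hV ⟨l, rfl, h1, h3⟩, tw, lineProj_span hV h1 h3, coProj_span hV h1 h3]
  simp only [add_apply, one_apply_eq_self, smul_apply, rankOne_apply, smul_smul, mul_assoc]

end Line

/-- Skew endomorphisms for the complex bilinear metric. -/
def IsSkew (X : Endo n) : Prop := ∀ x y, lor n (X x) y = -lor n x (X y)

/-- Orthogonal endomorphisms for the complex bilinear metric. -/
def IsOrth (T : Endo n) : Prop := ∀ x y, lor n (T x) (T y) = lor n x y

/-- A pair of complementary idempotents `P, Q = Pᵗ`, of rank at most one. -/
structure IsNullPair (P Q : Endo n) : Prop where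
  pp : P * P = P
  qq : Q * Q = Q
  pq : P * Q = 0
  qp : Q * P = 0
  adj : ∀ x y, lor n (P x) y = lor n x (Q y)
  qxp : ∀ X : Endo n, IsSkew X → Q * X * P = 0
  pxq : ∀ X : Endo n, IsSkew X → P * X * Q = 0

theorem IsSkew.self {X : Endo n} (h : IsSkew X) (x : Cn n) : lor n x (X x) = 0 := by
  have := h x x
  rw [lor_symm] at this
  linear_combination (1 / 2 : ℂ) * this

/-- The last two fields hold because `(l, X l) = 0` for skew `X`: the line being one-dimensional, a
skew endomorphism has no component of degree `±2`. -/
theorem isNullPair_rankOne {l m : Cn n} (h1 : lor n l l = 0) (h2 : lor n m m = 0)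
    (h3 : lor n l m ≠ 0) :
    IsNullPair ((lor n l m)⁻¹ • rankOne l m) ((lor n l m)⁻¹ • rankOne m l) where
  pp := by
    ext1 x
    simp [lor_symm m l, smul_smul, h3]
  qq := by
    ext1 x
    simp [smul_smul, h3]
  pq := by ext1 x; simp [h2]
  qp := by ext1 x; simp [h1]
  adj x y := by
    simp only [smul_apply, rankOne_apply, map_smul, LinearMap.smul_apply, smul_eq_mul, lor_symm x m]
    ring
  qxp X hX := by ext1 x; simp [hX.self]
  pxq X hX := by ext1 x; simp [hX.self]

theorem isNullPair_proj {V L : Submodule ℂ (Cn n)} (hV : IsNondeg V) (hL : IsDressing V L) :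
    IsNullPair (lineProj V L) (coProj V L) := by
  obtain ⟨l, rfl, h1, h3⟩ := hL
  rw [lineProj_span hV h1 h3, coProj_span hV h1 h3]
  exact isNullPair_rankOne h1 (lor_refl_self hV h1) h3

theorem refl_mul_lineProj {V L : Submodule ℂ (Cn n)} (hV : IsNondeg V) (hL : IsDressing V L) :
    refl V * lineProj V L = coProj V L * refl V := by
  obtain ⟨l, rfl, h1, h3⟩ := hL
  rw [lineProj_span hV h1 h3, coProj_span hV h1 h3]
  ext1 x
  simp [lor_refl hV]

theorem refl_mul_coProj {V L : Submodule ℂ (Cn n)} (hV : IsNondeg V) (hL : IsDressing V L) :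
    refl V * coProj V L = lineProj V L * refl V := by
  obtain ⟨l, rfl, h1, h3⟩ := hL
  rw [lineProj_span hV h1 h3, coProj_span hV h1 h3]
  ext1 x
  simp [lor_refl_refl hV, refl_refl hV]

theorem lineProj_mem {V L : Submodule ℂ (Cn n)} (hV : IsNondeg V) (hL : IsDressing V L)
    (x : Cn n) : lineProj V L x ∈ L := by
  obtain ⟨l, rfl, h1, h3⟩ := hL
  rw [lineProj_span hV h1 h3]
  exact Submodule.smul_mem _ _ (Submodule.smul_mem _ _ (Submodule.mem_span_singleton_self _))

theorem lineProj_of_mem {V L : Submodule ℂ (Cn n)} (hV : IsNondeg V) (hL : IsDressing V L)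
    {x : Cn n} (hx : x ∈ L) : lineProj V L x = x := by
  obtain ⟨l, rfl, h1, h3⟩ := hL
  rw [lineProj_span hV h1 h3]
  obtain ⟨c, rfl⟩ := Submodule.mem_span_singleton.1 hx
  simp [smul_smul, lor_symm (refl V l) l, h3]

/-! ### Algebra of simple factors -/

section Tw

variable {R : Type*} [Ring R] [Algebra ℂ R] {P Q : R}

@[simp] theorem tw_one : tw P Q 1 = 1 := by simp [tw]

theorem tw_mul_tw (pp : P * P = P) (qq : Q * Q = Q) (pq : P * Q = 0) (qp : Q * P = 0)
    {c d : ℂ} : tw P Q c * tw P Q d = tw P Q (c * d) := by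
  simp only [tw, mul_add, add_mul, smul_mul_assoc, mul_smul_comm, one_mul, mul_one, pp, qq, pq, qp,
    mul_inv]
  module

end Tw

theorem IsNullPair.tw_mul {P Q : Endo n} (h : IsNullPair P Q) (c d : ℂ) :
    tw P Q c * tw P Q d = tw P Q (c * d) := tw_mul_tw h.pp h.qq h.pq h.qp

theorem IsNullPair.tw_inv_mul {P Q : Endo n} (h : IsNullPair P Q) {c : ℂ} (hc : c ≠ 0) :
    tw P Q c⁻¹ * tw P Q c = 1 := by rw [h.tw_mul, inv_mul_cancel₀ hc, tw_one]

theorem IsNullPair.adj' {P Q : Endo n} (h : IsNullPair P Q) (x y : Cn n) :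
    lor n (Q x) y = lor n x (P y) := by
  rw [lor_symm, ← h.adj, lor_symm]

theorem IsNullPair.lor_tw {P Q : Endo n} (h : IsNullPair P Q) (c : ℂ) (x y : Cn n) :
    lor n (tw P Q c x) y = lor n x (tw P Q c⁻¹ y) := by
  simp [tw, h.adj, h.adj', add_comm, add_left_comm]

theorem IsNullPair.isOrth_tw {P Q : Endo n} (h : IsNullPair P Q) {c : ℂ} (hc : c ≠ 0) :
    IsOrth (tw P Q c) := by
  intro x y
  rw [h.lor_tw, ← mul_apply_eq_comp, h.tw_inv_mul hc]; rfl

/-- The reflection exchanges `L` and `ρL`, hence `c` and `c⁻¹`. In particular the factors with `c =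
±1` commute with `ρ`. -/
theorem tw_mul_refl {V L : Submodule ℂ (Cn n)} (hV : IsNondeg V) (hL : IsDressing V L) (c : ℂ) :
    refl V * tw (lineProj V L) (coProj V L) c = tw (lineProj V L) (coProj V L) c⁻¹ * refl V := by
  simp only [tw, mul_add, add_mul, mul_one, one_mul, mul_smul_comm, smul_mul_assoc, inv_inv,
    refl_mul_lineProj hV hL, refl_mul_coProj hV hL]
  abel

/-! ### Gauging a quadratic polynomial of connection forms by a simple factor -/

section Gauge

variable {R : Type*} [Ring R] [Algebra ℂ R]

theorem tw_mul_left {P Q : R} (pp : P * P = P) (qp : Q * P = 0) (c : ℂ) :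
    tw P Q c * P = c • P := by
  simp only [tw, add_mul, one_mul, smul_mul_assoc, pp, qp]; module

theorem tw_mul_right {P Q : R} (qq : Q * Q = Q) (pq : P * Q = 0) (c : ℂ) :
    tw P Q c * Q = c⁻¹ • Q := by
  simp only [tw, add_mul, one_mul, smul_mul_assoc, qq, pq]; module

theorem mul_tw_left {P Q : R} (pp : P * P = P) (pq : P * Q = 0) (c : ℂ) :
    P * tw P Q c = c • P := by
  simp only [tw, mul_add, mul_one, mul_smul_comm, pp, pq]; module

theorem mul_tw_right {P Q : R} (qq : Q * Q = Q) (qp : Q * P = 0) (c : ℂ) :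
    Q * tw P Q c = c⁻¹ • Q := by
  simp only [tw, mul_add, mul_one, mul_smul_comm, qq, qp]; module

/-- If `X` has only components of degrees `1, 0, -1` for the grading defined by `P, 1 - P - Q, Q`,
these are its components. -/
theorem exists_grading {P Q X : R} (pp : P * P = P) (qq : Q * Q = Q) (pq : P * Q = 0)
    (qp : Q * P = 0) (h1 : Q * X * P = 0) (h2 : P * X * Q = 0) :
    let Z := 1 - P - Q
    let X₁ := P * X * Z + Z * X * Q
    let X₂ := Q * X * Z + Z * X * P
    let X₀ := X - X₁ - X₂
    (∀ c : ℂ, c ≠ 0 → tw P Q c * X₁ = c • (X₁ * tw P Q c)) ∧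
    (∀ c : ℂ, tw P Q c * X₀ = X₀ * tw P Q c) ∧
    (∀ c : ℂ, c ≠ 0 → tw P Q c * X₂ = c⁻¹ • (X₂ * tw P Q c)) ∧
    (P - Q) * X₁ - X₁ * (P - Q) = X₁ ∧ (P - Q) * X₀ - X₀ * (P - Q) = 0 ∧
    (P - Q) * X₂ - X₂ * (P - Q) = -X₂ := by
  intro Z X₁ X₂ X₀
  have zP : Z * P = 0 := by simp [Z, sub_mul, pp, qp]
  have zQ : Z * Q = 0 := by simp [Z, sub_mul, qq, pq]
  have Pz : P * Z = 0 := by simp [Z, mul_sub, pp, pq]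
  have Qz : Q * Z = 0 := by simp [Z, mul_sub, qq, qp]
  have tz (c : ℂ) : tw P Q c * Z = Z := by simp [tw, add_mul, Pz, Qz]
  have zt (c : ℂ) : Z * tw P Q c = Z := by simp [tw, mul_add, zP, zQ]
  have tP := tw_mul_left (P := P) (Q := Q) pp qp
  have tQ := tw_mul_right (P := P) (Q := Q) qq pq
  have Pt := mul_tw_left (P := P) (Q := Q) pp pq
  have Qt := mul_tw_right (P := P) (Q := Q) qq qp
  have e0 : X₀ = P * X * P + Z * X * Z + Q * X * Q := by
    have : X = (P + Z + Q) * X * (P + Z + Q) := by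
      have : P + Z + Q = 1 := by simp only [Z]; abel
      rw [this, one_mul, mul_one]
    simp only [X₀, X₁, X₂]
    nth_rewrite 1 [this]
    simp only [add_mul, mul_add, h1, h2]
    abel
  refine ⟨fun c hc => ?_, fun c => ?_, fun c hc => ?_, ?_, ?_, ?_⟩
  · simp only [X₁, mul_add, add_mul, ← mul_assoc, tP, tz]
    simp only [mul_assoc, zt, Qt]
    simp only [mul_smul_comm, smul_mul_assoc, smul_add, smul_smul, mul_inv_cancel₀ hc, one_smul]
  · simp only [e0, mul_add, add_mul, ← mul_assoc, tP, tz, tQ]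
    simp only [mul_assoc, zt, Qt, Pt]
    simp only [mul_smul_comm, smul_mul_assoc]
  · simp only [X₂, mul_add, add_mul, ← mul_assoc, tQ, tz]
    simp only [mul_assoc, zt, Pt]
    simp only [mul_smul_comm, smul_mul_assoc, smul_add, smul_smul, inv_mul_cancel₀ hc, one_smul]
  · simp only [X₁, mul_add, add_mul, sub_mul, mul_sub, ← mul_assoc, pp, qp, Pz, Qz, zero_mul]
    simp only [mul_assoc, zP, zQ, qp, qq, mul_zero]
    abel
  · simp only [e0, mul_add, add_mul, sub_mul, mul_sub, ← mul_assoc, pp, qq, pq, qp, Pz, Qz,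
      zero_mul]
    simp only [mul_assoc, zP, zQ, pp, pq, qp, qq, mul_zero]
    abel
  · simp only [X₂, mul_add, add_mul, sub_mul, mul_sub, ← mul_assoc, pq, qq, Pz, Qz, zero_mul]
    simp only [mul_assoc, zP, zQ, pp, pq, mul_zero]
    abel

/-- The operator `W` with `[W, P] = D`, `[W, Q] = E`, for derivatives `D, E` of a family of
complementary idempotents `P, Q`. -/
def frameForm (P Q D E : R) : R := D * P + E * Q - (D + E) * (1 - P - Q)

-- `W` is the sum of derivative times idempotent over `P`, `Q` and `1 - P - Q`; differentiating the
-- idempotent relations shows that it generates the motion of the splitting. The hypotheses are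
-- exactly those differentiated relations.
omit [Algebra ℂ R] in
theorem frameForm_comm {P Q D E : R} (pp : P * P = P) (qq : Q * Q = Q) (pq : P * Q = 0)
    (qp : Q * P = 0) (dpp : D * P + P * D = D) (dqq : E * Q + Q * E = E)
    (dpq : D * Q + P * E = 0) (dqp : E * P + Q * D = 0) :
    frameForm P Q D E * P - P * frameForm P Q D E = D ∧
      frameForm P Q D E * Q - Q * frameForm P Q D E = E := by
  have e1 : P * D = D - D * P := eq_sub_of_add_eq' dpp
  have e2 : Q * E = E - E * Q := eq_sub_of_add_eq' dqq
  have e3 : P * E = -(D * Q) := eq_neg_of_add_eq_zero_right dpq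
  have e4 : Q * D = -(E * P) := eq_neg_of_add_eq_zero_right dqp
  constructor
  · simp only [frameForm, sub_mul, mul_sub, add_mul, mul_add, mul_assoc, mul_one, pp, qq,
      pq, qp, mul_zero, ← mul_assoc P, e1, e3, neg_mul]
    abel
  · simp only [frameForm, sub_mul, mul_sub, add_mul, mul_add, mul_assoc, mul_one, pp, qq,
      pq, qp, mul_zero, ← mul_assoc Q, e2, e4, neg_mul]
    abel

theorem sandwich (X Y A b c : R) (s t : ℂ) :
    X * (A + s • b + t • c) * Y = X * A * Y + s • (X * b * Y) + t • (X * c * Y) := by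
  rw [mul_add, mul_add, add_mul, add_mul, mul_smul_comm, mul_smul_comm, smul_mul_assoc,
    smul_mul_assoc]

/-- Gauging `a + μ b + μ² c` by the simple factor `tw P Q (ε (m - μ) / (m + μ))`. -/
theorem gauge_simple {P Q D E a b c : R} {m ε : ℂ} (hε : ε * ε = 1)
    (pp : P * P = P) (qq : Q * Q = Q) (pq : P * Q = 0) (qp : Q * P = 0)
    (dpp : D * P + P * D = D) (dqq : E * Q + Q * E = E)
    (dpq : D * Q + P * E = 0) (dqp : E * P + Q * D = 0)
    (ha1 : Q * (a + frameForm P Q D E) * P = 0) (ha2 : P * (a + frameForm P Q D E) * Q = 0)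
    (hb1 : Q * b * P = 0) (hb2 : P * b * Q = 0) (hc1 : Q * c * P = 0) (hc2 : P * c * Q = 0)
    (h1 : (1 - P - Q) * (a + frameForm P Q D E + m • b + m ^ 2 • c) * P = 0)
    (h2 : Q * (a + frameForm P Q D E + m • b + m ^ 2 • c) * (1 - P - Q) = 0)
    (h3 : (1 - P - Q) * (a + frameForm P Q D E - m • b + m ^ 2 • c) * Q = 0)
    (h4 : P * (a + frameForm P Q D E - m • b + m ^ 2 • c) * (1 - P - Q) = 0)
    {μ : ℂ} (hμ1 : m + μ ≠ 0) (hμ2 : m - μ ≠ 0) {κ : ℂ} (hκ : κ = ε * ((m - μ) / (m + μ))) :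
    tw P Q κ * (a + μ • b + μ ^ 2 • c) - ((κ - 1) • D + (κ⁻¹ - 1) • E) =
      ((tw P Q ε * a - ((ε - 1) • D + (ε⁻¹ - 1) • E)) * tw P Q ε
        + μ • (tw P Q (-ε) * b * tw P Q (-ε) - (2 * m) • ((P - Q) *
            (tw P Q (-ε) * c * tw P Q (-ε)) - (tw P Q (-ε) * c * tw P Q (-ε)) * (P - Q)))
        + μ ^ 2 • (tw P Q (-ε) * c * tw P Q (-ε))) * tw P Q κ := by
  set W := frameForm P Q D E with hW
  obtain ⟨hD, hE⟩ := frameForm_comm pp qq pq qp dpp dqq dpq dqp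
  -- The derivative of the simple factor is its commutator with `W`, so gauging `a` amounts to
  -- conjugating `A = a + W` and subtracting `W` again.
  have hdt (k : ℂ) : (k - 1) • D + (k⁻¹ - 1) • E = W * tw P Q k - tw P Q k * W := by
    have : W * tw P Q k - tw P Q k * W =
        (k - 1) • (W * P - P * W) + (k⁻¹ - 1) • (W * Q - Q * W) := by
      simp only [tw, mul_add, add_mul, mul_one, one_mul, mul_smul_comm, smul_mul_assoc]
      module
    rw [this, hD, hE]
  have hε0 : ε ≠ 0 := by rintro rfl; simp at hε
  have hεi : ε⁻¹ = ε := inv_eq_of_mul_eq_one_right hε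
  have hεn : (-ε)⁻¹ = -ε := by rw [inv_neg, hεi]
  have hκ0 : κ ≠ 0 := by rw [hκ]; exact mul_ne_zero hε0 (div_ne_zero hμ2 hμ1)
  have hκi : κ⁻¹ = ε * ((m + μ) / (m - μ)) := by rw [hκ, mul_inv, hεi, inv_div]
  have tt : tw P Q ε * tw P Q ε = 1 := by rw [tw_mul_tw pp qq pq qp, hε, tw_one]
  have ttn : tw P Q (-ε) * tw P Q (-ε) = 1 := by
    rw [tw_mul_tw pp qq pq qp, neg_mul_neg, hε, tw_one]
  obtain ⟨a1, a0, a2, -, -, -⟩ := exists_grading pp qq pq qp ha1 ha2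
  obtain ⟨b1, b0, b2, -, -, -⟩ := exists_grading pp qq pq qp hb1 hb2
  obtain ⟨c1, c0, c2, k1, k0, k2⟩ := exists_grading pp qq pq qp hc1 hc2
  -- Parallelism of the second line at `-m` determines the degree `1` part of `A` from those of `b`
  -- and `c`; parallelism of the first at `m` determines the degree `-1` part in `r2`. These
  -- relations remove the poles.
  have r1 : (P * (a + W) * (1 - P - Q) + (1 - P - Q) * (a + W) * Q)
      = m • (P * b * (1 - P - Q) + (1 - P - Q) * b * Q)
        - m ^ 2 • (P * c * (1 - P - Q) + (1 - P - Q) * c * Q) := by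
    rw [sub_eq_add_neg (a + W) (m • b), ← neg_smul, sandwich] at h3 h4
    rw [← sub_eq_zero, ← add_zero (0 : R)]
    nth_rewrite 2 [← h3]
    rw [← h4]
    module
  have r2 : (Q * (a + W) * (1 - P - Q) + (1 - P - Q) * (a + W) * P)
      = -(m • (Q * b * (1 - P - Q) + (1 - P - Q) * b * P))
        - m ^ 2 • (Q * c * (1 - P - Q) + (1 - P - Q) * c * P) := by
    rw [sandwich] at h1 h2
    rw [← sub_eq_zero, ← add_zero (0 : R)]
    nth_rewrite 2 [← h1]
    rw [← h2]
    module
  have ea : a = (a + W) - W := by abel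
  generalize (1 - P - Q) = Z at *
  generalize a + W = A at *
  generalize (P * A * Z + Z * A * Q) = A1 at *
  generalize (Q * A * Z + Z * A * P) = A2 at *
  generalize (P * b * Z + Z * b * Q) = B1 at *
  generalize (Q * b * Z + Z * b * P) = B2 at *
  generalize (P * c * Z + Z * c * Q) = C1 at *
  generalize (Q * c * Z + Z * c * P) = C2 at *
  -- For an involutive factor, `s = ±ε`, conjugation multiplies both odd degrees by `s`.
  have conj (s : ℂ) (hs : s ≠ 0) (hi : s⁻¹ = s) (ht : tw P Q s * tw P Q s = 1) {X X1 X2 : R}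
      (x1 : ∀ c : ℂ, c ≠ 0 → tw P Q c * X1 = c • (X1 * tw P Q c))
      (x0 : ∀ c : ℂ, tw P Q c * (X - X1 - X2) = (X - X1 - X2) * tw P Q c)
      (x2 : ∀ c : ℂ, c ≠ 0 → tw P Q c * X2 = c⁻¹ • (X2 * tw P Q c)) :
      tw P Q s * X * tw P Q s = s • X1 + (X - X1 - X2) + s • X2 := by
    have e : X = X1 + (X - X1 - X2) + X2 := by abel
    nth_rewrite 1 [e]
    rw [mul_add, mul_add, x1 s hs, x0, x2 s hs, hi, add_mul, add_mul, smul_mul_assoc,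
      smul_mul_assoc, mul_assoc, mul_assoc, mul_assoc, ht, mul_one, mul_one, mul_one]
  have comm {X X1 X2 : R}
      (x1 : ∀ c : ℂ, c ≠ 0 → tw P Q c * X1 = c • (X1 * tw P Q c))
      (x0 : ∀ c : ℂ, tw P Q c * (X - X1 - X2) = (X - X1 - X2) * tw P Q c)
      (x2 : ∀ c : ℂ, c ≠ 0 → tw P Q c * X2 = c⁻¹ • (X2 * tw P Q c)) :
      tw P Q κ * X = (κ • X1 + (X - X1 - X2) + κ⁻¹ • X2) * tw P Q κ := by
    have e : X = X1 + (X - X1 - X2) + X2 := by abel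
    nth_rewrite 1 [e]
    rw [mul_add, mul_add, x1 κ hκ0, x0, x2 κ hκ0, add_mul, add_mul, smul_mul_assoc,
      smul_mul_assoc]
  have lhs : tw P Q κ * (a + μ • b + μ ^ 2 • c) - ((κ - 1) • D + (κ⁻¹ - 1) • E) =
      tw P Q κ * A + μ • (tw P Q κ * b) + μ ^ 2 • (tw P Q κ * c) - W * tw P Q κ := by
    rw [hdt, ea, mul_add, mul_add, mul_sub, mul_smul_comm, mul_smul_comm]
    abel
  have ha : (tw P Q ε * a - ((ε - 1) • D + (ε⁻¹ - 1) • E)) * tw P Q ε =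
      tw P Q ε * A * tw P Q ε - W := by
    rw [hdt, ea, mul_sub, sub_mul, sub_mul, sub_mul, mul_assoc W, tt, mul_one]
    abel
  rw [lhs, ha, conj ε hε0 hεi tt a1 a0 a2, conj _ (neg_ne_zero.2 hε0) hεn ttn b1 b0 b2,
    conj _ (neg_ne_zero.2 hε0) hεn ttn c1 c0 c2, comm a1 a0 a2, comm b1 b0 b2, comm c1 c0 c2]
  -- The commutator with `P - Q` is the grading operator. It enters because `κ = -ε (1 - 2m/μ + ⋯)`
  -- as `μ → ∞`: the term of order `μ⁻¹`, met by `μ² c`, contributes to the linear coefficient.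
  have hH : (P - Q) * (-ε • C1 + (c - C1 - C2) + -ε • C2)
      - (-ε • C1 + (c - C1 - C2) + -ε • C2) * (P - Q) = -ε • C1 + ε • C2 := by
    have : (P - Q) * (-ε • C1 + (c - C1 - C2) + -ε • C2)
      - (-ε • C1 + (c - C1 - C2) + -ε • C2) * (P - Q) = -ε • ((P - Q) * C1 - C1 * (P - Q))
        + ((P - Q) * (c - C1 - C2) - (c - C1 - C2) * (P - Q))
        + -ε • ((P - Q) * C2 - C2 * (P - Q)) := by
      rw [mul_add, mul_add, add_mul, add_mul, mul_smul_comm, mul_smul_comm, smul_mul_assoc,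
        smul_mul_assoc]
      module
    rw [this, k1, k0, k2]
    module
  rw [hH, ← smul_mul_assoc, ← smul_mul_assoc, ← add_mul, ← add_mul, ← sub_mul]
  congr 1
  -- With the odd parts of `A` eliminated, each graded component gives a rational identity in `ε, m,
  -- μ`.
  rw [r1, r2, hκi, hκ]
  match_scalars <;> field_simp <;> ring

end Gauge

/-! ### Adjoints and bivectors -/

theorem endo_neg_mul (X Y : Endo n) : -X * Y = -(X * Y) := neg_mul X Y

theorem endo_mul_neg (X Y : Endo n) : X * -Y = -(X * Y) := mul_neg X Y

theorem endo_neg_smul (c : ℂ) (X : Endo n) : (-c) • X = -(c • X) := neg_smul c X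

/-- `Y` is the adjoint of `X` for the complex bilinear metric. -/
def IsAdj (X Y : Endo n) : Prop := ∀ x y, lor n (X x) y = lor n x (Y y)

namespace IsAdj

variable {X Y X' Y' : Endo n}

theorem add (h : IsAdj X Y) (h' : IsAdj X' Y') : IsAdj (X + X') (Y + Y') := fun x y => by
  simp [h x y, h' x y]

theorem sub (h : IsAdj X Y) (h' : IsAdj X' Y') : IsAdj (X - X') (Y - Y') := fun x y => by
  simp [h x y, h' x y]

theorem mul (h : IsAdj X Y) (h' : IsAdj X' Y') : IsAdj (X * X') (Y' * Y) := fun x y => by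
  rw [mul_apply_eq_comp, h, h']; rfl

theorem one : IsAdj (1 : Endo n) 1 := fun _ _ => rfl

theorem symm (h : IsAdj X Y) : IsAdj Y X := fun x y => by
  rw [lor_symm, ← h, lor_symm]

theorem unique (h : IsAdj X Y) (h' : IsAdj X Y') : Y = Y' := by
  ext1 y
  refine ext_lor fun w => ?_
  rw [lor_symm, ← h, h', lor_symm]

end IsAdj

theorem isSkew_iff {X : Endo n} : IsSkew X ↔ IsAdj X (-X) := by
  simp [IsSkew, IsAdj]

theorem IsNullPair.isAdj {P Q : Endo n} (h : IsNullPair P Q) : IsAdj P Q := h.adj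

theorem wedge_apply (u v w : Cn n) : wedge u v w = lor n u w • v - lor n v w • u := rfl

theorem isSkew_wedge (u v : Cn n) : IsSkew (wedge u v) := by
  intro x y
  simp only [wedge_apply, map_sub, map_smul, LinearMap.sub_apply, LinearMap.smul_apply,
    smul_eq_mul, lor_symm x]
  ring

theorem IsSkew.add {X Y : Endo n} (hX : IsSkew X) (hY : IsSkew Y) : IsSkew (X + Y) :=
  fun x y => by simp [hX x y, hY x y]; ring

theorem IsSkew.sub {X Y : Endo n} (hX : IsSkew X) (hY : IsSkew Y) : IsSkew (X - Y) :=
  fun x y => by simp [hX x y, hY x y]; ring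

theorem IsSkew.smul {X : Endo n} (hX : IsSkew X) (c : ℂ) : IsSkew (c • X) :=
  fun x y => by simp [hX x y]

theorem isSkew_of_mem_wedge2 {F : Submodule ℂ (Cn n)} {X : Endo n} (h : X ∈ wedge2 F) :
    IsSkew X := by
  refine Submodule.span_induction ?_ ?_ (fun _ _ _ _ => IsSkew.add) (fun c _ _ h => h.smul c) h
  · rintro _ ⟨u, -, v, -, rfl⟩; exact isSkew_wedge u v
  · intro x y; simp

theorem wedge2_apply_mem {F : Submodule ℂ (Cn n)} {X : Endo n} (h : X ∈ wedge2 F) (x : Cn n) :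
    X x ∈ F := by
  refine Submodule.span_induction ?_ ?_ (fun _ _ _ _ h1 h2 => F.add_mem h1 h2)
    (fun c _ _ h => F.smul_mem c h) h
  · rintro _ ⟨u, hu, v, hv, rfl⟩
    exact F.sub_mem (F.smul_mem _ hv) (F.smul_mem _ hu)
  · exact F.zero_mem

theorem wedge2_apply_perp {F : Submodule ℂ (Cn n)} {X : Endo n} (h : X ∈ wedge2 F) {x : Cn n}
    (hx : x ∈ perp F) : X x = 0 := by
  refine ext_lor fun w => ?_
  rw [isSkew_of_mem_wedge2 h, lor_symm, mem_perp.1 hx _ (wedge2_apply_mem h w)]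
  simp

/-- For orthogonal `T` one has `T (u ∧ v) T⁻¹ = Tu ∧ Tv`; this transports the multiplier condition.
-/
theorem wedge2_conj {F : Submodule ℂ (Cn n)} {X T S : Endo n} (h : X ∈ wedge2 F)
    (hT : IsOrth T) (hS : T * S = 1) : T * X * S ∈ wedge2 (image T F) := by
  have key (u w : Cn n) : lor n u (S w) = lor n (T u) w := by
    rw [← hT u (S w), ← mul_apply_eq_comp, hS]; rfl
  refine Submodule.span_induction (p := fun X _ => T * X * S ∈ wedge2 (image T F)) ?_ ?_ ?_ ?_ h
  · rintro _ ⟨u, hu, v, hv, rfl⟩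
    refine Submodule.subset_span ⟨T u, ⟨u, hu, rfl⟩, T v, ⟨v, hv, rfl⟩, ?_⟩
    ext1 w
    simp [wedge_apply, key]
  · simp
  · intro X Y _ _ h1 h2
    rw [mul_add, add_mul]; exact Submodule.add_mem _ h1 h2
  · intro c X _ h1
    rw [mul_smul_comm, smul_mul_assoc]; exact Submodule.smul_mem _ _ h1

theorem wedge2_mono {F G : Submodule ℂ (Cn n)} (h : F ≤ G) : wedge2 F ≤ wedge2 G :=
  Submodule.span_mono fun _ ⟨u, hu, v, hv, e⟩ => ⟨u, h hu, v, h hv, e⟩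

theorem perp_anti {F G : Submodule ℂ (Cn n)} (h : F ≤ G) : perp G ≤ perp F :=
  fun _ hx => mem_perp.2 fun y hy => mem_perp.1 hx y (h hy)

theorem anticomm_commutator {R : Type*} [Ring R] {r H c : R} (h1 : r * H = -(H * r))
    (h2 : r * c = c * r) : r * (H * c - c * H) = -((H * c - c * H) * r) := by
  have e1 : r * (H * c) = -(H * c * r) := by
    rw [← mul_assoc, h1, neg_mul, mul_assoc, h2, ← mul_assoc]
  have e2 : r * (c * H) = -(c * H * r) := by
    rw [← mul_assoc, h2, mul_assoc, h1, mul_neg, ← mul_assoc]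
  rw [mul_sub, e1, e2, sub_mul]; abel

/-! ### Half loops -/

/-- At a point, the `(1,0)`-part of a loop of connections `d + a + λ⁻¹ b + λ⁻² c`, or the
`(0,1)`-part of a loop `d + a + λ b + λ² c`, evaluated on a tangent vector; `δ` is the derivative
of the reflection across `V` in this direction. -/
structure IsHalfLoop (V : Submodule ℂ (Cn n)) (δ a b c : Endo n) (F : Submodule ℂ (Cn n)) :
    Prop where
  skew_a : IsSkew a
  skew_b : IsSkew b
  comm_a : refl V * a - a * refl V = δ
  comm_b : refl V * b = -(b * refl V)
  mem_c : c ∈ wedge2 F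
  le : F ≤ V
  isotropic : IsIsotropic F
  b_apply : ∀ x ∈ F, b x = 0

section Step

variable {V F : Submodule ℂ (Cn n)} {δ a b c : Endo n}

theorem IsHalfLoop.c_apply (h : IsHalfLoop V δ a b c F) {x : Cn n} (hx : x ∈ F) : c x = 0 :=
  wedge2_apply_perp h.mem_c (mem_perp.2 fun y hy => h.isotropic y hy x hx)

theorem IsHalfLoop.c_apply_perp (h : IsHalfLoop V δ a b c F) {x : Cn n} (hx : x ∈ perp V) :
    c x = 0 :=
  wedge2_apply_perp h.mem_c (perp_anti h.le hx)

theorem IsHalfLoop.skew_c (h : IsHalfLoop V δ a b c F) : IsSkew c := isSkew_of_mem_wedge2 h.mem_c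

/-- The form `c` takes values in `V` and kills `V^⊥`. -/
theorem IsHalfLoop.comm_c (h : IsHalfLoop V δ a b c F) (hV : IsNondeg V) :
    refl V * c = c * refl V := by
  ext1 x
  have h1 : refl V (c x) = c x := refl_of_mem hV (h.le (wedge2_apply_mem h.mem_c x))
  have h2 : c (x - refl V x) = 0 := by
    refine h.c_apply_perp ?_
    rw [mem_perp_iff_refl hV, map_sub, refl_refl hV]; abel
  rw [map_sub, sub_eq_zero] at h2
  rw [mul_apply_eq_comp, mul_apply_eq_comp, h1, h2]

/-- The relations satisfied by derivatives `D, E` of the idempotents `P, Q` attached to a null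
line, `δ` being the derivative of the reflection. -/
structure IsNullPairDeriv (ρ δ P Q D E : Endo n) : Prop where
  dpp : D * P + P * D = D
  dqq : E * Q + Q * E = E
  dpq : D * Q + P * E = 0
  dqp : E * P + Q * D = 0
  adj : IsAdj D E
  refl_p : δ * P + ρ * D = E * ρ + Q * δ
  refl_q : δ * Q + ρ * E = D * ρ + P * δ

/-- Transposition exchanges `P` with `Q` and `D` with `E`; the differentiated idempotent relations
then turn the transpose of `W` into `-W`. -/
theorem isSkew_frameForm {ρ P Q D E : Endo n} (h : IsNullPair P Q)
    (hd : IsNullPairDeriv ρ δ P Q D E) : IsSkew (frameForm P Q D E) := by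
  rw [isSkew_iff]
  have hp := h.isAdj
  have h1 : IsAdj (frameForm P Q D E) (Q * E + P * D - (1 - Q - P) * (E + D)) :=
    ((hd.adj.mul hp).add (hd.adj.symm.mul hp.symm)).sub
      ((hd.adj.add hd.adj.symm).mul ((IsAdj.one.sub hp).sub hp.symm))
  have h2 : Q * E + P * D - (1 - Q - P) * (E + D) = -frameForm P Q D E := by
    rw [eq_neg_iff_add_eq_zero, frameForm]
    have e1 := eq_sub_of_add_eq' hd.dpp
    have e2 := eq_sub_of_add_eq' hd.dqq
    have e3 := eq_neg_of_add_eq_zero_right hd.dpq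
    have e4 := eq_neg_of_add_eq_zero_right hd.dqp
    simp only [sub_mul, mul_sub, mul_add, add_mul, mul_one, one_mul, e1, e2, e3, e4]
    abel
  rwa [h2] at h1

theorem frameForm_tw {P Q D E : Endo n} (h : IsNullPair P Q) {ρ : Endo n}
    (hd : IsNullPairDeriv ρ δ P Q D E) (k : ℂ) :
    (k - 1) • D + (k⁻¹ - 1) • E =
      frameForm P Q D E * tw P Q k - tw P Q k * frameForm P Q D E := by
  obtain ⟨hD, hE⟩ := frameForm_comm h.pp h.qq h.pq h.qp hd.dpp hd.dqq hd.dpq hd.dqp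
  have : frameForm P Q D E * tw P Q k - tw P Q k * frameForm P Q D E =
      (k - 1) • (frameForm P Q D E * P - P * frameForm P Q D E)
        + (k⁻¹ - 1) • (frameForm P Q D E * Q - Q * frameForm P Q D E) := by
    simp only [tw, mul_add, add_mul, mul_one, one_mul, mul_smul_comm, smul_mul_assoc]
    module
  rw [this, hD, hE]

/-- The coefficient of degree zero of the gauged half loop. -/
def stepA (P Q D E : Endo n) (ε : ℂ) (a : Endo n) : Endo n :=
  (tw P Q ε * a - ((ε - 1) • D + (ε⁻¹ - 1) • E)) * tw P Q ε

/-- The coefficient of degree two of the gauged half loop. -/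
def stepC (P Q : Endo n) (ε : ℂ) (c : Endo n) : Endo n := tw P Q (-ε) * c * tw P Q (-ε)

/-- The coefficient of degree one of the gauged half loop. -/
def stepB (P Q : Endo n) (ε m : ℂ) (b c : Endo n) : Endo n :=
  tw P Q (-ε) * b * tw P Q (-ε)
    - (2 * m) • ((P - Q) * stepC P Q ε c - stepC P Q ε c * (P - Q))

variable {L : Submodule ℂ (Cn n)} {D E : Endo n}

/-- Since `ε² = 1`, the factors `tw P Q (±ε)` are orthogonal involutions commuting with `ρ`, so
conjugation by them keeps skewness and parity. The correction `[P - Q, C]` in degree one is odd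
because `P - Q` anticommutes with `ρ` while `C` commutes with it. No parallelism is needed for this
part. -/
theorem IsHalfLoop.step (h : IsHalfLoop V δ a b c F) (hV : IsNondeg V) (hL : IsDressing V L)
    (hd : IsNullPairDeriv (refl V) δ (lineProj V L) (coProj V L) D E) {ε : ℂ} (hε : ε * ε = 1)
    (m : ℂ) :
    IsHalfLoop V δ (stepA (lineProj V L) (coProj V L) D E ε a)
      (stepB (lineProj V L) (coProj V L) ε m b c) (stepC (lineProj V L) (coProj V L) ε c)
      (image (tw (lineProj V L) (coProj V L) (-ε)) F) := by
  have hN := isNullPair_proj hV hL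
  have ht (s : ℂ) := tw_mul_refl hV hL s
  have hP := refl_mul_lineProj hV hL
  have hQ := refl_mul_coProj hV hL
  set P := lineProj V L
  set Q := coProj V L
  have hε0 : ε ≠ 0 := by rintro rfl; simp at hε
  have hεi : ε⁻¹ = ε := inv_eq_of_mul_eq_one_right hε
  have hεn : (-ε)⁻¹ = -ε := by rw [inv_neg, hεi]
  have tt : tw P Q ε * tw P Q ε = 1 := by rw [hN.tw_mul, hε, tw_one]
  have ttn : tw P Q (-ε) * tw P Q (-ε) = 1 := by rw [hN.tw_mul, neg_mul_neg, hε, tw_one]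
  have rt := ht ε
  have rtn := ht (-ε)
  rw [hεi] at rt
  rw [hεn] at rtn
  have at1 : IsAdj (tw P Q ε) (tw P Q ε) := fun x y => by rw [hN.lor_tw, hεi]
  have at2 : IsAdj (tw P Q (-ε)) (tw P Q (-ε)) := fun x y => by rw [hN.lor_tw, hεn]
  have hc' : stepC P Q ε c ∈ wedge2 (image (tw P Q (-ε)) F) :=
    wedge2_conj h.mem_c (hN.isOrth_tw (neg_ne_zero.2 hε0)) ttn
  have tsk {t X : Endo n} (t1 : IsAdj t t) (hX : IsSkew X) : IsSkew (t * X * t) := by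
    rw [isSkew_iff] at hX ⊢
    have := (t1.mul hX).mul t1
    rwa [endo_neg_mul, endo_mul_neg, ← mul_assoc] at this
  have hHr : refl V * (P - Q) = -((P - Q) * refl V) := by
    rw [mul_sub, sub_mul, hP, hQ]; abel
  have hH : IsAdj (P - Q) (Q - P) := hN.isAdj.sub hN.isAdj.symm
  have hcr : refl V * stepC P Q ε c = stepC P Q ε c * refl V := by
    rw [stepC, ← mul_assoc, ← mul_assoc, rtn, mul_assoc _ (refl V) c, h.comm_c hV]
    simp only [mul_assoc, rtn]
  refine ⟨?_, ?_, ?_, ?_, hc', ?_, ?_, ?_⟩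
  · have : stepA P Q D E ε a =
        tw P Q ε * (a + frameForm P Q D E) * tw P Q ε - frameForm P Q D E := by
      rw [stepA, frameForm_tw hN hd, mul_add, sub_mul, sub_mul, mul_assoc (frameForm P Q D E), tt,
        add_mul, mul_one]
      abel
    rw [this]
    exact (tsk at1 (h.skew_a.add (isSkew_frameForm hN hd))).sub (isSkew_frameForm hN hd)
  · refine (tsk at2 h.skew_b).sub (IsSkew.smul ?_ _)
    have h1 := isSkew_iff.1 (isSkew_of_mem_wedge2 hc')
    rw [isSkew_iff]
    have h2 := (hH.mul h1).sub (h1.mul hH)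
    convert h2 using 1
    simp only [mul_sub, sub_mul, endo_neg_mul, endo_mul_neg]
    abel
  · have e1 : refl V * ((ε - 1) • D + (ε⁻¹ - 1) • E) = ((ε - 1) • D + (ε⁻¹ - 1) • E) * refl V
        + tw P Q ε * δ - δ * tw P Q ε := by
      have r1 := eq_sub_of_add_eq' hd.refl_p
      have r2 := eq_sub_of_add_eq' hd.refl_q
      simp only [hεi, tw, mul_add, add_mul, mul_smul_comm, smul_mul_assoc, r1, r2, one_mul,
        mul_one]
      module
    have e2 : refl V * a = a * refl V + δ := by rw [← h.comm_a]; abel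
    rw [stepA, ← mul_assoc, mul_sub, e1, ← mul_assoc (refl V) (tw P Q ε), rt,
      mul_assoc (tw P Q ε) (refl V), e2]
    have e3 (X : Endo n) : X * tw P Q ε * refl V = X * refl V * tw P Q ε := by
      rw [mul_assoc, ← rt, mul_assoc]
    rw [e3]
    have e4 : δ = δ * tw P Q ε * tw P Q ε := by rw [mul_assoc, tt, mul_one]
    nth_rewrite 4 [e4]
    simp only [mul_add, add_mul, sub_mul, mul_assoc]
    abel
  · have e1 : refl V * (tw P Q (-ε) * b * tw P Q (-ε)) =
        -(tw P Q (-ε) * b * tw P Q (-ε) * refl V) := by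
      rw [← mul_assoc, ← mul_assoc, rtn, mul_assoc _ (refl V) b, h.comm_b]
      simp only [mul_assoc, rtn, endo_mul_neg, endo_neg_mul]
    have e2 : refl V * ((P - Q) * stepC P Q ε c - stepC P Q ε c * (P - Q)) =
        -(((P - Q) * stepC P Q ε c - stepC P Q ε c * (P - Q)) * refl V) :=
      anticomm_commutator hHr hcr
    rw [stepB, mul_sub, e1, mul_smul_comm, e2]
    generalize (P - Q) * stepC P Q ε c - stepC P Q ε c * (P - Q) = Y
    rw [sub_mul, smul_mul_assoc]
    module
  · rintro _ ⟨x, hx, rfl⟩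
    rw [mem_iff_refl hV]
    change (refl V * tw P Q (-ε)) x = tw P Q (-ε) x
    rw [rtn, mul_apply_eq_comp, refl_of_mem hV (h.le hx)]
  · rintro _ ⟨x, hx, rfl⟩ _ ⟨y, hy, rfl⟩
    exact (hN.isOrth_tw (neg_ne_zero.2 hε0) x y).trans (h.isotropic x hx y hy)
  · rintro _ ⟨x, hx, rfl⟩
    change stepB P Q ε m b c (tw P Q (-ε) x) = 0
    have ttx : tw P Q (-ε) (tw P Q (-ε) x) = x := by
      rw [← mul_apply_eq_comp, ttn]; rfl
    -- The new `b` must vanish on the new plane. The only term not killed at once is `c` applied to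
    -- `(P - Q) x`; but `P - Q` sends `V` into `V^⊥`, where `c` vanishes.
    have Ht : tw P Q (-ε) * ((P - Q) * tw P Q (-ε)) = P - Q := by
      have : (P - Q) * tw P Q (-ε) = tw P Q (-ε) * (P - Q) := by
        simp only [mul_sub, sub_mul, tw_mul_left hN.pp hN.qp, tw_mul_right hN.qq hN.pq,
          mul_tw_left hN.pp hN.pq, mul_tw_right hN.qq hN.qp]
      rw [this, ← mul_assoc, ttn, one_mul]
    have cH : c ((P - Q) x) = 0 := by
      refine h.c_apply_perp ((mem_perp_iff_refl hV).2 ?_)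
      rw [← mul_apply_eq_comp, hHr, neg_apply, mul_apply_eq_comp, refl_of_mem hV (h.le hx)]
    have e1 : stepC P Q ε c (tw P Q (-ε) x) = 0 := by
      simp only [stepC, mul_apply_eq_comp, ttx, h.c_apply hx, map_zero]
    have e2 : stepC P Q ε c ((P - Q) (tw P Q (-ε) x)) = 0 := by
      have := congrArg (fun X : Endo n => X x) Ht
      simp only [mul_apply_eq_comp] at this
      simp only [stepC, mul_apply_eq_comp, this, cH, map_zero]
    simp only [stepB, sub_apply, smul_apply, mul_apply_eq_comp, ttx, h.b_apply x hx, map_zero, e1]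
    rw [← sub_apply, e2]
    simp

/-- All four residue conditions of `gauge_simple` come from the single hypothesis that `L` is
parallel at `m`: apply `ρ`, which sends `m` to `-m`, and take adjoints. -/
theorem IsHalfLoop.gauge (h : IsHalfLoop V δ a b c F) (hV : IsNondeg V) (hL : IsDressing V L)
    (hd : IsNullPairDeriv (refl V) δ (lineProj V L) (coProj V L) D E) {ε : ℂ} (hε : ε * ε = 1)
    {m : ℂ} (hpar : (1 - lineProj V L) * (D + (a + m • b + m ^ 2 • c) * lineProj V L) = 0)
    {μ : ℂ} (hμ1 : m + μ ≠ 0) (hμ2 : m - μ ≠ 0) {κ : ℂ} (hκ : κ = ε * ((m - μ) / (m + μ))) :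
    tw (lineProj V L) (coProj V L) κ * (a + μ • b + μ ^ 2 • c)
        - ((κ - 1) • D + (κ⁻¹ - 1) • E) =
      (stepA (lineProj V L) (coProj V L) D E ε a
        + μ • stepB (lineProj V L) (coProj V L) ε m b c
        + μ ^ 2 • stepC (lineProj V L) (coProj V L) ε c) * tw (lineProj V L) (coProj V L) κ := by
  have hN := isNullPair_proj hV hL
  have hP := refl_mul_lineProj hV hL
  have hQ := refl_mul_coProj hV hL
  set P := lineProj V L
  set Q := coProj V L
  set W := frameForm P Q D E
  have hW := isSkew_frameForm hN hd
  obtain ⟨hD, hE⟩ := frameForm_comm hN.pp hN.qq hN.pq hN.qp hd.dpp hd.dqq hd.dpq hd.dqp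
  have hrr := refl_mul_refl hV
  have par (s : ℂ) : IsSkew (a + W + s • b + m ^ 2 • c) :=
    ((h.skew_a.add hW).add (h.skew_b.smul s)).add (h.skew_c.smul _)
  -- the line `ρL` is parallel at `-m`
  have hpar' : (1 - Q) * (E + (a - m • b + m ^ 2 • c) * Q) = 0 := by
    have e1 : refl V * (1 - P) = (1 - Q) * refl V := by rw [mul_sub, hP, sub_mul]; simp
    have e2 : refl V * D = E * refl V + Q * δ - δ * P := eq_sub_of_add_eq' hd.refl_p
    have e3 : refl V * (a + m • b + m ^ 2 • c) = (a - m • b + m ^ 2 • c) * refl V + δ := by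
      rw [← h.comm_a, mul_add, mul_add, mul_smul_comm, mul_smul_comm, h.comm_b, h.comm_c hV,
        add_mul, sub_mul, smul_mul_assoc, smul_mul_assoc]
      module
    have e4 : (1 - Q) * Q = 0 := by rw [sub_mul, hN.qq, one_mul, sub_self]
    have e5 : (1 - Q) * (E + (a - m • b + m ^ 2 • c) * Q) * refl V = 0 := by
      have := congrArg (fun X => refl V * X) hpar
      simp only [mul_zero] at this
      rw [← mul_assoc, e1, mul_assoc, mul_add, e2, ← mul_assoc (refl V), e3, add_mul,
        mul_assoc _ (refl V) P, hP] at this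
      have e6 : E * refl V + Q * δ - δ * P + ((a - m • b + m ^ 2 • c) * (Q * refl V) + δ * P) =
        (E + (a - m • b + m ^ 2 • c) * Q) * refl V + Q * δ := by
        generalize a - m • b + m ^ 2 • c = A
        rw [add_mul, mul_assoc]; abel
      rw [e6, mul_add, ← mul_assoc _ Q, e4, zero_mul, add_zero, ← mul_assoc] at this
      exact this
    have := congrArg (fun X => X * refl V) e5
    simpa only [mul_assoc, hrr, mul_one, zero_mul] using this
  -- Modulo the image of `P`, the derivative `D` may be replaced by `W`, since `D = [W, P]`.
  have k1 : (1 - P) * (a + W + m • b + m ^ 2 • c) * P = 0 := by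
    have e1 : (1 - P) * (D * P) = (1 - P) * (W * P) := by
      rw [← hD]
      simp only [sub_mul, mul_sub, mul_assoc, hN.pp, one_mul]
      simp only [← mul_assoc, hN.pp]
      abel
    have := congrArg (fun X => X * P) hpar
    simp only [zero_mul] at this
    rw [mul_assoc, add_mul, mul_assoc _ P P, hN.pp, mul_add, e1, ← mul_add, ← add_mul,
      ← mul_assoc] at this
    rw [← this]
    congr 2
    abel
  have k3 : (1 - Q) * (a + W - m • b + m ^ 2 • c) * Q = 0 := by
    have e1 : (1 - Q) * (E * Q) = (1 - Q) * (W * Q) := by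
      rw [← hE]
      simp only [sub_mul, mul_sub, mul_assoc, hN.qq, one_mul]
      simp only [← mul_assoc, hN.qq]
      abel
    have := congrArg (fun X => X * Q) hpar'
    simp only [zero_mul] at this
    rw [mul_assoc, add_mul, mul_assoc _ Q Q, hN.qq, mul_add, e1, ← mul_add, ← add_mul,
      ← mul_assoc] at this
    rw [← this]
    congr 2
    abel
  -- This is the adjoint of `k1`, the middle factor being skew and `P`, `Q` being adjoint to each
  -- other; `k4` is obtained from `k3` in the same way.
  have k2 : Q * (a + W + m • b + m ^ 2 • c) * (1 - Q) = 0 := by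
    have h1 := ((IsAdj.one.sub hN.isAdj).mul (isSkew_iff.1 (par m))).mul hN.isAdj
    rw [k1] at h1
    have h2 : IsAdj (0 : Endo n) 0 := fun x y => by simp
    have := h1.unique h2
    rwa [endo_neg_mul, endo_mul_neg, neg_eq_zero, ← mul_assoc] at this
  have k4 : P * (a + W - m • b + m ^ 2 • c) * (1 - P) = 0 := by
    have p2 := par (-m)
    rw [endo_neg_smul, ← sub_eq_add_neg] at p2
    have h1 := ((IsAdj.one.sub hN.isAdj.symm).mul (isSkew_iff.1 p2)).mul hN.isAdj.symm
    rw [k3] at h1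
    have h2 : IsAdj (0 : Endo n) 0 := fun x y => by simp
    have := h1.unique h2
    rwa [endo_neg_mul, endo_mul_neg, neg_eq_zero, ← mul_assoc] at this
  have z1 : 1 - P - Q = (1 - P - Q) * (1 - P) := by simp [mul_sub, sub_mul, hN.pp, hN.qp]
  have z2 : 1 - P - Q = (1 - Q) * (1 - P - Q) := by
    simp only [mul_sub, sub_mul, hN.qq, hN.qp, one_mul, mul_one]; abel
  have z3 : 1 - P - Q = (1 - P - Q) * (1 - Q) := by simp [mul_sub, sub_mul, hN.qq, hN.pq]
  have z4 : 1 - P - Q = (1 - P) * (1 - P - Q) := by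
    simp [mul_sub, sub_mul, hN.pp, hN.pq]
  refine gauge_simple hε hN.pp hN.qq hN.pq hN.qp hd.dpp hd.dqq hd.dpq hd.dqp
    (hN.qxp _ (h.skew_a.add hW)) (hN.pxq _ (h.skew_a.add hW)) (hN.qxp _ h.skew_b)
    (hN.pxq _ h.skew_b) (hN.qxp _ h.skew_c) (hN.pxq _ h.skew_c) ?_ ?_ ?_ ?_ hμ1 hμ2 hκ
  · rw [z1, mul_assoc, mul_assoc, ← mul_assoc (1 - P), k1, mul_zero]
  · rw [z2, ← mul_assoc, k2, zero_mul]
  · rw [z3, mul_assoc, mul_assoc, ← mul_assoc (1 - Q), k3, mul_zero]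
  · rw [z4, ← mul_assoc, k4, zero_mul]

end Step

/-! ### Reality and permutability -/

theorem conjE_smul (c : ℂ) (x : Cn n) : conjE n (c • x) = star c • conjE n x :=
  (conjE n).map_smulₛₗ c x

section Reality

variable {V L : Submodule ℂ (Cn n)}

theorem IsDressing.conj (hV : IsNondeg V) (hr : conjSub V = V) (hL : IsDressing V L) :
    IsDressing V (conjSub L) := by
  obtain ⟨l, rfl, h1, h3⟩ := hL
  refine ⟨conjE n l, conjSub_span_singleton l, by rw [lor_conjE, h1, star_zero], ?_⟩
  rw [← conjE_refl hV hr, lor_conjE]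
  simpa using h3

theorem conjE_dress (hV : IsNondeg V) (hr : conjSub V = V) (hL : IsDressing V L) (c : ℂ)
    (x : Cn n) : conjE n (dress V L c x) = dress V (conjSub L) (star c) (conjE n x) := by
  obtain ⟨l, rfl, h1, h3⟩ := hL
  have h1' : lor n (conjE n l) (conjE n l) = 0 := by rw [lor_conjE, h1, star_zero]
  have h3' : lor n (conjE n l) (refl V (conjE n l)) ≠ 0 := by
    rw [← conjE_refl hV hr, lor_conjE]; simpa using h3
  rw [conjSub_span_singleton, dress_span_apply hV h1 h3, dress_span_apply hV h1' h3']
  simp only [map_add, conjE_smul, ← conjE_refl hV hr, lor_conjE]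
  simp [mul_assoc]

theorem IsDressing.image_dress (hV : IsNondeg V) (hL : IsDressing V L) {c : ℂ} :
    ∀ x, refl V (dress V L c x) = dress V L c⁻¹ (refl V x) := by
  intro x
  rw [dress_eq hV hL, dress_eq hV hL, ← mul_apply_eq_comp, tw_mul_refl hV hL]; rfl

/-- The numerator is symmetric in `l, k` and even in `c`. Hence dressing `k` by `l` and `l` by `k`,
with opposite constants, is admissible under one and the same condition. -/
theorem lor_dress_refl_self (hV : IsNondeg V) {l k : Cn n} (hl : lor n l l = 0)
    (hl' : lor n l (refl V l) ≠ 0) {c : ℂ} (hc : c ≠ 0) :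
    lor n (dress V (Submodule.span ℂ {l}) c k) (refl V (dress V (Submodule.span ℂ {l}) c k)) =
      (lor n l (refl V l) * lor n k (refl V k) + lor n l (refl V k) ^ 2 * (c ^ 2 - 1)
        + lor n l k ^ 2 * ((c⁻¹) ^ 2 - 1)) / lor n l (refl V l) := by
  have hLl : IsDressing V (Submodule.span ℂ {l}) := ⟨l, rfl, hl, hl'⟩
  have hl2 := lor_refl_self hV hl
  have e2 : lor n (refl V l) (refl V k) = lor n l k := lor_refl_refl hV _ _
  have e3 : lor n k (refl V l) = lor n l (refl V k) := by rw [← lor_refl hV, lor_symm]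
  have e5 : lor n (refl V l) k = lor n l (refl V k) := lor_refl hV _ _
  have e6 : lor n k l = lor n l k := lor_symm _ _
  have e7 : lor n (refl V l) l = lor n l (refl V l) := lor_symm _ _
  rw [hLl.image_dress hV, dress_span_apply hV hl hl', dress_span_apply hV hl hl', inv_inv]
  simp only [map_add, map_smul, LinearMap.add_apply, LinearMap.smul_apply, smul_eq_mul,
    e2, e3, e5, e6, e7, hl, hl2]
  field_simp
  ring

theorem lor_dress_self (hV : IsNondeg V) (hL : IsDressing V L) {c : ℂ} (hc : c ≠ 0) (x y : Cn n) :
    lor n (dress V L c x) (dress V L c y) = lor n x y := by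
  rw [dress_eq hV hL, (isNullPair_proj hV hL).isOrth_tw hc]

/-- Permutability: two dressings by simple factors may be exchanged. -/
theorem dress_permute (hV : IsNondeg V) {l k : Cn n} (hl : lor n l l = 0)
    (hl' : lor n l (refl V l) ≠ 0) (hk : lor n k k = 0) (hk' : lor n k (refl V k) ≠ 0)
    {κ a b : ℂ} (hκ : κ ≠ 0) (ha : a ≠ 0) (hb : b ≠ 0) (hκa : 1 + κ * a ≠ 0)
    (hab : κ * (1 - a * b) = b - a)
    (hD : lor n l (refl V l) * lor n k (refl V k)
      + lor n l (refl V k) ^ 2 * (κ ^ 2 - 1) + lor n l k ^ 2 * ((κ⁻¹) ^ 2 - 1) ≠ 0) (x : Cn n) :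
    dress V (Submodule.span ℂ {dress V (Submodule.span ℂ {k}) κ l}) a
        (dress V (Submodule.span ℂ {k}) b x) =
      dress V (Submodule.span ℂ {dress V (Submodule.span ℂ {l}) (-κ) k}) b
        (dress V (Submodule.span ℂ {l}) a x) := by
  have hLl : IsDressing V (Submodule.span ℂ {l}) := ⟨l, rfl, hl, hl'⟩
  have hLk : IsDressing V (Submodule.span ℂ {k}) := ⟨k, rfl, hk, hk'⟩
  have rk := hLl.image_dress hV (c := -κ) k
  have rl := hLk.image_dress hV (c := κ) l
  have nl := (lor_dress_self hV hLk hκ l l).trans hl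
  have nk := (lor_dress_self hV hLl (neg_ne_zero.2 hκ) k k).trans hk
  have gl := lor_dress_refl_self hV hk hk' (k := l) hκ
  have gk := lor_dress_refl_self hV hl hl' (k := k) (neg_ne_zero.2 hκ)
  have hl2 := lor_refl_self hV hl
  have hk2 := lor_refl_self hV hk
  have e1 : lor n (refl V k) (refl V l) = lor n l k := by rw [lor_refl_refl hV, lor_symm]
  have e2 : lor n (refl V l) (refl V k) = lor n l k := lor_refl_refl hV _ _
  have e3 : lor n k (refl V l) = lor n l (refl V k) := by rw [← lor_refl hV, lor_symm]
  have e4 : lor n (refl V k) l = lor n l (refl V k) := lor_symm _ _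
  have e5 : lor n (refl V l) k = lor n l (refl V k) := lor_refl hV _ _
  have e6 : lor n k l = lor n l k := lor_symm _ _
  have e7 : lor n (refl V l) l = lor n l (refl V l) := lor_symm _ _
  have e8 : lor n (refl V k) k = lor n k (refl V k) := lor_symm _ _
  rw [dress_span_apply hV hk hk' κ⁻¹, inv_inv] at rl
  rw [dress_span_apply hV hl hl' (-κ)⁻¹, inv_inv] at rk
  have dl := dress_span_apply hV hk hk' κ l
  have dk := dress_span_apply hV hl hl' (-κ) k
  have ex := dress_span_apply hV hk hk' b x
  have ey := dress_span_apply hV hl hl' a x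
  rw [ex, ey]
  set lt := dress V (Submodule.span ℂ {k}) κ l
  set kt := dress V (Submodule.span ℂ {l}) (-κ) k
  simp only [e1, e2, e3, e4, e5, e6] at dl dk rl rk gl gk
  generalize hg : lor n l (refl V l) = g at *
  generalize hh : lor n k (refl V k) = h at *
  generalize hs : lor n l k = s at *
  generalize ht : lor n l (refl V k) = t at *
  generalize hDD : g * h + t ^ 2 * (κ ^ 2 - 1) + s ^ 2 * ((κ⁻¹) ^ 2 - 1) = D at *
  -- Both dressed lines have the same numerator `D`, the sign of `κ` being irrelevant.
  have gl' : h * g + t ^ 2 * (κ ^ 2 - 1) + s ^ 2 * ((κ⁻¹) ^ 2 - 1) = D := by rw [← hDD]; ring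
  have gk' : g * h + t ^ 2 * ((-κ) ^ 2 - 1) + s ^ 2 * (((-κ)⁻¹) ^ 2 - 1) = D := by
    rw [← hDD]; ring
  rw [gl'] at gl
  rw [gk'] at gk
  rw [dress_span_apply hV nl (by rw [gl]; exact div_ne_zero hD hk'),
    dress_span_apply hV nk (by rw [gk]; exact div_ne_zero hD hl'), gl, gk, rl, rk, dl, dk]
  simp only [map_add, map_smul, LinearMap.add_apply, LinearMap.smul_apply, smul_eq_mul, hk, hk2,
    e1, e2, e3, e4, e5, e6, e7, e8, hg, hh, hs, ht, hl, hl2]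
  generalize lor n l x = x1
  generalize lor n (refl V l) x = x2
  generalize lor n k x = x3
  generalize lor n (refl V k) x = x4
  -- The relation `hab` holds for `κ = (α-β)/(α+β)`, `a = (λ-α)/(λ+α)`, `b = (λ-β)/(λ+β)`. Solving
  -- it for `b` leaves identities between coefficients of `l, ρl, k, ρk` and `x`, rational in `κ`
  -- and `a`.
  have hb' : b = (κ + a) / (1 + κ * a) := by
    rw [eq_div_iff hκa]; linear_combination -hab
  have hκa' : κ + a ≠ 0 := by
    intro h0; rw [h0, zero_div] at hb'; exact hb hb'
  rw [hb']
  clear * - hκ ha hκa hκa' hl' hk' hD hDD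
  generalize hu : 1 + κ * a = u at *
  generalize hw : κ + a = w at *
  match_scalars
  · ring
  all_goals
    field_simp
    rw [← hDD]
    field_simp
    rw [← hu, ← hw]
    ring

/-- The values of `r*` at a point: `dressTwo V L L' a b` is `r*(λ)` with `a = (λ - α) / (λ + α)`,
`b = (λ - β) / (λ + β)`, `L' = L̂`. -/
def dressTwo (V L L' : Submodule ℂ (Cn n)) (a b : ℂ) : Endo n := dress V L' b * dress V L (-a)

theorem dress_mul_dress (hV : IsNondeg V) (hL : IsDressing V L) (c d : ℂ) :
    dress V L c * dress V L d = dress V L (c * d) := by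
  rw [dress_eq hV hL, dress_eq hV hL, dress_eq hV hL, (isNullPair_proj hV hL).tw_mul]

theorem dress_one (hV : IsNondeg V) (hL : IsDressing V L) : dress V L 1 = 1 := by
  rw [dress_eq hV hL, tw_one]

theorem refl_mul_dress (hV : IsNondeg V) (hL : IsDressing V L) (c : ℂ) :
    refl V * dress V L c = dress V L c⁻¹ * refl V := by
  rw [dress_eq hV hL, dress_eq hV hL, tw_mul_refl hV hL]

/-- Dressing endomorphisms are natural for orthogonal endomorphisms commuting with the
reflection. -/
theorem mul_dress (hV : IsNondeg V) (hL : IsDressing V L) {T : Endo n} (hT : IsOrth T)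
    (hTr : refl V * T = T * refl V) (c : ℂ) :
    T * dress V L c = dress V (image T L) c * T := by
  obtain ⟨l, rfl, h1, h3⟩ := hL
  have e (x : Cn n) : refl V (T x) = T (refl V x) := congrArg (fun X : Endo n => X x) hTr
  have h1' : lor n (T l) (T l) = 0 := by rw [hT, h1]
  have h3' : lor n (T l) (refl V (T l)) ≠ 0 := by rwa [e, hT]
  ext1 x
  rw [image_span_singleton, mul_apply_eq_comp, mul_apply_eq_comp, dress_span_apply hV h1 h3,
    dress_span_apply hV h1' h3']
  have hT' (x y : Cn n) : lor n (T x) (T y) = lor n x y := hT x y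
  simp only [map_add, map_smul, e, hT']

theorem isOrth_dress (hV : IsNondeg V) (hL : IsDressing V L) {c : ℂ} (hc : c ≠ 0) :
    IsOrth (dress V L c) := lor_dress_self hV hL hc

/-- Complex conjugation acts on the values of `r*` by `λ ↦ 1 / conj λ`, up to a constant which
does not depend on `λ`. -/
theorem conjE_dressTwo (hV : IsNondeg V) (hr : conjSub V = V) (hL : IsDressing V L) {κ : ℂ}
    (hκ : κ ≠ 0) (hκr : star κ = κ)
    (hL' : IsDressing V (image (dress V L κ) (conjSub L))) {a b a' b' : ℂ} (ha : a ≠ 0)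
    (hb : b ≠ 0) (ha' : a' = -star b) (hb' : b' = -star a) (hκa : 1 + κ * a' ≠ 0)
    (hab : κ * (1 - a' * b') = b' - a') (x : Cn n) :
    conjE n (dressTwo V L (image (dress V L κ) (conjSub L)) a b x) =
      (dress V (conjSub (image (dress V L κ) (conjSub L))) (-1) * dress V L (-1))
        (dressTwo V L (image (dress V L κ) (conjSub L)) a' b' (conjE n x)) := by
  have hLc := hL.conj hV hr
  have hLc' := hL'.conj hV hr
  have ha0 : a' ≠ 0 := by rw [ha']; simpa using hb
  have hb0 : b' ≠ 0 := by rw [hb']; simpa using ha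
  have n1 : (-1 : ℂ) ≠ 0 := by norm_num
  rw [dressTwo, dressTwo, mul_apply_eq_comp, conjE_dress hV hr hL', conjE_dress hV hr hL]
  have s1 : star b = -1 * a' := by rw [ha']; ring
  have s2 : star (-a) = b' := by rw [hb']; simp
  -- Moving the factor `-1` of `L` past that of `L̂` replaces `L̂ = T_L(κ) L̄` by `T_L(-κ) L̄`, the
  -- line required by permutability.
  have i1 := mul_dress hV hL' (isOrth_dress hV hL n1)
    (by rw [refl_mul_dress hV hL]; norm_num) b'
  rw [← image_mul, dress_mul_dress hV hL, neg_one_mul] at i1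
  have key : dress V L (-1) * (dress V (image (dress V L κ) (conjSub L)) b' * dress V L (-a')) =
      dress V (image (dress V L (-κ)) (conjSub L)) b' * dress V L a' := by
    rw [← mul_assoc, i1, mul_assoc, dress_mul_dress hV hL]
    norm_num
  rw [s1, s2, ← dress_mul_dress hV hLc', mul_apply_eq_comp, mul_apply_eq_comp]
  congr 1
  rw [← mul_apply_eq_comp (dress V L (-1)), key]
  obtain ⟨l, rfl, h1, h3⟩ := hL
  have h1' : lor n (conjE n l) (conjE n l) = 0 := by rw [lor_conjE, h1, star_zero]
  have h3' : lor n (conjE n l) (refl V (conjE n l)) ≠ 0 := by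
    rw [← conjE_refl hV hr, lor_conjE]; simpa using h3
  obtain ⟨m, hm, -, hm3⟩ := hL'
  have hc : conjSub (image (dress V (Submodule.span ℂ {l}) κ) (conjSub (Submodule.span ℂ {l}))) =
      Submodule.span ℂ {dress V (Submodule.span ℂ {conjE n l}) κ l} := by
    rw [conjSub_span_singleton, image_span_singleton, conjSub_span_singleton,
      conjE_dress hV hr ⟨l, rfl, h1, h3⟩, conjE_conjE, conjSub_span_singleton, hκr]
  rw [hc, mul_apply_eq_comp, conjSub_span_singleton, image_span_singleton]
  refine dress_permute hV h1 h3 h1' h3' hκ ha0 hb0 hκa hab ?_ _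
  -- The non-vanishing of the numerator `D` is the transversality of `L̂`.
  rw [conjSub_span_singleton, image_span_singleton] at hm
  obtain ⟨u, hu⟩ := Submodule.mem_span_singleton.1
    (hm ▸ Submodule.mem_span_singleton_self m)
  have := lor_dress_refl_self hV h1 h3 (k := conjE n l) hκ
  intro h0
  rw [h0, zero_div] at this
  apply hm3
  rw [← hu]
  simp [this]

end Reality

/-! ### Isotropic planes in a space of dimension four -/

section Planes

variable {V A B : Submodule ℂ (Cn n)} {w : Cn n} {T : Endo n}

theorem finrank_eq_one_of_forall {F : Submodule ℂ (Cn n)} {e : Cn n} (he : e ∈ F) (h0 : e ≠ 0)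
    (h : ∀ x ∈ F, ∃ c : ℂ, c • e = x) : Module.finrank ℂ F = 1 := by
  refine finrank_eq_one_iff'.2 ⟨⟨e, he⟩, fun h1 => h0 (congrArg Subtype.val h1), ?_⟩
  rintro ⟨x, hx⟩
  obtain ⟨c, hc⟩ := h x hx
  exact ⟨c, Subtype.ext hc⟩

theorem exists_of_finrank_eq_one {F : Submodule ℂ (Cn n)} (h : Module.finrank ℂ F = 1) :
    ∃ e ∈ F, e ≠ 0 ∧ ∀ x ∈ F, ∃ c : ℂ, c • e = x := by
  obtain ⟨⟨e, he⟩, h0, h1⟩ := finrank_eq_one_iff'.1 h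
  refine ⟨e, he, fun h2 => h0 (Subtype.ext h2), fun x hx => ?_⟩
  obtain ⟨c, hc⟩ := h1 ⟨x, hx⟩
  exact ⟨c, congrArg Subtype.val hc⟩

variable (hV : IsNondeg V) (h4 : Module.finrank ℂ V = 4)
  (hA : IsIsotropic A) (hA2 : Module.finrank ℂ A = 2) (hAV : A ≤ V)
  (hB : IsIsotropic B) (hB2 : Module.finrank ℂ B = 2) (hBV : B ≤ V)
  (hw : w ∈ V) (hww : lor n w w ≠ 0)
  (hT : ∀ x ∈ V, T x = x - (2 * lor n w x / lor n w w) • w)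

theorem span_pair_eq {C : Submodule ℂ (Cn n)} (hC2 : Module.finrank ℂ C = 2) {u e : Cn n}
    (hu : u ∈ C) (heC : e ∈ C) (he0 : e ≠ 0) (hue : ∀ c : ℂ, c • e ≠ u) :
    Submodule.span ℂ {u, e} = C := by
  apply Submodule.eq_of_le_of_finrank_eq
  · rw [Submodule.span_le]; rintro x (rfl | rfl) <;> assumption
  · have : LinearIndependent ℂ ![u, e] := by
      rw [LinearIndependent.pair_symm_iff, LinearIndependent.pair_iff' he0]
      exact hue
    have h2 := finrank_span_eq_card this
    rw [hC2]
    have h3 : Set.range ![u, e] = {u, e} := by simp [Matrix.range_cons, Set.pair_comm]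
    rw [h3] at h2
    exact h2.trans (Fintype.card_fin 2)

-- Both sides have dimension three, and each plane is orthogonal to the common vector `e`.
include hV h4 hA hA2 hAV hB hB2 hBV in
theorem sup_eq_inf_perp (hAB : Module.finrank ℂ ↥(A ⊓ B) = 1) {e : Cn n} (he : e ∈ A ⊓ B)
    (he0 : e ≠ 0) : A ⊔ B = V ⊓ perp (Submodule.span ℂ {e}) := by
  apply Submodule.eq_of_le_of_finrank_eq
  · refine le_inf (sup_le hAV hBV) (sup_le ?_ ?_)
    all_goals
      intro x hx
      refine mem_perp.2 fun y hy => ?_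
      obtain ⟨c, rfl⟩ := Submodule.mem_span_singleton.1 hy
    · simp [hA e he.1 x hx]
    · simp [hB e he.2 x hx]
  · have d1 := Submodule.finrank_sup_add_finrank_inf_eq A B
    have d2 : V ⊓ perp (Submodule.span ℂ {e}) = perp (perp V ⊔ Submodule.span ℂ {e}) := by
      rw [perp_sup, perp_perp]
    have d3 : perp V ⊓ Submodule.span ℂ {e} = ⊥ := by
      rw [eq_bot_iff]
      refine (inf_le_inf_left _ ?_).trans (by rw [inf_comm, hV])
      rw [Submodule.span_singleton_le_iff_mem]
      exact hAV he.1
    have d4 := Submodule.finrank_sup_add_finrank_inf_eq (perp V) (Submodule.span ℂ {e})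
    rw [d3, finrank_bot, finrank_perp, h4, finrank_span_singleton he0] at d4
    have d5 := finrank_le_dim V
    rw [d2, finrank_perp]
    omega

-- The intersection is `A ∩ w^⊥`, a hyperplane of `A`. It is not all of `A`: otherwise `w` would lie
-- in `V ∩ A^⊥ = A` and be null.
include hV h4 hA hA2 hAV hww hT hw in
theorem finrank_reflect_inf_self : Module.finrank ℂ ↥(image T A ⊓ A) = 1 := by
  have hwA : w ∉ A := fun h => hww (hA w h w h)
  have e1 : image T A ⊓ A = A ⊓ perp (Submodule.span ℂ {w}) := by
    ext y
    simp only [Submodule.mem_inf, mem_perp, Submodule.mem_span_singleton]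
    constructor
    · rintro ⟨⟨x, hx, rfl⟩, hy⟩
      refine ⟨hy, ?_⟩
      change T x ∈ A at hy
      have h1 : lor n w x = 0 := by
        by_contra h0
        rw [hT x (hAV hx)] at hy
        have h2 := A.sub_mem hx hy
        rw [sub_sub_cancel] at h2
        exact hwA ((A.smul_mem_iff (div_ne_zero (mul_ne_zero two_ne_zero h0) hww)).1 h2)
      rintro _ ⟨c, rfl⟩
      change lor n (c • w) (T x) = 0
      rw [hT x (hAV hx)]
      simp [h1]
    · rintro ⟨hy, h1⟩
      have h2 := h1 w ⟨1, one_smul _ _⟩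
      refine ⟨⟨y, hy, ?_⟩, hy⟩
      change T y = y
      rw [hT y (hAV hy), h2]
      simp
  rw [e1]
  have hw0 : w ≠ 0 := by rintro rfl; simp at hww
  have d1 := finrank_perp (Submodule.span ℂ {w})
  rw [finrank_span_singleton hw0] at d1
  have d2 := Submodule.finrank_sup_add_finrank_inf_eq A (perp (Submodule.span ℂ {w}))
  have d3 := finrank_le_dim (A ⊔ perp (Submodule.span ℂ {w}))
  have d4 := Submodule.finrank_mono (inf_le_left : A ⊓ perp (Submodule.span ℂ {w}) ≤ A)
  have d5 : Module.finrank ℂ ↥(A ⊓ perp (Submodule.span ℂ {w})) ≠ 2 := by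
    intro h
    have h1 := Submodule.eq_of_le_of_finrank_eq
      (inf_le_left : A ⊓ perp (Submodule.span ℂ {w}) ≤ A) (by rw [h, hA2])
    apply hwA
    rw [← isotropic_perp_eq hV h4 hA hA2 hAV]
    refine ⟨hw, mem_perp'.2 fun y hy => ?_⟩
    rw [← h1] at hy
    exact mem_perp.1 hy.2 w (Submodule.mem_span_singleton_self w)
  omega

-- Write `w = a + b` along `V = A ⊕ B`; then `T a = -b`, and `b` spans the intersection.
include h4 hA hA2 hAV hB hB2 hBV hww hT hw in
theorem finrank_reflect_inf_of_disjoint (hAB : A ⊓ B = ⊥) :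
    Module.finrank ℂ ↥(image T A ⊓ B) = 1 := by
  have hs : A ⊔ B = V := by
    apply Submodule.eq_of_le_of_finrank_eq (sup_le hAV hBV)
    have := Submodule.finrank_sup_add_finrank_inf_eq A B
    rw [hAB, finrank_bot] at this
    omega
  obtain ⟨a, ha, b, hb, rfl⟩ := Submodule.mem_sup.1 (hs.symm ▸ hw)
  have e1 : lor n (a + b) (a + b) = 2 * lor n a b := by
    simp only [map_add, LinearMap.add_apply, hA a ha a ha, hB b hb b hb, lor_symm b a]
    ring
  have hab : lor n a b ≠ 0 := by rw [e1] at hww; exact right_ne_zero_of_mul hww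
  have e2 : T a = -b := by
    rw [hT a (hAV ha), e1]
    simp only [map_add, LinearMap.add_apply, hA a ha a ha, lor_symm b a, zero_add, ne_eq,
      mul_eq_zero, OfNat.ofNat_ne_zero, hab, or_self, not_false_eq_true, div_self, one_smul]
    abel
  have hb0 : b ≠ 0 := by rintro rfl; simp at hab
  refine finrank_eq_one_of_forall (e := b) ⟨⟨-a, A.neg_mem ha, ?_⟩, hb⟩ hb0 ?_
  · change T (-a) = b
    rw [map_neg, e2, neg_neg]
  · rintro y ⟨⟨x, hx, rfl⟩, hy⟩
    change T x ∈ B at hy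
    have h1 := hT x (hAV hx)
    set c := 2 * lor n (a + b) x / lor n (a + b) (a + b)
    have h2 : x - c • a = T x + c • b := by rw [h1, smul_add]; abel
    have h3 : x - c • a ∈ A ⊓ B := by
      refine ⟨A.sub_mem hx (A.smul_mem _ ha), ?_⟩
      rw [h2]; exact B.add_mem hy (B.smul_mem _ hb)
    rw [hAB, Submodule.mem_bot, h2, add_eq_zero_iff_eq_neg] at h3
    exact ⟨-c, by change _ = T x; rw [h3, neg_smul]⟩

-- Let `e` span `A ∩ B`. If `w ⟂ e`, then `w = a + b` lies in `A + B`, and the reflection sends `a`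
-- to `-b` and fixes `e`, so it maps `A` to `B`. If not, pairing `T x ∈ B` with `e` gives `(w, x) =
-- 0`, so that `x = T x` is a multiple of `e` orthogonal to `w`, hence zero.
include hV h4 hA hA2 hAV hB hB2 hBV hww hT hw in
theorem reflect_eq_or_disjoint (hAB : Module.finrank ℂ ↥(A ⊓ B) = 1) :
    image T A ≤ B ∨ image T A ⊓ B = ⊥ := by
  obtain ⟨e, he, he0, hmul⟩ := exists_of_finrank_eq_one hAB
  by_cases hwe : lor n w e = 0
  · left
    have hs := sup_eq_inf_perp hV h4 hA hA2 hAV hB hB2 hBV hAB he he0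
    have hwp : w ∈ V ⊓ perp (Submodule.span ℂ {e}) := by
      refine ⟨hw, mem_perp'.2 fun y hy => ?_⟩
      obtain ⟨c, rfl⟩ := Submodule.mem_span_singleton.1 hy
      simp [hwe]
    obtain ⟨a, ha, b, hb, rfl⟩ := Submodule.mem_sup.1 (hs.symm ▸ hwp)
    have e1 : lor n (a + b) (a + b) = 2 * lor n a b := by
      simp only [map_add, LinearMap.add_apply, hA a ha a ha, hB b hb b hb, lor_symm b a]
      ring
    have hab : lor n a b ≠ 0 := by rw [e1] at hww; exact right_ne_zero_of_mul hww
    have hA' := span_pair_eq hA2 ha he.1 he0 (by rintro c rfl; simp [hB e he.2 b hb] at hab)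
    have hB' := span_pair_eq hB2 hb he.2 he0 (by rintro c rfl; simp [hA a ha e he.1] at hab)
    rintro _ ⟨x, hx, rfl⟩
    change T x ∈ B
    rw [hT x (hAV hx), e1]
    rw [SetLike.mem_coe, ← hA', Submodule.mem_span_pair] at hx
    obtain ⟨s, t, rfl⟩ := hx
    have h1 : lor n (a + b) (s • a + t • e) = s * lor n a b := by
      simp only [map_add, map_smul, LinearMap.add_apply, hA a ha a ha, hA a ha e he.1,
        hB b hb e he.2, lor_symm b a, smul_eq_mul]
      ring
    have h2 : s • a + t • e - (2 * lor n (a + b) (s • a + t • e) / (2 * lor n a b)) • (a + b) =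
        t • e - s • b := by
      rw [h1]
      have : 2 * (s * lor n a b) / (2 * lor n a b) = s := by field_simp
      rw [this]; module
    rw [h2]
    exact B.sub_mem (B.smul_mem _ he.2) (B.smul_mem _ hb)
  · right
    rw [eq_bot_iff]
    rintro y ⟨⟨x, hx, rfl⟩, hy⟩
    change T x ∈ B at hy
    change T x = 0
    have h1 := hT x (hAV hx)
    set c := 2 * lor n w x / lor n w w with hc
    have h2 := hB e he.2 _ hy
    rw [h1, map_sub, hA e he.1 x hx, map_smul, lor_symm e w, zero_sub, neg_eq_zero, smul_eq_mul,
      mul_eq_zero, or_iff_left hwe] at h2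
    rw [h2, zero_smul, sub_zero] at h1
    have h3 : x ∈ A ⊓ B := ⟨hx, h1 ▸ hy⟩
    obtain ⟨t, rfl⟩ := hmul x h3
    rw [hc, div_eq_zero_iff, or_iff_left hww, mul_eq_zero, or_iff_right two_ne_zero, map_smul,
      smul_eq_mul, mul_eq_zero, or_iff_left hwe] at h2
    rw [h1, h2, zero_smul]

end Planes

/-! ### Calculus with complex bilinear maps -/

section Calculus

variable {E F G : Type*} [NormedAddCommGroup E] [NormedSpace ℂ E] [NormedAddCommGroup F]
  [NormedSpace ℂ F] [NormedAddCommGroup G] [NormedSpace ℂ G]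

/-- The `(1,0)`-part of a covector for `η = 1`, the `(0,1)`-part for `η = -1`, evaluated on a
vector. -/
def pt (η : ℂ) (θ : ℂ →L[ℝ] E) (v : ℂ) : E :=
  (1 / 2 : ℂ) • (θ v - (η * Complex.I) • θ (Complex.I * v))

/-- The part of type `η` of the differential. -/
def pder (η : ℂ) (f : ℂ → E) (z v : ℂ) : E := pt η (fderiv ℝ f z) v

theorem part10_apply (θ : ℂ →L[ℝ] E) (v : ℂ) : part10 θ v = pt 1 θ v := by
  simp [part10, pt, compJ]

theorem part01_apply (θ : ℂ →L[ℝ] E) (v : ℂ) : part01 θ v = pt (-1) θ v := by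
  simp [part01, pt, compJ]

theorem pt_add_pt (θ : ℂ →L[ℝ] E) (v : ℂ) : pt 1 θ v + pt (-1) θ v = θ v := by
  simp only [pt]; module

theorem pt_add (η : ℂ) (θ θ' : ℂ →L[ℝ] E) (v : ℂ) : pt η (θ + θ') v = pt η θ v + pt η θ' v := by
  simp only [pt, add_apply]; module

theorem pt_smul (η c : ℂ) (θ : ℂ →L[ℝ] E) (v : ℂ) : pt η (c • θ) v = c • pt η θ v := by
  simp only [pt, smul_apply]; module

theorem pt_neg (η : ℂ) (θ : ℂ →L[ℝ] E) (v : ℂ) : pt η (-θ) v = -pt η θ v := by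
  simp only [pt, neg_apply]; module

theorem pt_part10 {η : ℂ} (hη : η = 1 ∨ η = -1) (θ : ℂ →L[ℝ] E) (v : ℂ) :
    pt η (part10 θ) v = ((1 + η) / 2) • pt η θ v := by
  have e : Complex.I * (Complex.I * v) = -v := by rw [← mul_assoc, Complex.I_mul_I]; ring
  simp only [pt, part10, compJ, smul_apply, sub_apply, ContinuousLinearMap.comp_apply,
    ContinuousLinearMap.mul_apply', e, map_neg]
  rcases hη with rfl | rfl
  · match_scalars <;> ring_nf <;> simp <;> ring
  · match_scalars <;> ring_nf <;> simp

theorem pt_part01 {η : ℂ} (hη : η = 1 ∨ η = -1) (θ : ℂ →L[ℝ] E) (v : ℂ) :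
    pt η (part01 θ) v = ((1 - η) / 2) • pt η θ v := by
  have e : θ = part10 θ + part01 θ := by
    ext u; rw [add_apply, part10_apply, part01_apply, pt_add_pt]
  have h := pt_part10 hη θ v
  have h2 := pt_add η (part10 θ) (part01 θ) v
  rw [← e, h] at h2
  have h3 := eq_sub_of_add_eq' h2.symm
  rw [h3]
  module

theorem pt_comp (η : ℂ) (T : E →L[ℂ] F) (θ : ℂ →L[ℝ] E) (v : ℂ) :
    pt η ((T.restrictScalars ℝ).comp θ) v = T (pt η θ v) := by
  simp [pt]

theorem pder_congr {η : ℂ} {U : Set ℂ} (hU : IsOpen U) {f g : ℂ → E} (h : ∀ z ∈ U, f z = g z)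
    {z : ℂ} (hz : z ∈ U) (v : ℂ) : pder η f z v = pder η g z v := by
  have : f =ᶠ[nhds z] g := Filter.eventuallyEq_of_mem (hU.mem_nhds hz) h
  rw [pder, pder, this.fderiv_eq]

theorem fderiv_clm (T : E →L[ℂ] F) {f : ℂ → E} {z : ℂ} (hf : DifferentiableAt ℝ f z) (v : ℂ) :
    fderiv ℝ (fun w => T (f w)) z v = T (fderiv ℝ f z v) := by
  have h := ((T.restrictScalars ℝ).hasFDerivAt (x := f z)).comp z hf.hasFDerivAt
  have h2 : HasFDerivAt (fun w => T (f w)) ((T.restrictScalars ℝ).comp (fderiv ℝ f z)) z := h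
  rw [h2.fderiv]; rfl

theorem pder_clm (η : ℂ) (T : E →L[ℂ] F) {f : ℂ → E} {z : ℂ} (hf : DifferentiableAt ℝ f z)
    (v : ℂ) : pder η (fun w => T (f w)) z v = T (pder η f z v) := by
  simp [pder, pt, fderiv_clm T hf]

theorem fderiv_bilin (B : E →L[ℂ] F →L[ℂ] G) {f : ℂ → E} {g : ℂ → F} {z : ℂ}
    (hf : DifferentiableAt ℝ f z) (hg : DifferentiableAt ℝ g z) (v : ℂ) :
    fderiv ℝ (fun w => B (f w) (g w)) z v = B (fderiv ℝ f z v) (g z) + B (f z) (fderiv ℝ g z v) := by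
  have h := (B.bilinearRestrictScalars ℝ).hasFDerivAt_of_bilinear hf.hasFDerivAt hg.hasFDerivAt
  have h2 : HasFDerivAt (fun w => B (f w) (g w)) _ z := h
  rw [h2.fderiv]
  simp [add_comm]

theorem pder_bilin (η : ℂ) (B : E →L[ℂ] F →L[ℂ] G) {f : ℂ → E} {g : ℂ → F} {z : ℂ}
    (hf : DifferentiableAt ℝ f z) (hg : DifferentiableAt ℝ g z) (v : ℂ) :
    pder η (fun w => B (f w) (g w)) z v = B (pder η f z v) (g z) + B (f z) (pder η g z v) := by
  simp only [pder, pt, fderiv_bilin B hf hg, map_smul, map_sub, smul_apply, sub_apply]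
  module

theorem contDiffOn_bilin (B : E →L[ℂ] F →L[ℂ] G) {f : ℂ → E} {g : ℂ → F} {U : Set ℂ}
    (hf : ContDiffOn ℝ ∞ f U) (hg : ContDiffOn ℝ ∞ g U) :
    ContDiffOn ℝ ∞ (fun w => B (f w) (g w)) U :=
  (B.bilinearRestrictScalars ℝ).isBoundedBilinearMap.contDiff.comp₂_contDiffOn hf hg

theorem _root_.ContDiffOn.differentiableAt_of_isOpen {E : Type*} [NormedAddCommGroup E]
    [NormedSpace ℝ E] {f : ℂ → E} {U : Set ℂ} (hf : ContDiffOn ℝ ∞ f U)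
    (hU : IsOpen U) {z : ℂ} (hz : z ∈ U) : DifferentiableAt ℝ f z :=
  (hf.contDiffAt (hU.mem_nhds hz)).differentiableAt (by simp)

theorem contDiffOn_of_locally {f : ℂ → E} {U : Set ℂ}
    (h : ∀ z ∈ U, ∃ O : Set ℂ, IsOpen O ∧ z ∈ O ∧ ContDiffOn ℝ ∞ f O) : ContDiffOn ℝ ∞ f U := by
  intro z hz
  obtain ⟨O, hO, hzO, hf⟩ := h z hz
  exact (hf.contDiffAt (hO.mem_nhds hzO)).contDiffWithinAt

end Calculus

/-! ### Product rules and smoothness for endomorphisms, vectors and the metric -/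

section Endo

theorem fderiv_mul_endo {f g : ℂ → Endo n} {z : ℂ} (hf : DifferentiableAt ℝ f z)
    (hg : DifferentiableAt ℝ g z) (v : ℂ) :
    fderiv ℝ (fun w => f w * g w) z v = fderiv ℝ f z v * g z + f z * fderiv ℝ g z v :=
  fderiv_bilin (ContinuousLinearMap.mul ℂ (Endo n)) hf hg v

theorem pder_mul (η : ℂ) {f g : ℂ → Endo n} {z : ℂ} (hf : DifferentiableAt ℝ f z)
    (hg : DifferentiableAt ℝ g z) (v : ℂ) :
    pder η (fun w => f w * g w) z v = pder η f z v * g z + f z * pder η g z v :=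
  pder_bilin η (ContinuousLinearMap.mul ℂ (Endo n)) hf hg v

theorem pder_apply (η : ℂ) {f : ℂ → Endo n} {g : ℂ → Cn n} {z : ℂ} (hf : DifferentiableAt ℝ f z)
    (hg : DifferentiableAt ℝ g z) (v : ℂ) :
    pder η (fun w => f w (g w)) z v = pder η f z v (g z) + f z (pder η g z v) :=
  pder_bilin η (ContinuousLinearMap.id ℂ (Endo n)) hf hg v

theorem pder_apply_const (η : ℂ) {f : ℂ → Endo n} {z : ℂ} (hf : DifferentiableAt ℝ f z)
    (x : Cn n) (v : ℂ) : pder η (fun w => f w x) z v = pder η f z v x :=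
  pder_clm η (ContinuousLinearMap.apply ℂ (Cn n) x) hf v

theorem contDiffOn_mul {f g : ℂ → Endo n} {U : Set ℂ} (hf : ContDiffOn ℝ ∞ f U)
    (hg : ContDiffOn ℝ ∞ g U) : ContDiffOn ℝ ∞ (fun w => f w * g w) U :=
  contDiffOn_bilin (ContinuousLinearMap.mul ℂ (Endo n)) hf hg

theorem contDiffOn_apply {f : ℂ → Endo n} {g : ℂ → Cn n} {U : Set ℂ} (hf : ContDiffOn ℝ ∞ f U)
    (hg : ContDiffOn ℝ ∞ g U) : ContDiffOn ℝ ∞ (fun w => f w (g w)) U :=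
  contDiffOn_bilin (ContinuousLinearMap.id ℂ (Endo n)) hf hg

/-- The metric as a continuous bilinear map. -/
def lorL (n : ℕ) : Cn n →L[ℂ] Cn n →L[ℂ] ℂ :=
  LinearMap.toContinuousLinearMap
    ((LinearMap.toContinuousLinearMap (𝕜 := ℂ) (E := Cn n) (F' := ℂ)).toLinearMap ∘ₗ lor n)

/-- `rankOne` as a continuous bilinear map. -/
def rankOneL (n : ℕ) : Cn n →L[ℂ] Cn n →L[ℂ] Endo n :=
  ((ContinuousLinearMap.smulRightL ℂ (Cn n) (Cn n)).comp (lorL n)).flip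

theorem contDiffOn_lor {f g : ℂ → Cn n} {U : Set ℂ} (hf : ContDiffOn ℝ ∞ f U)
    (hg : ContDiffOn ℝ ∞ g U) : ContDiffOn ℝ ∞ (fun w => lor n (f w) (g w)) U :=
  contDiffOn_bilin (lorL n) hf hg

theorem pder_lor (η : ℂ) {f g : ℂ → Cn n} {z : ℂ} (hf : DifferentiableAt ℝ f z)
    (hg : DifferentiableAt ℝ g z) (v : ℂ) :
    pder η (fun w => lor n (f w) (g w)) z v =
      lor n (pder η f z v) (g z) + lor n (f z) (pder η g z v) :=
  pder_bilin η (lorL n) hf hg v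

theorem contDiffOn_rankOne {f g : ℂ → Cn n} {U : Set ℂ} (hf : ContDiffOn ℝ ∞ f U)
    (hg : ContDiffOn ℝ ∞ g U) : ContDiffOn ℝ ∞ (fun w => rankOne (f w) (g w)) U :=
  contDiffOn_bilin (rankOneL n) hf hg

end Endo

/-! ### Smoothness of projections -/

theorem contDiffOn_det {k : ℕ} {G : ℂ → Matrix (Fin k) (Fin k) ℂ} {U : Set ℂ}
    (h : ∀ i j, ContDiffOn ℝ ∞ (fun z => G z i j) U) : ContDiffOn ℝ ∞ (fun z => (G z).det) U := by
  simp only [Matrix.det_apply]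
  refine ContDiffOn.sum fun σ _ => ?_
  have : ContDiffOn ℝ ∞ (fun z => ∏ i, G z (σ i) i) U := contDiffOn_prod fun i _ => h _ _
  rcases Int.units_eq_one_or (Equiv.Perm.sign σ) with h1 | h1
  · simpa [h1] using this
  · simpa [h1] using this.neg

/-- In a local frame the projection is given by the inverse Gram matrix, written as adjugate over
determinant so that smoothness is polynomial apart from one division. -/
theorem IsSubbundleOn.contDiffOn_orthProj {k : ℕ} {U : Set ℂ} {V : ℂ → Submodule ℂ (Cn n)}
    (hV : IsSubbundleOn k U V) (hN : ∀ z ∈ U, IsNondeg (V z)) :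
    ContDiffOn ℝ ∞ (fun z => orthProj (V z)) U := by
  refine contDiffOn_of_locally fun z hz => ?_
  obtain ⟨O, hO, hzO, hOU, s, hs, hsp⟩ := hV z hz
  refine ⟨O, hO, hzO, ?_⟩
  let G : ℂ → Matrix (Fin k) (Fin k) ℂ := fun w => Matrix.of fun i j => lor n (s i w) (s j w)
  have hG (i j) : ContDiffOn ℝ ∞ (fun w => G w i j) O := contDiffOn_lor (hs i) (hs j)
  have hdet : ∀ w ∈ O, (G w).det ≠ 0 := by
    intro w hw h0
    obtain ⟨c, hc, hc0⟩ := Matrix.exists_mulVec_eq_zero_iff.2 h0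
    obtain ⟨hli, hspan⟩ := hsp w hw
    -- A kernel vector of the Gram matrix would be a vector of `V ∩ V^⊥`.
    have hx : ∑ j, c j • s j w ∈ V w ⊓ perp (V w) := by
      refine ⟨?_, ?_⟩
      · rw [SetLike.mem_coe, ← hspan]
        exact Submodule.sum_mem _ fun j _ =>
          Submodule.smul_mem _ _ (Submodule.subset_span ⟨j, rfl⟩)
      · rw [SetLike.mem_coe, mem_perp, ← hspan]
        intro y hy
        refine Submodule.span_induction ?_ ?_ ?_ ?_ hy
        · rintro _ ⟨i, rfl⟩
          have := congrFun hc0 i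
          simpa [Matrix.mulVec, dotProduct, G, mul_comm] using this
        · simp
        · intro a b _ _ ha hb; rw [map_add, LinearMap.add_apply, ha, hb, add_zero]
        · intro r a _ ha; rw [map_smul, LinearMap.smul_apply, ha, smul_zero]
    rw [hN w (hOU hw), Submodule.mem_bot] at hx
    exact hc (funext fun i => Fintype.linearIndependent_iff.1 hli c hx i)
  have hadj (i j) : ContDiffOn ℝ ∞ (fun w => (G w).adjugate i j) O := by
    simp only [Matrix.adjugate_apply]
    refine contDiffOn_det fun a b => ?_
    by_cases hab : a = j
    · subst hab; simpa using contDiffOn_const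
    · simpa [Matrix.updateRow_ne hab] using hG a b
  have key : ∀ w ∈ O, orthProj (V w) =
      ∑ i, ∑ j, ((G w).det)⁻¹ • (G w).adjugate i j • rankOne (s i w) (s j w) := by
    intro w hw
    obtain ⟨hli, hspan⟩ := hsp w hw
    have hmem (i) : s i w ∈ V w := by rw [← hspan]; exact Submodule.subset_span ⟨i, rfl⟩
    set T := ∑ i, ∑ j, ((G w).det)⁻¹ • (G w).adjugate i j • rankOne (s i w) (s j w) with hT
    have hTx (x) : T x = ∑ i, ((G w).det⁻¹ * ∑ j, (G w).adjugate i j * lor n (s j w) x) • s i w := by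
      simp only [hT, sum_apply, smul_apply, rankOne_apply, smul_smul, Finset.mul_sum,
        Finset.sum_smul, mul_assoc]
    have hTs (k') : T (s k' w) = s k' w := by
      rw [hTx]
      have e (i) : (G w).det⁻¹ * ∑ j, (G w).adjugate i j * lor n (s j w) (s k' w)
          = (1 : Matrix (Fin k) (Fin k) ℂ) i k' := by
        have := congrFun (congrFun (Matrix.adjugate_mul (G w)) i) k'
        rw [Matrix.mul_apply] at this
        simp only [Matrix.smul_apply, smul_eq_mul] at this
        change (G w).det⁻¹ * ∑ j, (G w).adjugate i j * G w j k' = _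
        rw [this, ← mul_assoc, inv_mul_cancel₀ (hdet w hw), one_mul]
      simp [e, Matrix.one_apply]
    have h3 : ∀ x ∈ V w, T x = x := by
      intro x hx
      rw [← hspan] at hx
      refine Submodule.span_induction ?_ ?_ ?_ ?_ hx
      · rintro _ ⟨i, rfl⟩; exact hTs i
      · simp
      · intro a b _ _ ha hb; rw [map_add, ha, hb]
      · intro r a _ ha; rw [map_smul, ha]
    have h4 : ∀ x ∈ perp (V w), T x = 0 := by
      intro x hx
      rw [hTx]
      simp [mem_perp.1 hx _ (hmem _)]
    ext1 x
    have e : x = orthProj (V w) x + (x - orthProj (V w) x) := by abel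
    conv_rhs => rw [e]
    rw [map_add, h3 _ (orthProj_mem (hN w (hOU hw)) x), h4 _ (sub_orthProj_mem (hN w (hOU hw)) x),
      add_zero]
  refine ContDiffOn.congr ?_ key
  refine ContDiffOn.sum fun i _ => ContDiffOn.sum fun j _ => ?_
  exact ((contDiffOn_det hG).inv hdet).smul ((hadj i j).smul (contDiffOn_rankOne (hs i) (hs j)))

/-! ### Flatness -/

/-- This is `F_B g = g F_A`: `h1` and `h2` are the gauge equation differentiated in two directions,
and `s` is the common mixed second derivative of `g`. -/
theorem curvature_gauge {R : Type*} [Ring R] {g gu gv s au av bu bv duv dvu euv evu : R}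
    (h1 : euv * g + bv * gu = gu * av + g * duv - s)
    (h2 : evu * g + bu * gv = gv * au + g * dvu - s)
    (ku : bu * g = g * au - gu) (kv : bv * g = g * av - gv)
    (hF : duv - dvu + (au * av - av * au) = 0) :
    (euv - evu + (bu * bv - bv * bu)) * g = 0 := by
  have gu' : gu = g * au - bu * g := by rw [ku]; abel
  have gv' : gv = g * av - bv * g := by rw [kv]; abel
  subst gu' gv'
  have e1 := eq_sub_of_add_eq h1
  have e2 := eq_sub_of_add_eq h2
  have : (euv - evu + (bu * bv - bv * bu)) * g = g * (duv - dvu + (au * av - av * au)) := by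
    rw [add_mul, sub_mul, e1, e2]
    noncomm_ring
  rw [this, hF, mul_zero]

theorem fderiv_form_apply {A : ℂ → ℂ →L[ℝ] Endo n} {z : ℂ} (hA : DifferentiableAt ℝ A z)
    (u v : ℂ) : fderiv ℝ (fun w => A w v) z u = fderiv ℝ A z u v := by
  rw [(hA.hasFDerivAt.clm_apply (hasFDerivAt_const v z)).fderiv]
  simp

theorem isFlatOn_gauge {U : Set ℂ} (hU : IsOpen U) {A B : ℂ → ℂ →L[ℝ] Endo n}
    {g g' : ℂ → Endo n} (hA : ContDiffOn ℝ ∞ A U) (hB : ContDiffOn ℝ ∞ B U)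
    (hg : ContDiffOn ℝ ∞ g U) (hg' : ∀ z ∈ U, g z * g' z = 1)
    (h : ∀ z ∈ U, ∀ v, B z v * g z = g z * A z v - fderiv ℝ g z v) (hf : IsFlatOn U A) :
    IsFlatOn U B := by
  intro z hz u v
  have dA := hA.differentiableAt_of_isOpen hU hz
  have dB := hB.differentiableAt_of_isOpen hU hz
  have dg := hg.differentiableAt_of_isOpen hU hz
  have hg1 : ContDiffOn ℝ ∞ (fderiv ℝ g) U := hg.fderiv_of_isOpen hU (by simp)
  have dg1 := hg1.differentiableAt_of_isOpen hU hz
  have sym : fderiv ℝ (fderiv ℝ g) z u v = fderiv ℝ (fderiv ℝ g) z v u := by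
    have := (hg.contDiffAt (hU.mem_nhds hz)).isSymmSndFDerivAt
      (by simp only [minSmoothness_of_isRCLikeNormedField]; exact WithTop.coe_le_coe.2 le_top)
    exact this u v
  have ap {C : ℂ → ℂ →L[ℝ] Endo n} (hC : DifferentiableAt ℝ C z) (y : ℂ) :
      DifferentiableAt ℝ (fun w => C w y) z := hC.clm_apply (differentiableAt_const y)
  have key (x y : ℂ) : fderiv ℝ B z x y * g z + B z y * fderiv ℝ g z x =
      fderiv ℝ g z x * A z y + g z * fderiv ℝ A z x y - fderiv ℝ (fderiv ℝ g) z x y := by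
    have e : (fun w => B w y * g w) =ᶠ[nhds z] fun w => g w * A w y - fderiv ℝ g w y :=
      Filter.eventuallyEq_of_mem (hU.mem_nhds hz) fun w hw => h w hw y
    have e2 := congrArg (fun T : ℂ →L[ℝ] Endo n => T x) e.fderiv_eq
    have m : DifferentiableAt ℝ (fun w => g w * A w y) z := dg.mul (ap dA y)
    rw [fderiv_mul_endo (ap dB y) dg, fderiv_fun_sub m (ap dg1 y), sub_apply,
      fderiv_mul_endo dg (ap dA y), fderiv_form_apply dB, fderiv_form_apply dA,
      fderiv_form_apply dg1] at e2
    exact e2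
  have h1 := key u v
  have h2 := key v u
  rw [← sym] at h2
  have := curvature_gauge h1 h2 (h z hz u) (h z hz v) (hf z hz u v)
  have h3 := congrArg (fun X => X * g' z) this
  simpa only [mul_assoc, hg' z hz, mul_one, zero_mul] using h3

theorem contDiffOn_form {A : ℂ → ℂ →L[ℝ] Endo n} {U : Set ℂ} :
    ContDiffOn ℝ ∞ A U ↔ ∀ v, ContDiffOn ℝ ∞ (fun z => A z v) U := contDiffOn_clm_apply

theorem contDiffOn_pt {A : ℂ → ℂ →L[ℝ] Endo n} {U : Set ℂ} (hA : ContDiffOn ℝ ∞ A U) (η v : ℂ) :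
    ContDiffOn ℝ ∞ (fun z => pt η (A z) v) U := by
  simp only [pt]
  exact ((contDiffOn_form.1 hA v).sub ((contDiffOn_form.1 hA _).const_smul _)).const_smul _

theorem contDiffOn_part10 {A : ℂ → ℂ →L[ℝ] Endo n} {U : Set ℂ} (hA : ContDiffOn ℝ ∞ A U) :
    ContDiffOn ℝ ∞ (fun z => part10 (A z)) U := by
  rw [contDiffOn_form]
  simp only [part10_apply]
  exact contDiffOn_pt hA 1

theorem contDiffOn_part01 {A : ℂ → ℂ →L[ℝ] Endo n} {U : Set ℂ} (hA : ContDiffOn ℝ ∞ A U) :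
    ContDiffOn ℝ ∞ (fun z => part01 (A z)) U := by
  rw [contDiffOn_form]
  simp only [part01_apply]
  exact contDiffOn_pt hA (-1)

theorem contDiffOn_formLoop {U : Set ℂ} {V : ℂ → Submodule ℂ (Cn n)} {q : ℂ → ℂ →L[ℝ] Endo n}
    (hD : ContDiffOn ℝ ∞ (formD V) U) (hq : ContDiffOn ℝ ∞ q U) (l : ℂ) :
    ContDiffOn ℝ ∞ (formLoop V q l) U := by
  have hN : ContDiffOn ℝ ∞ (formN V) U := hD.neg
  rw [contDiffOn_form] at hD ⊢
  intro v
  have h1 := contDiffOn_form.1 (contDiffOn_part10 hN) v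
  have h2 := contDiffOn_form.1 (contDiffOn_part01 hN) v
  have h3 := contDiffOn_form.1 (contDiffOn_part10 hq) v
  have h4 := contDiffOn_form.1 (contDiffOn_part01 hq) v
  exact ((((hD v).add (h1.const_smul l⁻¹)).add (h2.const_smul l)).add
    (h3.const_smul ((l ^ 2)⁻¹ - 1))).add (h4.const_smul (l ^ 2 - 1))

theorem fderiv_quadratic_loop {f₀ f₁ f₂ f₃ f₄ : ℂ → ℂ →L[ℝ] Endo n} {z : ℂ}
    (h₀ : DifferentiableAt ℝ f₀ z) (h₁ : DifferentiableAt ℝ f₁ z) (h₂ : DifferentiableAt ℝ f₂ z)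
    (h₃ : DifferentiableAt ℝ f₃ z) (h₄ : DifferentiableAt ℝ f₄ z) {c₁ c₂ c₃ c₄ : ℂ}
    (d : DifferentiableAt ℝ
      (fun w => f₀ w + c₁ • f₁ w + c₂ • f₂ w + c₃ • f₃ w + c₄ • f₄ w) z) (x y : ℂ) :
    fderiv ℝ (fun w => f₀ w + c₁ • f₁ w + c₂ • f₂ w + c₃ • f₃ w + c₄ • f₄ w) z x y =
      fderiv ℝ f₀ z x y + c₁ • fderiv ℝ f₁ z x y + c₂ • fderiv ℝ f₂ z x y
        + c₃ • fderiv ℝ f₃ z x y + c₄ • fderiv ℝ f₄ z x y := by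
  have ap {f : ℂ → ℂ →L[ℝ] Endo n} (h : DifferentiableAt ℝ f z) :
      HasFDerivAt (fun w => f w y) (fderiv ℝ (fun w => f w y) z) z :=
    (h.clm_apply (differentiableAt_const y)).hasFDerivAt
  have h : HasFDerivAt (fun w => f₀ w y + c₁ • f₁ w y + c₂ • f₂ w y + c₃ • f₃ w y + c₄ • f₄ w y)
      _ z := ((((ap h₀).add ((ap h₁).const_smul c₁)).add ((ap h₂).const_smul c₂)).add
        ((ap h₃).const_smul c₃)).add ((ap h₄).const_smul c₄)
  rw [← fderiv_form_apply d]
  simp only [add_apply, smul_apply]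
  rw [h.fderiv]
  simp only [add_apply, smul_apply, fderiv_form_apply h₀, fderiv_form_apply h₁,
    fderiv_form_apply h₂, fderiv_form_apply h₃, fderiv_form_apply h₄]

/-- At a fixed point the curvature is a Laurent polynomial in the spectral parameter, so it is
continuous there and vanishes at the finitely many excluded values too. -/
theorem isFlatOn_formLoop_of_cofinite {U : Set ℂ} (hU : IsOpen U) {V : ℂ → Submodule ℂ (Cn n)}
    {q : ℂ → ℂ →L[ℝ] Endo n} (hD : ContDiffOn ℝ ∞ (formD V) U) (hq : ContDiffOn ℝ ∞ q U)
    {S : Set ℂ} (hS : S.Finite) (h : ∀ l ∉ S, l ≠ 0 → IsFlatOn U (formLoop V q l)) {l : ℂ}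
    (hl : l ≠ 0) : IsFlatOn U (formLoop V q l) := by
  intro z hz u v
  have hNs : ContDiffOn ℝ ∞ (formN V) U := hD.neg
  have d0 := hD.differentiableAt_of_isOpen hU hz
  have d1 := (contDiffOn_part10 hNs).differentiableAt_of_isOpen hU hz
  have d2 := (contDiffOn_part01 hNs).differentiableAt_of_isOpen hU hz
  have d3 := (contDiffOn_part10 hq).differentiableAt_of_isOpen hU hz
  have d4 := (contDiffOn_part01 hq).differentiableAt_of_isOpen hU hz
  have e (k x y : ℂ) := fderiv_quadratic_loop d0 d1 d2 d3 d4
    ((contDiffOn_formLoop hD hq k).differentiableAt_of_isOpen hU hz) x y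
  let K : ℂ → Endo n := fun k => fderiv ℝ (formLoop V q k) z u v - fderiv ℝ (formLoop V q k) z v u
    + (formLoop V q k z u * formLoop V q k z v - formLoop V q k z v * formLoop V q k z u)
  have hc : ContinuousAt K l := by
    have hinv : ContinuousAt (fun k : ℂ => k⁻¹) l := continuousAt_inv₀ hl
    have hinv2 : ContinuousAt (fun k : ℂ => (k ^ 2)⁻¹) l :=
      ContinuousAt.inv₀ (by fun_prop) (pow_ne_zero 2 hl)
    have cl (a₀ a₁ a₂ a₃ a₄ : Endo n) : ContinuousAt (fun k : ℂ => a₀ + k⁻¹ • a₁ + k • a₂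
        + ((k ^ 2)⁻¹ - 1) • a₃ + (k ^ 2 - 1) • a₄) l :=
      ((((continuousAt_const.add (hinv.smul continuousAt_const)).add
        (continuousAt_id.smul continuousAt_const)).add
        ((hinv2.sub continuousAt_const).smul continuousAt_const)).add
        (((continuousAt_id.pow 2).sub continuousAt_const).smul continuousAt_const))
    have c1 (x y : ℂ) : ContinuousAt (fun k => fderiv ℝ (formLoop V q k) z x y) l := by
      exact (cl _ _ _ _ _).congr (.of_forall fun k => (e k x y).symm)
    have c2 (x : ℂ) : ContinuousAt (fun k => formLoop V q k z x) l := by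
      exact cl _ _ _ _ _
    exact ((c1 u v).sub (c1 v u)).add (((c2 u).mul (c2 v)).sub ((c2 v).mul (c2 u)))
  have h1 : Filter.Tendsto K (nhdsWithin l {l}ᶜ) (nhds (K l)) := hc.tendsto.mono_left nhdsWithin_le_nhds
  have h2 : ∀ᶠ k in nhdsWithin l {l}ᶜ, K k = 0 := by
    have f1 : ∀ᶠ k in nhdsWithin l {l}ᶜ, k ≠ 0 :=
      (eventually_ne_nhds hl).filter_mono nhdsWithin_le_nhds
    have f2 : ∀ᶠ k in nhdsWithin l {l}ᶜ, k ∉ S := by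
      have : (S \ {l})ᶜ ∈ nhds l :=
        ((hS.subset Set.sdiff_subset).isClosed.isOpen_compl).mem_nhds (by simp)
      filter_upwards [nhdsWithin_le_nhds this, self_mem_nhdsWithin] with k hk hk2 hkS
      exact hk ⟨hkS, hk2⟩
    filter_upwards [f1, f2] with k k1 k2
    exact h k k2 k1 z hz u v
  exact tendsto_nhds_unique h1 (tendsto_const_nhds.congr' (h2.mono fun k hk => hk.symm))

/-! ### The connection of a bundle of non-degenerate subspaces -/

section Connection

variable {U : Set ℂ} {V : ℂ → Submodule ℂ (Cn n)} {k : ℕ}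

theorem IsSubbundleOn.contDiffOn_refl (hV : IsSubbundleOn k U V) (hN : ∀ z ∈ U, IsNondeg (V z)) :
    ContDiffOn ℝ ∞ (fun z => refl (V z)) U :=
  (((hV.contDiffOn_orthProj hN).const_smul (2 : ℂ)).sub contDiffOn_const).congr
    fun z hz => refl_eq (hN z hz)

/-- Substitute `π = (1 + ρ)/2` and `π^⊥ = (1 - ρ)/2`. From here on `ρ` alone carries the geometry of
`V`. -/
theorem formD_apply (hU : IsOpen U) (hV : IsSubbundleOn k U V) (hN : ∀ z ∈ U, IsNondeg (V z))
    {z : ℂ} (hz : z ∈ U) (v : ℂ) :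
    formD V z v = (1 / 2 : ℂ) • (refl (V z) * fderiv ℝ (fun w => refl (V w)) z v) := by
  have d := (hV.contDiffOn_orthProj hN).differentiableAt_of_isOpen hU hz
  have e1 : fderiv ℝ (fun w => orthProjPerp (V w)) z = -fderiv ℝ (fun w => orthProj (V w)) z := by
    have : (fun w => orthProjPerp (V w)) =ᶠ[nhds z] fun w => 1 - orthProj (V w) :=
      Filter.eventuallyEq_of_mem (hU.mem_nhds hz) fun w hw => orthProjPerp_eq (hN w hw)
    rw [this.fderiv_eq]
    exact fderiv_const_sub _
  have e2 : fderiv ℝ (fun w => refl (V w)) z = (2 : ℂ) • fderiv ℝ (fun w => orthProj (V w)) z := by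
    have : (fun w => refl (V w)) =ᶠ[nhds z] fun w => (2 : ℂ) • orthProj (V w) - 1 :=
      Filter.eventuallyEq_of_mem (hU.mem_nhds hz) fun w hw => refl_eq (hN w hw)
    rw [this.fderiv_eq]
    exact ((d.hasFDerivAt.const_smul (2 : ℂ)).sub_const 1).fderiv
  have e3 : formD V z v = orthProj (V z) * fderiv ℝ (fun w => orthProj (V w)) z v
      + orthProjPerp (V z) * fderiv ℝ (fun w => orthProjPerp (V w)) z v := rfl
  rw [e3, e1, e2, orthProjPerp_eq (hN z hz), refl_eq (hN z hz), neg_apply, smul_apply,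
    endo_mul_neg, mul_smul_comm, sub_mul, sub_mul, smul_mul_assoc, one_mul]
  module

theorem contDiffOn_formD (hU : IsOpen U) (hV : IsSubbundleOn k U V)
    (hN : ∀ z ∈ U, IsNondeg (V z)) : ContDiffOn ℝ ∞ (formD V) U := by
  rw [contDiffOn_form]
  intro v
  have h := hV.contDiffOn_refl hN
  have h1 : ContDiffOn ℝ ∞ (fderiv ℝ fun w => refl (V w)) U := h.fderiv_of_isOpen hU (by simp)
  refine ContDiffOn.congr ?_ fun z hz => formD_apply hU hV hN hz v
  exact (contDiffOn_mul h (contDiffOn_form.1 h1 v)).const_smul (1 / 2 : ℂ)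

theorem pt_formD (hU : IsOpen U) (hV : IsSubbundleOn k U V) (hN : ∀ z ∈ U, IsNondeg (V z))
    {z : ℂ} (hz : z ∈ U) (η v : ℂ) :
    pt η (formD V z) v = (1 / 2 : ℂ) • (refl (V z) * pder η (fun w => refl (V w)) z v) := by
  simp only [pder, pt, formD_apply hU hV hN hz, mul_smul_comm, mul_sub]
  module

theorem pder_refl_anticomm (hU : IsOpen U) (hV : IsSubbundleOn k U V)
    (hN : ∀ z ∈ U, IsNondeg (V z)) {z : ℂ} (hz : z ∈ U) (η v : ℂ) :
    pder η (fun w => refl (V w)) z v * refl (V z) =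
      -(refl (V z) * pder η (fun w => refl (V w)) z v) := by
  have d := (hV.contDiffOn_refl hN).differentiableAt_of_isOpen hU hz
  have h := pder_mul η d d v
  rw [pder_congr hU (g := fun _ => (1 : Endo n)) (fun w hw => refl_mul_refl (hN w hw)) hz] at h
  have h0 : pder η (fun _ => (1 : Endo n)) z v = 0 := by simp [pder, pt]
  rw [h0] at h
  exact eq_neg_of_add_eq_zero_left h.symm

theorem isAdj_pder {f g : ℂ → Endo n} (hU : IsOpen U) {z : ℂ} (hz : z ∈ U)
    (hf : DifferentiableAt ℝ f z) (hg : DifferentiableAt ℝ g z)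
    (h : ∀ w ∈ U, IsAdj (f w) (g w)) (η v : ℂ) : IsAdj (pder η f z v) (pder η g z v) := by
  intro x y
  have dc (c : Cn n) : DifferentiableAt ℝ (fun _ : ℂ => c) z := differentiableAt_const c
  have ap {f : ℂ → Endo n} (hf : DifferentiableAt ℝ f z) (x : Cn n) :
      DifferentiableAt ℝ (fun w => f w x) z := by
    have := ((ContinuousLinearMap.apply ℂ (Cn n) x).restrictScalars ℝ).differentiableAt.comp z hf
    exact this
  have h0 (c : Cn n) : pder η (fun _ : ℂ => c) z v = 0 := by simp [pder, pt]
  have e := pder_congr (η := η) hU (f := fun w => lor n (f w x) y)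
    (g := fun w => lor n x (g w y)) (fun w hw => h w hw x y) hz v
  rw [pder_lor η (ap hf x) (dc y), pder_lor η (dc x) (ap hg y), h0, h0,
    pder_apply_const η hf, pder_apply_const η hg] at e
  simpa using e

theorem isAdj_refl {W : Submodule ℂ (Cn n)} (h : IsNondeg W) : IsAdj (refl W) (refl W) :=
  lor_refl h

/-- The coefficient of degree zero of the part of type `η` of `d_V^{λ,q}`. -/
def coeffA (η : ℂ) (V : ℂ → Submodule ℂ (Cn n)) (q : ℂ → ℂ →L[ℝ] Endo n) (z v : ℂ) : Endo n :=
  pt η (formD V z) v - pt η (q z) v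

/-- The spectral parameter in the part of type `η`: `λ⁻¹` for type `(1,0)`, `λ` for `(0,1)`. -/
def IsSpectral (η l μ : ℂ) : Prop := (η = 1 ∧ μ = l⁻¹) ∨ (η = -1 ∧ μ = l)

theorem pt_formLoop {q : ℂ → ℂ →L[ℝ] Endo n} {η l μ : ℂ} (h : IsSpectral η l μ) (z v : ℂ) :
    pt η (formLoop V q l z) v =
      coeffA η V q z v + μ • pt η (formN V z) v + μ ^ 2 • pt η (q z) v := by
  have hη : η = 1 ∨ η = -1 := h.imp And.left And.left
  simp only [formLoop, pt_add, pt_smul, pt_part10 hη, pt_part01 hη, coeffA]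
  rcases h with ⟨rfl, rfl⟩ | ⟨rfl, rfl⟩
  · match_scalars <;> ring
  · match_scalars <;> ring

/-- One half of the data of a constrained Willmore surface: for `η = 1`, `G = Λ^{1,0}` and
`F = Λ^{0,1}`; for `η = -1`, conversely. -/
structure IsHalfWillmore (η : ℂ) (U : Set ℂ) (G F V : ℂ → Submodule ℂ (Cn n))
    (q : ℂ → ℂ →L[ℝ] Endo n) : Prop where
  bundleG : IsSubbundleOn 2 U G
  isotropicG : ∀ z ∈ U, IsIsotropic (G z)
  isotropicF : ∀ z ∈ U, IsIsotropic (F z)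
  leG : ∀ z ∈ U, G z ≤ V z
  leF : ∀ z ∈ U, F z ≤ V z
  inter : IsSubbundleOn 1 U (fun z => G z ⊓ F z)
  deriv : ∀ (O : Set ℂ) (s : ℂ → Cn n), O ⊆ U → IsSectionOn (fun z => G z ⊓ F z) O s →
    ∀ z ∈ O, ∀ v : ℂ, pder η s z v ∈ G z
  central : ∀ z ∈ U, ∀ v : ℂ, ∀ x ∈ F z, pt η (formN V z) v x = 0
  multiplier : ∀ z ∈ U, ∀ v : ℂ, pt η (q z) v ∈ wedge2 (F z)

theorem IsConstrainedWillmoreOn.half10 {L10 L01 : ℂ → Submodule ℂ (Cn n)}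
    {q : ℂ → ℂ →L[ℝ] Endo n} (h : IsConstrainedWillmoreOn U L10 L01 V q) :
    IsHalfWillmore 1 U L10 L01 V q where
  bundleG := h.surface.bundle10
  isotropicG := h.surface.isotropic10
  isotropicF := h.surface.isotropic01
  leG z hz := le_sup_left.trans (h.central.le z hz)
  leF z hz := le_sup_right.trans (h.central.le z hz)
  inter := h.surface.bundle_inter
  deriv O s hO hs z hz v := by
    have := h.surface.deriv10 O s hO hs z hz v; rwa [part10_apply] at this
  central z hz v x hx := by
    have := h.central.central10 z hz v x hx; rwa [part10_apply] at this
  multiplier z hz v := by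
    have := h.multiplier10 z hz v; rwa [part10_apply] at this

theorem IsConstrainedWillmoreOn.half01 {L10 L01 : ℂ → Submodule ℂ (Cn n)}
    {q : ℂ → ℂ →L[ℝ] Endo n} (h : IsConstrainedWillmoreOn U L10 L01 V q) :
    IsHalfWillmore (-1) U L01 L10 V q where
  bundleG := h.surface.bundle01
  isotropicG := h.surface.isotropic01
  isotropicF := h.surface.isotropic10
  leG z hz := le_sup_right.trans (h.central.le z hz)
  leF z hz := le_sup_left.trans (h.central.le z hz)
  inter := by simpa only [inf_comm] using h.surface.bundle_inter
  deriv O s hO hs z hz v := by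
    have := h.surface.deriv01 O s hO (by simpa only [inf_comm] using hs) z hz v
    rwa [part01_apply] at this
  central z hz v x hx := by
    have := h.central.central01 z hz v x hx; rwa [part01_apply] at this
  multiplier z hz v := by
    have := h.multiplier01 z hz v; rwa [part01_apply] at this

theorem pt_formN (hU : IsOpen U) (hV : IsSubbundleOn k U V) (hN : ∀ z ∈ U, IsNondeg (V z))
    {z : ℂ} (hz : z ∈ U) (η v : ℂ) :
    pt η (formN V z) v = (-1 / 2 : ℂ) • (refl (V z) * pder η (fun w => refl (V w)) z v) := by
  rw [formN, pt_neg, pt_formD hU hV hN hz]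
  module

/-- From `ρ² = 1` the derivative `δ` anticommutes with `ρ`; hence `±½ ρ δ` is skew and odd and `[ρ,
½ ρ δ] = δ`. The multiplier commutes with `ρ` and does not disturb these relations. -/
theorem IsHalfWillmore.isHalfLoop {η : ℂ} {G F : ℂ → Submodule ℂ (Cn n)}
    {q : ℂ → ℂ →L[ℝ] Endo n} (h : IsHalfWillmore η U G F V q) (hU : IsOpen U)
    (hV : IsSubbundleOn k U V) (hN : ∀ z ∈ U, IsNondeg (V z)) {z : ℂ} (hz : z ∈ U) (v : ℂ) :
    IsHalfLoop (V z) (pder η (fun w => refl (V w)) z v) (coeffA η V q z v) (pt η (formN V z) v)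
      (pt η (q z) v) (F z) := by
  have d := (hV.contDiffOn_refl hN).differentiableAt_of_isOpen hU hz
  have anti := pder_refl_anticomm hU hV hN hz η v
  have adj := isAdj_pder hU hz d d (fun w hw => isAdj_refl (hN w hw)) η v
  have rr := refl_mul_refl (hN z hz)
  have a1 := pt_formD hU hV hN hz η v
  have b1 := pt_formN hU hV hN hz η v
  set δ := pder η (fun w => refl (V w)) z v
  have skew : IsSkew (refl (V z) * δ) := by
    have := (isAdj_refl (hN z hz)).mul adj
    rw [anti] at this
    exact isSkew_iff.2 this
  have hc := h.multiplier z hz v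
  have rrδ : refl (V z) * (refl (V z) * δ) = δ := by rw [← mul_assoc, rr, one_mul]
  have rδr : refl (V z) * δ * refl (V z) = -δ := by
    rw [mul_assoc, anti, endo_mul_neg, rrδ]
  refine ⟨?_, ?_, ?_, ?_, hc, h.leF z hz, h.isotropicF z hz, h.central z hz v⟩
  · rw [coeffA, a1]
    exact (skew.smul _).sub (isSkew_of_mem_wedge2 hc)
  · rw [b1]; exact skew.smul _
  · have comm : refl (V z) * pt η (q z) v = pt η (q z) v * refl (V z) := by
      ext1 x
      have h1 : refl (V z) (pt η (q z) v x) = pt η (q z) v x :=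
        refl_of_mem (hN z hz) (h.leF z hz (wedge2_apply_mem hc x))
      have h2 : pt η (q z) v (x - refl (V z) x) = 0 := by
        refine wedge2_apply_perp hc (perp_anti (h.leF z hz) ?_)
        rw [mem_perp_iff_refl (hN z hz), map_sub, refl_refl (hN z hz)]; abel
      rw [map_sub, sub_eq_zero] at h2
      rw [mul_apply_eq_comp, mul_apply_eq_comp, h1, h2]
    rw [coeffA, a1, mul_sub, sub_mul, comm, mul_smul_comm, smul_mul_assoc, rrδ, rδr]
    module
  · rw [b1, mul_smul_comm, smul_mul_assoc, rrδ, rδr]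
    module

end Connection

/-! ### Orthogonal endomorphisms -/

theorem IsOrth.injective {T : Endo n} (h : IsOrth T) : Function.Injective T := by
  rw [injective_iff_map_eq_zero]
  intro x hx
  refine eq_zero_of_lor fun y => ?_
  rw [← h, hx, map_zero, LinearMap.zero_apply]

theorem IsOrth.isUnit {T : Endo n} (h : IsOrth T) : IsUnit T := by
  rw [ContinuousLinearMap.isUnit_iff_bijective]
  exact ⟨h.injective,
    (LinearMap.injective_iff_surjective (f := (T : Cn n →ₗ[ℂ] Cn n))).1 h.injective⟩

theorem IsOrth.mul_inverse {T : Endo n} (h : IsOrth T) : T * Ring.inverse T = 1 :=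
  Ring.mul_inverse_cancel T h.isUnit

theorem IsOrth.inverse_mul {T : Endo n} (h : IsOrth T) : Ring.inverse T * T = 1 :=
  Ring.inverse_mul_cancel T h.isUnit

theorem IsOrth.apply_inverse {T : Endo n} (h : IsOrth T) (x : Cn n) : T (Ring.inverse T x) = x := by
  rw [← mul_apply_eq_comp, h.mul_inverse]; rfl

theorem IsOrth.inverse_apply {T : Endo n} (h : IsOrth T) (x : Cn n) : Ring.inverse T (T x) = x := by
  rw [← mul_apply_eq_comp, h.inverse_mul]; rfl

theorem IsOrth.inverse {T : Endo n} (h : IsOrth T) : IsOrth (Ring.inverse T) := fun x y => by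
  rw [← h, h.apply_inverse, h.apply_inverse]

theorem IsOrth.mul {S T : Endo n} (hS : IsOrth S) (hT : IsOrth T) : IsOrth (S * T) := fun x y => by
  rw [mul_apply_eq_comp, mul_apply_eq_comp, hS, hT]

theorem IsOrth.mem_image {T : Endo n} (h : IsOrth T) {F : Submodule ℂ (Cn n)} {x : Cn n} :
    x ∈ image T F ↔ Ring.inverse T x ∈ F := by
  constructor
  · rintro ⟨y, hy, rfl⟩
    change Ring.inverse T (T y) ∈ F
    rwa [h.inverse_apply]
  · exact fun hx => ⟨_, hx, h.apply_inverse x⟩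

theorem IsOrth.perp_image {T : Endo n} (h : IsOrth T) (F : Submodule ℂ (Cn n)) :
    perp (image T F) = image T (perp F) := by
  ext x
  rw [h.mem_image, mem_perp, mem_perp]
  constructor
  · intro hx y hy
    rw [← h, h.apply_inverse]
    exact hx _ ⟨y, hy, rfl⟩
  · rintro hx _ ⟨y, hy, rfl⟩
    have := hx y hy
    rwa [← h, h.apply_inverse] at this

theorem IsOrth.image_inf {T : Endo n} (h : IsOrth T) (F G : Submodule ℂ (Cn n)) :
    image T (F ⊓ G) = image T F ⊓ image T G := Submodule.map_inf _ h.injective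

theorem IsOrth.isNondeg_image {T : Endo n} (h : IsOrth T) {F : Submodule ℂ (Cn n)}
    (hF : IsNondeg F) : IsNondeg (image T F) := by
  rw [IsNondeg, h.perp_image, ← h.image_inf, hF]
  exact Submodule.map_bot _

theorem IsOrth.isIsotropic_image {T : Endo n} (h : IsOrth T) {F : Submodule ℂ (Cn n)}
    (hF : IsIsotropic F) : IsIsotropic (image T F) := by
  rintro _ ⟨x, hx, rfl⟩ _ ⟨y, hy, rfl⟩
  exact (h x y).trans (hF x hx y hy)

theorem IsOrth.finrank_image {T : Endo n} (h : IsOrth T) (F : Submodule ℂ (Cn n)) :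
    Module.finrank ℂ (image T F) = Module.finrank ℂ F :=
  (LinearEquiv.finrank_eq (Submodule.equivMapOfInjective (T : Cn n →ₗ[ℂ] Cn n) h.injective F)).symm

theorem image_mono (T : Endo n) {F G : Submodule ℂ (Cn n)} (h : F ≤ G) : image T F ≤ image T G :=
  Submodule.map_mono h

theorem IsOrth.refl_image {T : Endo n} (h : IsOrth T) {V : Submodule ℂ (Cn n)}
    (hV : IsNondeg V) : refl (image T V) = T * refl V * Ring.inverse T := by
  have hP : orthProj (image T V) = T * orthProj V * Ring.inverse T := by
    refine projAlong_eq _ (fun x => ⟨_, orthProj_mem hV (Ring.inverse T x), rfl⟩) (fun x => ?_)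
      (fun x hx => ?_) (fun x hx => ?_)
    · rw [h.perp_image]
      refine ⟨_, sub_orthProj_mem hV (Ring.inverse T x), ?_⟩
      change T (Ring.inverse T x - orthProj V (Ring.inverse T x)) = _
      rw [map_sub, h.apply_inverse]; rfl
    · change T (orthProj V (Ring.inverse T x)) = x
      rw [orthProj_of_mem hV (h.mem_image.1 hx), h.apply_inverse]
    · change T (orthProj V (Ring.inverse T x)) = 0
      rw [h.perp_image, h.mem_image] at hx
      rw [orthProj_of_mem_perp hV hx, map_zero]
  rw [refl_eq (h.isNondeg_image hV), hP, refl_eq hV, mul_sub, sub_mul, mul_one, h.mul_inverse,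
    mul_smul_comm, smul_mul_assoc]

/-- An endomorphism commuting with the reflection preserves the space. -/
theorem image_le_of_comm {T : Endo n} {V F : Submodule ℂ (Cn n)} (hV : IsNondeg V)
    (h : refl V * T = T * refl V) (hF : F ≤ V) : image T F ≤ V := by
  rintro _ ⟨x, hx, rfl⟩
  have e := congrArg (fun X : Endo n => X x) h
  change refl V (T x) = T (refl V x) at e
  rw [refl_of_mem hV (hF hx)] at e
  exact (mem_iff_refl hV).2 e

theorem contDiffOn_inverse {f : ℂ → Endo n} {U : Set ℂ} (hf : ContDiffOn ℝ ∞ f U)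
    (h : ∀ z ∈ U, IsOrth (f z)) : ContDiffOn ℝ ∞ (fun z => Ring.inverse (f z)) U := fun z hz =>
  ContDiffAt.comp_contDiffWithinAt z (contDiffAt_ringInverse ℝ (h z hz).isUnit.unit) (hf z hz)

theorem pder_inverse {f : ℂ → Endo n} {U : Set ℂ} (hU : IsOpen U) (hf : ContDiffOn ℝ ∞ f U)
    (h : ∀ z ∈ U, IsOrth (f z)) (η : ℂ) {z : ℂ} (hz : z ∈ U) (v : ℂ) :
    pder η (fun z => Ring.inverse (f z)) z v =
      -(Ring.inverse (f z) * pder η f z v * Ring.inverse (f z)) := by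
  have d1 := hf.differentiableAt_of_isOpen hU hz
  have d2 := (contDiffOn_inverse hf h).differentiableAt_of_isOpen hU hz
  have e := pder_mul η d1 d2 v
  rw [pder_congr hU (g := fun _ => (1 : Endo n)) (fun w hw => (h w hw).mul_inverse) hz] at e
  have h0 : pder η (fun _ => (1 : Endo n)) z v = 0 := by simp [pder, pt]
  rw [h0] at e
  have e2 := congrArg (fun X => Ring.inverse (f z) * X) e
  simp only [mul_add, ← mul_assoc, (h z hz).inverse_mul, one_mul, mul_zero] at e2
  exact eq_neg_of_add_eq_zero_right e2.symm

/-! ### Images of bundles -/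

theorem IsSubbundleOn.image {k : ℕ} {U : Set ℂ} {F : ℂ → Submodule ℂ (Cn n)}
    (hF : IsSubbundleOn k U F) {T : ℂ → Endo n} (hT : ContDiffOn ℝ ∞ T U)
    (hT' : ∀ z ∈ U, IsOrth (T z)) : IsSubbundleOn k U (fun z => Backlund.image (T z) (F z)) := by
  intro z hz
  obtain ⟨O, hO, hzO, hOU, s, hs, hsp⟩ := hF z hz
  refine ⟨O, hO, hzO, hOU, fun i w => T w (s i w),
    fun i => contDiffOn_apply (hT.mono hOU) (hs i), fun w hw => ⟨?_, ?_⟩⟩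
  · exact (hsp w hw).1.map' (T w : Cn n →ₗ[ℂ] Cn n)
      (LinearMap.ker_eq_bot.2 (hT' w (hOU hw)).injective)
  · change _ = Backlund.image (T w) (F w)
    rw [← (hsp w hw).2, Backlund.image, Submodule.map_span, ← Set.range_comp]
    rfl

theorem IsSubbundleOn.finrank {k : ℕ} {U : Set ℂ} {F : ℂ → Submodule ℂ (Cn n)}
    (hF : IsSubbundleOn k U F) {z : ℂ} (hz : z ∈ U) : Module.finrank ℂ (F z) = k := by
  obtain ⟨O, -, hzO, -, s, -, hsp⟩ := hF z hz
  rw [← (hsp z hzO).2, finrank_span_eq_card (hsp z hzO).1, Fintype.card_fin]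

theorem IsSubbundleOn.exists_frame_one {U : Set ℂ} {F : ℂ → Submodule ℂ (Cn n)}
    (hF : IsSubbundleOn 1 U F) {z : ℂ} (hz : z ∈ U) : ∃ O : Set ℂ, IsOpen O ∧ z ∈ O ∧ O ⊆ U ∧
      ∃ s : ℂ → Cn n, ContDiffOn ℝ ∞ s O ∧ ∀ w ∈ O, s w ≠ 0 ∧ F w = Submodule.span ℂ {s w} := by
  obtain ⟨O, hO, hzO, hOU, s, hs, hsp⟩ := hF z hz
  refine ⟨O, hO, hzO, hOU, s 0, hs 0, fun w hw => ⟨(hsp w hw).1.ne_zero 0, ?_⟩⟩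
  rw [← (hsp w hw).2]
  congr 1
  ext x
  simp [Fin.exists_fin_one, eq_comm]

theorem isSubbundleOn_one {U : Set ℂ} {F : ℂ → Submodule ℂ (Cn n)}
    (h : ∀ z ∈ U, ∃ O : Set ℂ, IsOpen O ∧ z ∈ O ∧ O ⊆ U ∧
      ∃ s : ℂ → Cn n, ContDiffOn ℝ ∞ s O ∧ ∀ w ∈ O, s w ≠ 0 ∧ F w = Submodule.span ℂ {s w}) :
    IsSubbundleOn 1 U F := by
  intro z hz
  obtain ⟨O, hO, hzO, hOU, s, hs, hsp⟩ := h z hz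
  refine ⟨O, hO, hzO, hOU, fun _ => s, fun _ => hs, fun w hw => ⟨?_, ?_⟩⟩
  · exact linearIndependent_unique_iff.2 (hsp w hw).1
  · rw [(hsp w hw).2]; simp

/-- The intersection of isotropic plane bundles, if of rank one at each point, is a bundle. -/
theorem isSubbundleOn_inf {U : Set ℂ} {V A B : ℂ → Submodule ℂ (Cn n)}
    (hV : ∀ z ∈ U, IsNondeg (V z)) (h4 : ∀ z ∈ U, Module.finrank ℂ (V z) = 4)
    (hA : IsSubbundleOn 2 U A) (hAV : ∀ z ∈ U, A z ≤ V z)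
    (hB : IsSubbundleOn 2 U B) (hBi : ∀ z ∈ U, IsIsotropic (B z)) (hBV : ∀ z ∈ U, B z ≤ V z)
    (h1 : ∀ z ∈ U, Module.finrank ℂ ↥(A z ⊓ B z) = 1) :
    IsSubbundleOn 1 U (fun z => A z ⊓ B z) := by
  refine isSubbundleOn_one fun z hz => ?_
  obtain ⟨O, hO, hzO, hOU, a, ha, hasp⟩ := hA z hz
  obtain ⟨O', hO', hzO', hOU', b, hb, hbsp⟩ := hB z hz
  -- Inside `V` an isotropic plane is its own orthogonal complement, so membership in `B` becomes a
  -- linear system.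
  have hmem (w) (hw : w ∈ O ∩ O') {x : Cn n} (hx : x ∈ A w) :
      x ∈ B w ↔ ∀ j, lor n x (b j w) = 0 := by
    have e : B w = V w ⊓ perp (B w) := (isotropic_perp_eq (hV w (hOU hw.1)) (h4 w (hOU hw.1))
      (hBi w (hOU hw.1)) (hB.finrank (hOU hw.1)) (hBV w (hOU hw.1))).symm
    rw [e, Submodule.mem_inf, mem_perp', and_iff_right (hAV w (hOU hw.1) hx), ← (hbsp w hw.2).2]
    constructor
    · exact fun h j => h _ (Submodule.subset_span ⟨j, rfl⟩)
    · intro h y hy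
      refine Submodule.span_induction ?_ (by simp) ?_ ?_ hy
      · rintro _ ⟨j, rfl⟩; exact h j
      · intro y y' _ _ h1 h2; rw [map_add, h1, h2, add_zero]
      · intro c y _ h1; rw [map_smul, h1, smul_zero]
  have haA (w) (hw : w ∈ O ∩ O') (i) : a i w ∈ A w := by
    rw [← (hasp w hw.1).2]; exact Submodule.subset_span ⟨i, rfl⟩
  -- A common vector of `A` and `B` is a dependence between the rows of the pairing matrix, which is
  -- therefore singular.
  have hdet (w) (hw : w ∈ O ∩ O') (j k) : lor n (a 1 w) (b j w) * lor n (a 0 w) (b k w) =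
      lor n (a 0 w) (b j w) * lor n (a 1 w) (b k w) := by
    obtain ⟨e, he, he0, -⟩ := exists_of_finrank_eq_one (h1 w (hOU hw.1))
    have heB := (hmem w hw he.1).1 he.2
    have heA := he.1
    rw [SetLike.mem_coe, ← (hasp w hw.1).2, Submodule.mem_span_range_iff_exists_fun] at heA
    obtain ⟨c, rfl⟩ := heA
    simp only [Fin.sum_univ_two, map_add, map_smul, LinearMap.add_apply, LinearMap.smul_apply,
      smul_eq_mul] at heB
    have hj := heB j
    have hk := heB k
    by_cases hc : c 0 = 0
    · have hc1 : c 1 ≠ 0 := by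
        intro hc1; apply he0; simp [hc, hc1]
      rw [hc] at hj hk
      have hj' : lor n (a 1 w) (b j w) = 0 := by
        rcases mul_eq_zero.1 (by linear_combination hj : c 1 * lor n (a 1 w) (b j w) = 0) with h | h
        · exact absurd h hc1
        · exact h
      have hk' : lor n (a 1 w) (b k w) = 0 := by
        rcases mul_eq_zero.1 (by linear_combination hk : c 1 * lor n (a 1 w) (b k w) = 0) with h | h
        · exact absurd h hc1
        · exact h
      rw [hj', hk']; ring
    · refine mul_left_cancel₀ hc ?_
      linear_combination lor n (a 1 w) (b j w) * hk - lor n (a 1 w) (b k w) * hj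
  -- some entry of the Gram matrix does not vanish
  have hne : ∃ i j, lor n (a i z) (b j z) ≠ 0 := by
    by_contra! h0
    have : A z ⊓ B z = A z := by
      refine inf_eq_left.2 ?_
      rw [← (hasp z hzO).2, Submodule.span_le]
      rintro _ ⟨i, rfl⟩
      exact (hmem z ⟨hzO, hzO'⟩ (haA z ⟨hzO, hzO'⟩ i)).2 (h0 i)
    have h2 := h1 z hz
    rw [this, hA.finrank hz] at h2
    omega
  obtain ⟨i₀, j, hij⟩ := hne
  let G : Fin 2 → ℂ → ℂ := fun i w => lor n (a i w) (b j w)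
  have hG (i) : ContDiffOn ℝ ∞ (G i) (O ∩ O') :=
    contDiffOn_lor ((ha i).mono Set.inter_subset_left) ((hb j).mono Set.inter_subset_right)
  have hOO : IsOpen (O ∩ O') := hO.inter hO'
  -- The frame `(a₁, b_j) a₀ - (a₀, b_j) a₁` is orthogonal to `b_j` by construction and to the other
  -- frame vector by `hdet`; it is non-zero where the chosen entry is.
  refine ⟨(O ∩ O') ∩ G i₀ ⁻¹' {0}ᶜ,
    (hG i₀).continuousOn.isOpen_inter_preimage hOO isOpen_compl_singleton,
    ⟨⟨hzO, hzO'⟩, hij⟩, fun w hw => hOU hw.1.1, fun w => G 1 w • a 0 w - G 0 w • a 1 w, ?_, ?_⟩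
  · have h0 := ((hG 1).smul ((ha 0).mono (Set.inter_subset_left (t := O')))).sub
      ((hG 0).smul ((ha 1).mono (Set.inter_subset_left (t := O'))))
    exact h0.mono Set.inter_subset_left
  · rintro w ⟨hw, hw0⟩
    have hw0 : G i₀ w ≠ 0 := hw0
    have hs0 : G 1 w • a 0 w - G 0 w • a 1 w ≠ 0 := by
      intro h0
      have hli := Fintype.linearIndependent_iff.1 (hasp w hw.1).1 ![G 1 w, -G 0 w]
        (by simpa [Fin.sum_univ_two, sub_eq_add_neg] using h0)
      have e0 := hli 0
      have e1 := hli 1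
      simp only [Matrix.cons_val_zero, Matrix.cons_val_one, neg_eq_zero] at e0 e1
      apply hw0
      fin_cases i₀
      · exact e1
      · exact e0
    have hsA : G 1 w • a 0 w - G 0 w • a 1 w ∈ A w :=
      (A w).sub_mem ((A w).smul_mem _ (haA w hw 0)) ((A w).smul_mem _ (haA w hw 1))
    have hsB : G 1 w • a 0 w - G 0 w • a 1 w ∈ B w := by
      rw [hmem w hw hsA]
      intro k
      simp only [map_sub, map_smul, LinearMap.sub_apply, LinearMap.smul_apply, smul_eq_mul]
      linear_combination hdet w hw j k
    refine ⟨hs0, ?_⟩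
    symm
    apply Submodule.eq_of_le_of_finrank_eq
    · rw [Submodule.span_singleton_le_iff_mem]; exact ⟨hsA, hsB⟩
    · rw [h1 w (hOU hw.1), finrank_span_singleton hs0]

/-! ### Dressing by a line bundle -/

theorem IsDressing.of_span {V : Submodule ℂ (Cn n)} {s : Cn n}
    (h : IsDressing V (Submodule.span ℂ {s})) : lor n s s = 0 ∧ lor n s (refl V s) ≠ 0 := by
  obtain ⟨l, hl, h1, h2⟩ := h
  obtain ⟨c, rfl⟩ := Submodule.mem_span_singleton.1 (hl ▸ Submodule.mem_span_singleton_self l :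
    l ∈ Submodule.span ℂ {s})
  simp only [map_smul, LinearMap.smul_apply, smul_eq_mul, ne_eq, mul_eq_zero, not_or] at h1 h2
  exact ⟨by simpa [h2.1] using h1, h2.2.2⟩

/-- `X'` is obtained from the connection form `X` by the gauge transformation `T`, in the
directions of type `η`. -/
def IsGauge (η : ℂ) (U : Set ℂ) (T : ℂ → Endo n) (X X' : ℂ → ℂ → Endo n) : Prop :=
  ∀ z ∈ U, ∀ v : ℂ, X' z v * T z = T z * X z v - pder η T z v

theorem IsGauge.trans {η : ℂ} {U : Set ℂ} (hU : IsOpen U) {S T : ℂ → Endo n}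
    {X X' X'' : ℂ → ℂ → Endo n} (hS : ContDiffOn ℝ ∞ S U) (hT : ContDiffOn ℝ ∞ T U)
    (h : IsGauge η U T X X') (h' : IsGauge η U S X' X'') :
    IsGauge η U (fun z => S z * T z) X X'' := by
  intro z hz v
  have e := pder_mul η (hS.differentiableAt_of_isOpen hU hz) (hT.differentiableAt_of_isOpen hU hz) v
  rw [e, ← mul_assoc, h' z hz v, sub_mul, mul_assoc, h z hz v, mul_sub, ← mul_assoc]
  abel

/-- The image of a projection `P` is parallel for the connection form `X`, in the directions of
type `η`. -/
def IsParallelProj (η : ℂ) (U : Set ℂ) (P : ℂ → Endo n) (X : ℂ → ℂ → Endo n) : Prop :=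
  ∀ z ∈ U, ∀ v : ℂ, (1 - P z) * (pder η P z v + X z v * P z) = 0

/-- Gauging by `T` carries parallel subspaces to parallel subspaces. The projections need not be
conjugate, only their images correspond; so `P'` is differentiated through `P' = T P S P'`, with `Y`
the derivative of `S P'`. -/
theorem parallel_transfer {R : Type*} [Ring R] {P P' T S X X' dP dP' dT Y : R}
    (hST : S * T = 1) (h1 : T * P * S * P' = P') (h2 : P' * T * P = T * P)
    (hX : X' * T = T * X - dT) (h : (1 - P) * (dP + X * P) = 0)
    (hd : dP' = dT * P * S * P' + T * dP * S * P' + T * P * Y) :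
    (1 - P') * (dP' + X' * P') = 0 := by
  have k1 : (1 - P') * (T * P) = 0 := by rw [sub_mul, one_mul, ← mul_assoc, h2, sub_self]
  have k2 : P * S * P' = S * P' := by
    calc P * S * P' = S * T * P * S * P' := by rw [hST, one_mul]
      _ = S * (T * P * S * P') := by simp only [mul_assoc]
      _ = _ := by rw [h1]
  have k3 : dP + X * P = P * (dP + X * P) := by
    rw [sub_mul, one_mul, sub_eq_zero] at h; exact h
  have k4 : X' * P' = T * X * S * P' - dT * S * P' := by
    calc X' * P' = X' * T * (P * S * P') := by simp only [← mul_assoc] at h1 ⊢; rw [mul_assoc X', mul_assoc X', mul_assoc X', h1]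
      _ = _ := by rw [hX, k2, sub_mul, mul_assoc, mul_assoc, mul_assoc, mul_assoc]
  have k5 : dP' + X' * P' = T * P * ((dP + X * P) * (S * P') + Y) := by
    have e1 : dT * P * S * P' = dT * S * P' := by rw [mul_assoc, mul_assoc, ← mul_assoc P, k2, mul_assoc]
    have e2 : T * X * S * P' = T * (X * P) * (S * P') := by
      have : T * (X * P) * (S * P') = T * X * (P * S * P') := by simp only [mul_assoc]
      rw [this, k2]; simp only [mul_assoc]
    have e3 : T * P * ((dP + X * P) * (S * P')) = T * (dP + X * P) * (S * P') := by
      have : T * P * ((dP + X * P) * (S * P')) = T * (P * (dP + X * P)) * (S * P') := by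
        simp only [mul_assoc]
      rw [this, ← k3]
    rw [hd, k4, e1, e2, mul_add, e3]
    simp only [add_mul, mul_add, mul_assoc]
    abel
  rw [k5, ← mul_assoc, k1, zero_mul]

section Field

variable {U : Set ℂ} {V L : ℂ → Submodule ℂ (Cn n)} {k : ℕ}

variable (hU : IsOpen U) (hV : IsSubbundleOn k U V) (hN : ∀ z ∈ U, IsNondeg (V z))
  (hL : IsSubbundleOn 1 U L) (hD : ∀ z ∈ U, IsDressing (V z) (L z))

include hV hN hL hD

theorem contDiffOn_lineProj : ContDiffOn ℝ ∞ (fun z => lineProj (V z) (L z)) U := by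
  refine contDiffOn_of_locally fun z hz => ?_
  obtain ⟨O, hO, hzO, hOU, s, hs, hsp⟩ := hL.exists_frame_one hz
  have hρ := contDiffOn_apply ((hV.contDiffOn_refl hN).mono hOU) hs
  have hd (w) (hw : w ∈ O) : lor n (s w) (s w) = 0 ∧ lor n (s w) (refl (V w) (s w)) ≠ 0 :=
    IsDressing.of_span ((hsp w hw).2 ▸ hD w (hOU hw))
  refine ⟨O, hO, hzO, ContDiffOn.congr (((contDiffOn_lor hs hρ).inv fun w hw => (hd w hw).2).smul
    (contDiffOn_rankOne hs hρ)) fun w hw => ?_⟩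
  rw [(hsp w hw).2, lineProj_span (hN w (hOU hw)) (hd w hw).1 (hd w hw).2]
  rfl

theorem contDiffOn_coProj : ContDiffOn ℝ ∞ (fun z => coProj (V z) (L z)) U := by
  have hρ := hV.contDiffOn_refl hN
  refine (contDiffOn_mul (contDiffOn_mul hρ (contDiffOn_lineProj hV hN hL hD)) hρ).congr
    fun z hz => ?_
  rw [refl_mul_lineProj (hN z hz) (hD z hz), mul_assoc, refl_mul_refl (hN z hz), mul_one]

theorem contDiffOn_dress (c : ℂ) : ContDiffOn ℝ ∞ (fun z => dress (V z) (L z) c) U := by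
  refine ContDiffOn.congr ?_ fun z hz => dress_eq (hN z hz) (hD z hz) c
  exact (contDiffOn_const.add ((contDiffOn_lineProj hV hN hL hD).const_smul (c - 1))).add
    ((contDiffOn_coProj hV hN hL hD).const_smul (c⁻¹ - 1))

include hU

theorem pder_dress (η c : ℂ) {z : ℂ} (hz : z ∈ U) (v : ℂ) :
    pder η (fun z => dress (V z) (L z) c) z v =
      (c - 1) • pder η (fun z => lineProj (V z) (L z)) z v
        + (c⁻¹ - 1) • pder η (fun z => coProj (V z) (L z)) z v := by
  have dP := (contDiffOn_lineProj hV hN hL hD).differentiableAt_of_isOpen hU hz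
  have dQ := (contDiffOn_coProj hV hN hL hD).differentiableAt_of_isOpen hU hz
  rw [pder_congr hU (fun w hw => dress_eq (hN w hw) (hD w hw) c) hz]
  have h : HasFDerivAt (fun w => tw (lineProj (V w) (L w)) (coProj (V w) (L w)) c) _ z :=
    (((hasFDerivAt_const (1 : Endo n) z).add (dP.hasFDerivAt.const_smul (c - 1))).add
      (dQ.hasFDerivAt.const_smul (c⁻¹ - 1)))
  simp only [pder, pt]
  rw [h.fderiv]
  simp only [add_apply, smul_apply, zero_apply]
  module

theorem isNullPairDeriv_pder (η : ℂ) {z : ℂ} (hz : z ∈ U) (v : ℂ) :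
    IsNullPairDeriv (refl (V z)) (pder η (fun w => refl (V w)) z v) (lineProj (V z) (L z))
      (coProj (V z) (L z)) (pder η (fun w => lineProj (V w) (L w)) z v)
      (pder η (fun w => coProj (V w) (L w)) z v) := by
  have dP := (contDiffOn_lineProj hV hN hL hD).differentiableAt_of_isOpen hU hz
  have dQ := (contDiffOn_coProj hV hN hL hD).differentiableAt_of_isOpen hU hz
  have dr := (hV.contDiffOn_refl hN).differentiableAt_of_isOpen hU hz
  have np (w) (hw : w ∈ U) := isNullPair_proj (hN w hw) (hD w hw)
  have h0 : pder η (fun _ => (0 : Endo n)) z v = 0 := by simp [pder, pt]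
  constructor
  · rw [← pder_mul η dP dP, pder_congr hU (fun w hw => (np w hw).pp) hz]
  · rw [← pder_mul η dQ dQ, pder_congr hU (fun w hw => (np w hw).qq) hz]
  · rw [← pder_mul η dP dQ, pder_congr hU (fun w hw => (np w hw).pq) hz, h0]
  · rw [← pder_mul η dQ dP, pder_congr hU (fun w hw => (np w hw).qp) hz, h0]
  · exact isAdj_pder hU hz dP dQ (fun w hw => (np w hw).isAdj) η v
  · rw [← pder_mul η dr dP, ← pder_mul η dQ dr,
      pder_congr hU (fun w hw => refl_mul_lineProj (hN w hw) (hD w hw)) hz]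
  · rw [← pder_mul η dr dQ, ← pder_mul η dP dr,
      pder_congr hU (fun w hw => refl_mul_coProj (hN w hw) (hD w hw)) hz]

/-- The parallelism is tested on the sections obtained by projecting constant vectors to `L`. -/
theorem isParallelProj_of_isParallelOn {A : ℂ → ℂ →L[ℝ] Endo n} (h : IsParallelOn U A L) (η : ℂ) :
    IsParallelProj η U (fun z => lineProj (V z) (L z)) (fun z v => pt η (A z) v) := by
  intro z hz v
  have hs := contDiffOn_lineProj hV hN hL hD
  have dP := hs.differentiableAt_of_isOpen hU hz
  have key (u : ℂ) : (1 - lineProj (V z) (L z)) * (fderiv ℝ (fun w => lineProj (V w) (L w)) z u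
      + A z u * lineProj (V z) (L z)) = 0 := by
    ext1 x
    have h1 := h U (fun w => lineProj (V w) (L w) x) le_rfl
      ⟨hU, contDiffOn_apply hs contDiffOn_const, fun w hw => lineProj_mem (hN w hw) (hD w hw) x⟩
      z hz u
    have e : fderiv ℝ (fun w => lineProj (V w) (L w) x) z u =
      fderiv ℝ (fun w => lineProj (V w) (L w)) z u x :=
      fderiv_clm (ContinuousLinearMap.apply ℂ (Cn n) x) dP u
    rw [e] at h1
    have h2 := lineProj_of_mem (hN z hz) (hD z hz) h1
    simp only [mul_apply_eq_comp, sub_apply, add_apply, one_apply_eq_self]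
    rw [h2, sub_self]; rfl
  have k1 := key v
  have k2 := key (Complex.I * v)
  have e : (1 - lineProj (V z) (L z)) * (pder η (fun w => lineProj (V w) (L w)) z v
      + pt η (A z) v * lineProj (V z) (L z)) = (1 / 2 : ℂ) • ((1 - lineProj (V z) (L z)) *
        (fderiv ℝ (fun w => lineProj (V w) (L w)) z v + A z v * lineProj (V z) (L z)))
      - (1 / 2 * (η * Complex.I)) • ((1 - lineProj (V z) (L z)) *
        (fderiv ℝ (fun w => lineProj (V w) (L w)) z (Complex.I * v)
          + A z (Complex.I * v) * lineProj (V z) (L z))) := by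
    rw [← mul_smul_comm, ← mul_smul_comm, ← mul_sub]
    congr 1
    simp only [pder, pt, smul_add, smul_sub, smul_smul, sub_mul, smul_mul_assoc]
    abel
  have s0 (c : ℂ) : c • (0 : Endo n) = 0 := by ext1 x; exact smul_zero c
  rw [e, k1, k2, s0, s0, sub_zero]

theorem isParallelProj_image {L' : ℂ → Submodule ℂ (Cn n)} (hL' : IsSubbundleOn 1 U L')
    (hD' : ∀ z ∈ U, IsDressing (V z) (L' z)) {T : ℂ → Endo n} (hT : ContDiffOn ℝ ∞ T U)
    (hTo : ∀ z ∈ U, IsOrth (T z)) (hLL : ∀ z ∈ U, L' z = image (T z) (L z)) {η : ℂ}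
    {X X' : ℂ → ℂ → Endo n} (hX : IsGauge η U T X X')
    (h : IsParallelProj η U (fun z => lineProj (V z) (L z)) X) :
    IsParallelProj η U (fun z => lineProj (V z) (L' z)) X' := by
  intro z hz v
  have sP := contDiffOn_lineProj hV hN hL hD
  have sP' := contDiffOn_lineProj hV hN hL' hD'
  have sS := contDiffOn_inverse hT hTo
  have dP := sP.differentiableAt_of_isOpen hU hz
  have dT := hT.differentiableAt_of_isOpen hU hz
  have dTP := (contDiffOn_mul hT sP).differentiableAt_of_isOpen hU hz
  have dSP := (contDiffOn_mul sS sP').differentiableAt_of_isOpen hU hz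
  have e1 (w) (hw : w ∈ U) : T w * lineProj (V w) (L w) *
      (Ring.inverse (T w) * lineProj (V w) (L' w)) = lineProj (V w) (L' w) := by
    ext1 x
    have h1 := lineProj_mem (hN w hw) (hD' w hw) x
    have h2 := (hTo w hw).mem_image.1 ((hLL w hw).le h1)
    change T w (lineProj (V w) (L w) (Ring.inverse (T w) (lineProj (V w) (L' w) x))) = _
    rw [lineProj_of_mem (hN w hw) (hD w hw) h2, (hTo w hw).apply_inverse]
  have e2 : lineProj (V z) (L' z) * T z * lineProj (V z) (L z) = T z * lineProj (V z) (L z) := by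
    ext1 x
    refine lineProj_of_mem (hN z hz) (hD' z hz) ?_
    rw [hLL z hz]
    exact ⟨_, lineProj_mem (hN z hz) (hD z hz) x, rfl⟩
  have hd := pder_mul η dTP dSP v
  rw [pder_congr hU e1 hz, pder_mul η dT dP] at hd
  refine parallel_transfer (hTo z hz).inverse_mul ?_ e2 (hX z hz v) (h z hz v)
    (Y := pder η (fun w => Ring.inverse (T w) * lineProj (V w) (L' w)) z v) ?_
  · rw [mul_assoc (T z * _)]; exact e1 z hz
  · rw [hd]; simp only [add_mul, mul_assoc]

/-- The effect of dressing by a parallel null line bundle on a bundle of half loops. -/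
theorem exists_dressed_halfLoop {η : ℂ} {F : ℂ → Submodule ℂ (Cn n)} {a b c : ℂ → ℂ → Endo n}
    (h : ∀ z ∈ U, ∀ v, IsHalfLoop (V z) (pder η (fun w => refl (V w)) z v) (a z v) (b z v) (c z v)
      (F z)) {ε : ℂ} (hε : ε * ε = 1) {m : ℂ}
    (hpar : IsParallelProj η U (fun z => lineProj (V z) (L z))
      fun z v => a z v + m • b z v + m ^ 2 • c z v) :
    ∃ a' b' c' : ℂ → ℂ → Endo n,
      (∀ z ∈ U, ∀ v, IsHalfLoop (V z) (pder η (fun w => refl (V w)) z v) (a' z v) (b' z v)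
        (c' z v) (image (dress (V z) (L z) (-ε)) (F z))) ∧
      IsGauge η U (fun z => dress (V z) (L z) ε) a a' ∧
      (∀ z ∈ U, ∀ v, c' z v * dress (V z) (L z) (-ε) = dress (V z) (L z) (-ε) * c z v) ∧
      ∀ μ κ : ℂ, m + μ ≠ 0 → m - μ ≠ 0 → κ = ε * ((m - μ) / (m + μ)) →
        IsGauge η U (fun z => dress (V z) (L z) κ)
          (fun z v => a z v + μ • b z v + μ ^ 2 • c z v)
          fun z v => a' z v + μ • b' z v + μ ^ 2 • c' z v := by
  have dd (z) (hz : z ∈ U) (v) := isNullPairDeriv_pder hU hV hN hL hD η hz v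
  have ε0 : ε ≠ 0 := left_ne_zero_of_mul (hε.trans_ne one_ne_zero)
  refine ⟨fun z v => stepA (lineProj (V z) (L z)) (coProj (V z) (L z))
      (pder η (fun w => lineProj (V w) (L w)) z v) (pder η (fun w => coProj (V w) (L w)) z v) ε
      (a z v),
    fun z v => stepB (lineProj (V z) (L z)) (coProj (V z) (L z)) ε m (b z v) (c z v),
    fun z v => stepC (lineProj (V z) (L z)) (coProj (V z) (L z)) ε (c z v), ?_, ?_, ?_, ?_⟩
  · intro z hz v
    rw [dress_eq (hN z hz) (hD z hz)]
    exact (h z hz v).step (hN z hz) (hD z hz) (dd z hz v) hε m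
  · intro z hz v
    have np := isNullPair_proj (hN z hz) (hD z hz)
    rw [pder_dress hU hV hN hL hD η ε hz v]
    beta_reduce
    rw [dress_eq (hN z hz) (hD z hz), stepA, mul_assoc,
      np.tw_mul, hε, tw_one, mul_one]
  · intro z hz v
    have np := isNullPair_proj (hN z hz) (hD z hz)
    beta_reduce
    rw [dress_eq (hN z hz) (hD z hz), stepC, mul_assoc, np.tw_mul, neg_mul_neg, hε, tw_one, mul_one]
  · intro μ κ h1 h2 hκ z hz v
    rw [pder_dress hU hV hN hL hD η κ hz v]
    beta_reduce
    rw [dress_eq (hN z hz) (hD z hz)]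
    exact ((h z hz v).gauge (hN z hz) (hD z hz) (dd z hz v) hε (hpar z hz v) h1 h2 hκ).symm

end Field

/-! ### The Bäcklund transformation of half loops -/

/-- A gauge transformation of one half of a loop of connections, `a + μ b + μ² c` being the
transformed half loop, and `R` a parallel frame of `a + b + c`. -/
structure IsHalfGauge (η : ℂ) (U : Set ℂ) (V F : ℂ → Submodule ℂ (Cn n))
    (q : ℂ → ℂ →L[ℝ] Endo n) (R rA rF : ℂ → Endo n) (a b c : ℂ → ℂ → Endo n) : Prop where
  loop : ∀ z ∈ U, ∀ v, IsHalfLoop (V z) (pder η (fun w => refl (V w)) z v) (a z v) (b z v)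
    (c z v) (image (rF z) (F z))
  gauge : IsGauge η U rA (coeffA η V q) a
  comm : ∀ z ∈ U, ∀ v, c z v * rF z = rF z * pt η (q z) v
  deriv : ∀ z ∈ U, ∀ v, pder η R z v = -((a z v + b z v + c z v) * R z)

/-- Inverting the parameters changes the sign of the ratio; this is the source of the sign `ε = -η`
for the first factor and `ε = η` for the second. -/
theorem IsSpectral.ratio {η l α m μ : ℂ} (hα : IsSpectral η α m) (hl : IsSpectral η l μ)
    (h0 : α ≠ 0) (h1 : l ≠ 0) (h2 : α + l ≠ 0) (h3 : α - l ≠ 0) :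
    m + μ ≠ 0 ∧ m - μ ≠ 0 ∧ (α - l) / (α + l) = -η * ((m - μ) / (m + μ)) := by
  rcases hα with ⟨rfl, rfl⟩ | ⟨rfl, rfl⟩
  · rcases hl with ⟨-, rfl⟩ | ⟨h, -⟩
    · have e1 : α⁻¹ + l⁻¹ = (α + l) / (α * l) := by field_simp; ring
      have e2 : α⁻¹ - l⁻¹ = -(α - l) / (α * l) := by field_simp; ring
      refine ⟨?_, ?_, ?_⟩
      · rw [e1]; exact div_ne_zero h2 (mul_ne_zero h0 h1)
      · rw [e2]; exact div_ne_zero (neg_ne_zero.2 h3) (mul_ne_zero h0 h1)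
      · rw [e1, e2]; field_simp
    · norm_num at h
  · rcases hl with ⟨h, -⟩ | ⟨-, rfl⟩
    · norm_num at h
    · exact ⟨h2, h3, by ring⟩

section TwoStep

variable {U : Set ℂ} {V L L' G F : ℂ → Submodule ℂ (Cn n)} {q : ℂ → ℂ →L[ℝ] Endo n} {α β η : ℂ}

theorem isSubbundleOn_hatL {k : ℕ} (hV : IsSubbundleOn k U V) (hN : ∀ z ∈ U, IsNondeg (V z))
    (hL : IsSubbundleOn 1 U L) (hD : ∀ z ∈ U, IsDressing (V z) (L z))
    (hL' : IsSubbundleOn 1 U L') (h : (α - β) / (α + β) ≠ 0) :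
    IsSubbundleOn 1 U (fun z => hatL (V z) α β (L z) (L' z)) :=
  hL'.image (contDiffOn_dress hV hN hL hD _) fun z hz => isOrth_dress (hN z hz) (hD z hz) h

/-- Two simple dressings in succession. `rA` is the gauge at `μ = 0` and `rF` the one at `μ = ∞`:
these are `r*(∞)` and `r*(0)` for `η = 1`, and the opposite for `η = -1`. -/
theorem exists_twoStep {k : ℕ} (hη : η * η = 1) (hU : IsOpen U) (hV : IsSubbundleOn k U V)
    (hN : ∀ z ∈ U, IsNondeg (V z)) (hL : IsSubbundleOn 1 U L)
    (hD : ∀ z ∈ U, IsDressing (V z) (L z)) (hL' : IsSubbundleOn 1 U L')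
    (hD' : ∀ z ∈ U, IsDressing (V z) (L' z))
    (hDh : ∀ z ∈ U, IsDressing (V z) (hatL (V z) α β (L z) (L' z)))
    (hα : α ≠ 0) (hβ : β ≠ 0) (hp : α + β ≠ 0) (hm : α - β ≠ 0)
    (hα1 : α + 1 ≠ 0) (hα2 : α - 1 ≠ 0) (hβ1 : β + 1 ≠ 0) (hβ2 : β - 1 ≠ 0)
    (hW : IsHalfWillmore η U G F V q) {mα mβ : ℂ} (hmα : IsSpectral η α mα)
    (hmβ : IsSpectral η β mβ)
    (hpα : IsParallelProj η U (fun z => lineProj (V z) (L z)) fun z v => pt η (formLoop V q α z) v)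
    (hpβ : IsParallelProj η U (fun z => lineProj (V z) (L' z))
      fun z v => pt η (formLoop V q β z) v) :
    ∃ a b c : ℂ → ℂ → Endo n,
      IsHalfGauge η U V F q (fun z => rStar (V z) α β (L z) (L' z) 1)
        (fun z => dress (V z) (hatL (V z) α β (L z) (L' z)) η * dress (V z) (L z) (-η))
        (fun z => dress (V z) (hatL (V z) α β (L z) (L' z)) (-η) * dress (V z) (L z) η) a b c ∧
      ∀ l μ : ℂ, IsSpectral η l μ → l ≠ 0 → α + l ≠ 0 → α - l ≠ 0 → β + l ≠ 0 → β - l ≠ 0 →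
        IsGauge η U (fun z => rStar (V z) α β (L z) (L' z) l)
          (fun z v => pt η (formLoop V q l z) v) fun z v => a z v + μ • b z v + μ ^ 2 • c z v := by
  have hκ : (α - β) / (α + β) ≠ 0 := div_ne_zero hm hp
  have hLh := isSubbundleOn_hatL hV hN hL hD hL' hκ
  have hfl {l μ : ℂ} (h : IsSpectral η l μ) : (fun z v => pt η (formLoop V q l z) v) =
      fun z v => coeffA η V q z v + μ • pt η (formN V z) v + μ ^ 2 • pt η (q z) v :=
    funext fun z => funext fun v => pt_formLoop h z v
  rw [hfl hmα] at hpα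
  obtain ⟨a₁, b₁, c₁, hl₁, hga₁, hc₁, hg₁⟩ := exists_dressed_halfLoop hU hV hN hL hD
    (fun z hz v => hW.isHalfLoop hU hV hN hz v) (ε := -η) (by rw [neg_mul_neg, hη]) hpα
  obtain ⟨r1, r2, r3⟩ := hmα.ratio hmβ hα hβ hp hm
  have hgβ := hg₁ mβ _ r1 r2 r3
  rw [hfl hmβ] at hpβ
  -- The first gauge at the parameter `β` is `p_{α,L}(β)`, which maps the second line to `L̂`; so
  -- `L̂` is parallel for the once-gauged loop at `β`.
  have hpar₂ := isParallelProj_image hU hV hN hL' hD' hLh hDh (contDiffOn_dress hV hN hL hD _)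
    (fun z hz => isOrth_dress (hN z hz) (hD z hz) hκ) (fun z hz => rfl) hgβ hpβ
  obtain ⟨a, b, c, hl, hga, hc, hg⟩ := exists_dressed_halfLoop hU hV hN hLh hDh hl₁ hη hpar₂
  have hgauge (l μ : ℂ) (hlμ : IsSpectral η l μ) (h0 : l ≠ 0) (h1 : α + l ≠ 0) (h2 : α - l ≠ 0)
      (h3 : β + l ≠ 0) (h4 : β - l ≠ 0) : IsGauge η U (fun z => rStar (V z) α β (L z) (L' z) l)
          (fun z v => pt η (formLoop V q l z) v)
          fun z v => a z v + μ • b z v + μ ^ 2 • c z v := by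
    obtain ⟨s1, s2, s3⟩ := hmα.ratio hlμ hα h0 h1 h2
    obtain ⟨t1, t2, t3⟩ := hmβ.ratio hlμ hβ h0 h3 h4
    have t4 : (l - β) / (l + β) = η * ((mβ - μ) / (mβ + μ)) := by
      rw [add_comm l β, ← neg_sub β l, neg_div, t3]; ring
    rw [hfl hlμ]
    exact IsGauge.trans hU (contDiffOn_dress hV hN hLh hDh _) (contDiffOn_dress hV hN hL hD _)
      (hg₁ μ _ s1 s2 s3) (hg μ _ t1 t2 t4)
  refine ⟨a, b, c, ⟨?_, ?_, ?_, ?_⟩, hgauge⟩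
  · intro z hz v
    have := hl z hz v
    rwa [neg_neg, ← image_mul] at this
  · exact IsGauge.trans hU (contDiffOn_dress hV hN hLh hDh _) (contDiffOn_dress hV hN hL hD _)
      hga₁ hga
  · intro z hz v
    have h1 := hc₁ z hz v
    rw [neg_neg] at h1
    rw [← mul_assoc, hc z hz v, mul_assoc, h1, mul_assoc]
  · intro z hz v
    have hη' : η = 1 ∨ η = -1 := hmα.imp And.left And.left
    have h1 : IsSpectral η 1 1 := by
      rcases hη' with rfl | rfl
      · left; simp
      · right; simp
    have h2 := hgauge 1 1 h1 one_ne_zero hα1 hα2 hβ1 hβ2 z hz v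
    -- At `λ = 1` the loop is the trivial connection, so `r*(1)` is a parallel frame of the gauged
    -- one.
    have h3 : pt η (formLoop V q 1 z) v = 0 := by
      rw [pt_formLoop h1, coeffA, formN, pt_neg]; module
    beta_reduce at h2 ⊢
    rw [h3] at h2
    simp only [one_smul, one_pow, mul_zero, zero_sub] at h2
    rw [h2, neg_neg]

end TwoStep

/-! ### The transformed surface -/

/-- Write `∇ = d + a` in the direction considered. It is metric and preserves `V`, so on a frame of
the isotropic plane `G` the numbers `(∇ s_i, s_j)` form a skew `2 × 2` matrix. A section `e` of `G ∩
F` has `∇ e ∈ G`, which gives this matrix a kernel vector and makes it zero. Hence `∇ G` lies in `V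
∩ G^⊥ = G`. -/
theorem IsHalfWillmore.covariant_mem {η : ℂ} {U : Set ℂ} {V G F : ℂ → Submodule ℂ (Cn n)}
    {q : ℂ → ℂ →L[ℝ] Endo n} (hW : IsHalfWillmore η U G F V q) (hU : IsOpen U)
    (hV : IsSubbundleOn 4 U V) (hN : ∀ z ∈ U, IsNondeg (V z)) {O : Set ℂ} (hOU : O ⊆ U)
    {y : ℂ → Cn n} (hy : IsSectionOn G O y) {z : ℂ} (hz : z ∈ O) (v : ℂ) :
    pder η y z v + coeffA η V q z v (y z) ∈ G z := by
  have hzU := hOU hz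
  have hloop := hW.isHalfLoop hU hV hN hzU v
  obtain ⟨O₁, hO₁, hzO₁, hOU₁, s, hs, hsp⟩ := hW.bundleG z hzU
  obtain ⟨O₂, hO₂, hzO₂, hOU₂, e, he, hesp⟩ := hW.inter.exists_frame_one hzU
  have hsG (w) (hw : w ∈ O₁) (i) : s i w ∈ G w := by
    rw [← (hsp w hw).2]; exact Submodule.subset_span ⟨i, rfl⟩
  have heGF (w) (hw : w ∈ O₂) : e w ∈ G w ⊓ F w := by
    rw [(hesp w hw).2]; exact Submodule.mem_span_singleton_self _
  have ds (i) := (hs i).differentiableAt_of_isOpen hO₁ hzO₁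
  have de := he.differentiableAt_of_isOpen hO₂ hzO₂
  have dy := hy.smooth.differentiableAt_of_isOpen hy.isOpen hz
  have h0 : pder η (fun _ => (0 : ℂ)) z v = 0 := by simp [pder, pt]
  -- the connection is metric
  have metric {O O' : Set ℂ} {f g : ℂ → Cn n} (hO : IsOpen O) (hO' : IsOpen O') (hzO : z ∈ O)
      (hzO' : z ∈ O') (hOU : O ⊆ U)
      (df : DifferentiableAt ℝ f z) (dg : DifferentiableAt ℝ g z) (hf : ∀ w ∈ O, f w ∈ G w)
      (hg : ∀ w ∈ O', g w ∈ G w) : lor n (pder η f z v + coeffA η V q z v (f z)) (g z) =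
        -lor n (f z) (pder η g z v + coeffA η V q z v (g z)) := by
    have h1 := pder_congr (η := η) (f := fun w => lor n (f w) (g w)) (g := fun _ => (0 : ℂ))
      (hO.inter hO') (fun w hw => hW.isotropicG w (hOU hw.1) _ (hf w hw.1) _ (hg w hw.2))
      ⟨hzO, hzO'⟩ v
    rw [pder_lor η df dg, h0] at h1
    have h2 := hloop.skew_a (f z) (g z)
    simp only [map_add, LinearMap.add_apply]
    linear_combination h1 + h2
  -- Both `𝒩` and `q` of this type vanish on `F`, so `∇ e = d e`, and the surface condition applies.
  have ae : coeffA η V q z v (e z) = 0 := by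
    have h1 := hloop.b_apply (e z) (heGF z hzO₂).2
    have h2 := hloop.c_apply (heGF z hzO₂).2
    rw [formN, pt_neg, neg_apply, neg_eq_zero] at h1
    rw [coeffA, sub_apply, h1, h2, sub_zero]
  have he' : pder η e z v + coeffA η V q z v (e z) ∈ G z := by
    rw [ae, add_zero]
    exact hW.deriv O₂ e hOU₂ ⟨hO₂, he, heGF⟩ z hzO₂ v
  set t : Fin 2 → Fin 2 → ℂ := fun i j =>
    lor n (pder η (s i) z v + coeffA η V q z v (s i z)) (s j z) with ht
  have tskew (i j) : t i j = -t j i := by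
    rw [ht]; dsimp only
    rw [metric hO₁ hO₁ hzO₁ hzO₁ hOU₁ (ds i) (ds j) (fun w hw => hsG w hw i)
      (fun w hw => hsG w hw j), lor_symm]
  have hec := (heGF z hzO₂).1
  rw [SetLike.mem_coe, ← (hsp z hzO₁).2, Submodule.mem_span_range_iff_exists_fun] at hec
  obtain ⟨c, hc⟩ := hec
  -- This is `(∇ s_i, e) = -(s_i, ∇ e) = 0`.
  have hct (i) : c 0 * t i 0 + c 1 * t i 1 = 0 := by
    have h1 := metric hO₁ hO₂ hzO₁ hzO₂ hOU₁ (ds i) de (fun w hw => hsG w hw i)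
      (fun w hw => (heGF w hw).1)
    rw [hW.isotropicG z hzU _ (hsG z hzO₁ i) _ he', neg_zero, ← hc, Fin.sum_univ_two, map_add,
      map_smul, map_smul, smul_eq_mul, smul_eq_mul] at h1
    exact h1
  have t00 : t 0 0 = 0 := by linear_combination (1 / 2 : ℂ) * tskew 0 0
  have t11 : t 1 1 = 0 := by linear_combination (1 / 2 : ℂ) * tskew 1 1
  have t01 : t 0 1 = 0 := by
    by_contra h
    have c1 := hct 0
    have c0 := hct 1
    rw [t00, mul_zero, zero_add] at c1
    rw [t11, mul_zero, add_zero, tskew 1 0] at c0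
    have c1' : c 1 = 0 := (mul_eq_zero.1 c1).resolve_right h
    have c0' : c 0 = 0 := (mul_eq_zero.1 c0).resolve_right (neg_ne_zero.2 h)
    apply (hesp z hzO₂).1
    rw [← hc, Fin.sum_univ_two, c0', c1', zero_smul, zero_smul, add_zero]
  have t0 (i j) : t i j = 0 := by
    fin_cases i <;> fin_cases j
    · exact t00
    · exact t01
    · exact (tskew 1 0).trans (by rw [t01, neg_zero])
    · exact t11
  have hsmem (i) : pder η (s i) z v + coeffA η V q z v (s i z) ∈ perp (G z) := by
    rw [mem_perp', ← (hsp z hzO₁).2]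
    intro x hx
    refine Submodule.span_induction ?_ (by simp) ?_ ?_ hx
    · rintro _ ⟨j, rfl⟩; exact t0 i j
    · intro x x' _ _ h1 h2; rw [map_add, h1, h2, add_zero]
    · intro c x _ h1; rw [map_smul, h1, smul_zero]
  have hfin := isotropic_perp_eq (hN z hzU) (hV.finrank hzU) (hW.isotropicG z hzU)
    (hW.bundleG.finrank hzU) (hW.leG z hzU)
  rw [← hfin]
  refine ⟨?_, ?_⟩
  · rw [SetLike.mem_coe, mem_iff_refl (hN z hzU), map_add]
    have dr := (hV.contDiffOn_refl hN).differentiableAt_of_isOpen hU hzU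
    have h1 := pder_apply η dr dy v
    rw [pder_congr hy.isOpen (g := y)
      (fun w hw => refl_of_mem (hN w (hOU hw)) (hW.leG w (hOU hw) (hy.mem w hw))) hz] at h1
    have h2 := congrArg (fun X : Endo n => X (y z)) hloop.comm_a
    simp only [sub_apply, mul_apply_eq_comp] at h2
    rw [refl_of_mem (hN z hzU) (hW.leG z hzU (hy.mem z hz))] at h2
    have h3 : refl (V z) (pder η y z v) =
      pder η y z v - pder η (fun w => refl (V w)) z v (y z) := eq_sub_of_add_eq' h1.symm
    rw [h3, eq_add_of_sub_eq h2]
    abel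
  · rw [SetLike.mem_coe, mem_perp', ← (hsp z hzO₁).2]
    intro x hx
    refine Submodule.span_induction ?_ (by simp) ?_ ?_ hx
    · rintro _ ⟨j, rfl⟩
      rw [metric hy.isOpen hO₁ hz hzO₁ hOU dy (ds j) hy.mem (fun w hw => hsG w hw j),
        mem_perp.1 (hsmem j) _ (hy.mem z hz), neg_zero]
    · intro x x' _ _ h1 h2; rw [map_add, h1, h2, add_zero]
    · intro c x _ h1; rw [map_smul, h1, smul_zero]

/-! ### Transport of one half of the data by the parallel frame -/

section Transform

variable {η : ℂ} {U : Set ℂ} {V G F : ℂ → Submodule ℂ (Cn n)} {q qs : ℂ → ℂ →L[ℝ] Endo n}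
  {R rA rF : ℂ → Endo n} {a b c : ℂ → ℂ → Endo n}

/-- The reflection across the new bundle is `R⁻¹ ρ R`, and `dR = -(a + b + c) R`. In its derivative
`c` drops out since it commutes with `ρ`, and the commutator of `a` cancels `δ`; only the odd part
`b` remains. -/
theorem pt_formN_image {k : ℕ} (hU : IsOpen U) (hV : IsSubbundleOn k U V)
    (hN : ∀ z ∈ U, IsNondeg (V z)) (hR : ContDiffOn ℝ ∞ R U) (hRo : ∀ z ∈ U, IsOrth (R z))
    (hg : IsHalfGauge η U V F q R rA rF a b c) {z : ℂ} (hz : z ∈ U) (v : ℂ) :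
    pt η (formN (fun z => image (Ring.inverse (R z)) (V z)) z) v =
      Ring.inverse (R z) * b z v * R z := by
  have hS := contDiffOn_inverse hR hRo
  have hSo (w) (hw : w ∈ U) := (hRo w hw).inverse
  have hρ := hV.contDiffOn_refl hN
  have hV' := hV.image hS hSo
  have hN' (w) (hw : w ∈ U) := (hSo w hw).isNondeg_image (hN w hw)
  have e (w) (hw : w ∈ U) : refl (image (Ring.inverse (R w)) (V w)) =
      Ring.inverse (R w) * refl (V w) * R w := by
    rw [(hSo w hw).refl_image (hN w hw), Ring.inverse_inverse (hRo w hw).isUnit]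
  have dS := hS.differentiableAt_of_isOpen hU hz
  have dR := hR.differentiableAt_of_isOpen hU hz
  have dρ := hρ.differentiableAt_of_isOpen hU hz
  have dSρ := (contDiffOn_mul hS hρ).differentiableAt_of_isOpen hU hz
  rw [pt_formN hU hV' hN' hz, pder_congr hU e hz, pder_mul η dSρ dR, pder_mul η dS dρ,
    pder_inverse hU hR hRo η hz, hg.deriv z hz v, e z hz]
  have h := hg.loop z hz v
  have hba := h.comm_a
  have hbb := h.comm_b
  have hbc := h.comm_c (hN z hz)
  have hρρ := refl_mul_refl (hN z hz)
  have hSR := (hRo z hz).inverse_mul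
  have hRS := (hRo z hz).mul_inverse
  have key : ∀ {A : Type _} [Ring A] [Algebra ℂ A] {S R ρ δ a b c : A}, S * R = 1 → R * S = 1 →
      ρ * ρ = 1 → ρ * a - a * ρ = δ → ρ * b = -(b * ρ) → ρ * c = c * ρ →
      (-1 / 2 : ℂ) • (S * ρ * R * ((-(S * (-((a + b + c) * R)) * S) * ρ + S * δ) * R
        + S * ρ * (-((a + b + c) * R)))) = S * b * R := by
    intro A _ _ S R ρ δ a b c hSR hRS hρρ ha hb hc
    have e1 : -(S * (-((a + b + c) * R)) * S) = S * (a + b + c) := by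
      rw [mul_neg, neg_mul, neg_neg, mul_assoc, mul_assoc, hRS, mul_one]
    have e2 : (S * (a + b + c) * ρ + S * δ) * R + S * ρ * (-((a + b + c) * R)) =
        S * (((a + b + c) * ρ + δ - ρ * (a + b + c)) * R) := by noncomm_ring
    have e3 : (a + b + c) * ρ + δ - ρ * (a + b + c) = (-2 : ℂ) • (ρ * b) := by
      rw [← ha, mul_add, mul_add, hb, hc, add_mul, add_mul]; module
    rw [e1, e2, e3]
    have e4 : S * ρ * R * (S * ((-2 : ℂ) • (ρ * b) * R)) = (-2 : ℂ) • (S * b * R) := by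
      calc S * ρ * R * (S * ((-2 : ℂ) • (ρ * b) * R))
          = (-2 : ℂ) • (S * ρ * (R * S) * ρ * b * R) := by
            simp only [smul_mul_assoc, mul_smul_comm, mul_assoc]
        _ = (-2 : ℂ) • (S * (ρ * ρ) * b * R) := by rw [hRS, mul_one, mul_assoc S ρ ρ]
        _ = _ := by rw [hρρ, mul_one]
    rw [e4, smul_smul]; norm_num
  exact key hSR hRS hρρ hba hbb hbc

/-- The gauge transformation between the loops of connections of a surface and of its
transform. -/
theorem isGauge_formLoop {k : ℕ} (hU : IsOpen U) (hV : IsSubbundleOn k U V)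
    (hN : ∀ z ∈ U, IsNondeg (V z)) (hR : ContDiffOn ℝ ∞ R U) (hRo : ∀ z ∈ U, IsOrth (R z))
    (hg : IsHalfGauge η U V F q R rA rF a b c)
    (hqs : ∀ z ∈ U, ∀ v, pt η (qs z) v = Ring.inverse (R z) * c z v * R z) {l μ : ℂ}
    (hl : IsSpectral η l μ) {r : ℂ → Endo n} (hr : ContDiffOn ℝ ∞ r U)
    (h : IsGauge η U r (fun z v => pt η (formLoop V q l z) v)
      fun z v => a z v + μ • b z v + μ ^ 2 • c z v) :
    IsGauge η U (fun z => Ring.inverse (R z) * r z) (fun z v => pt η (formLoop V q l z) v)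
      fun z v => pt η (formLoop (fun z => image (Ring.inverse (R z)) (V z)) qs l z) v := by
  intro z hz v
  have hS := contDiffOn_inverse hR hRo
  beta_reduce
  rw [pder_mul η (hS.differentiableAt_of_isOpen hU hz) (hr.differentiableAt_of_isOpen hU hz),
    pder_inverse hU hR hRo η hz, hg.deriv z hz v, pt_formLoop hl (V := fun z => image _ _), coeffA,
    hqs z hz, pt_formN_image hU hV hN hR hRo hg hz]
  have e : pt η (formD (fun z => image (Ring.inverse (R z)) (V z)) z) v =
      -(Ring.inverse (R z) * b z v * R z) := by
    rw [← pt_formN_image hU hV hN hR hRo hg hz, formN, pt_neg, neg_neg]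
  rw [e]
  have h2 := h z hz v
  beta_reduce at h2
  have hRS := (hRo z hz).mul_inverse
  have key : ∀ {A : Type _} [Ring A] [Algebra ℂ A] {S R a b c r X dr : A}, R * S = 1 →
      (a + μ • b + μ ^ 2 • c) * r = r * X - dr →
      (-(S * b * R) - S * c * R + μ • (S * b * R) + μ ^ 2 • (S * c * R)) * (S * r) =
        S * r * X - (-(S * (-((a + b + c) * R)) * S) * r + S * dr) := by
    intro A _ _ S R a b c r X dr hRS h
    have e1 : R * (S * r) = r := by rw [← mul_assoc, hRS, one_mul]
    have e2 : -(S * (-((a + b + c) * R)) * S) = S * (a + b + c) := by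
      rw [mul_neg, neg_mul, neg_neg, mul_assoc, mul_assoc, hRS, mul_one]
    have e3 : S * r * X = S * ((a + μ • b + μ ^ 2 • c) * r) + S * dr := by
      rw [h, mul_sub, mul_assoc]; abel
    rw [e2, e3]
    simp only [add_mul, sub_mul, neg_mul, smul_mul_assoc, e1, mul_add, mul_smul_comm, mul_assoc]
    abel
  exact key hRS h2

/-- Conjugation by `R⁻¹` turns `d + a + b + c` into `d`, so the new conditions are those of the
gauged half loop. The rank of the intersection is the one item not local to a half, hence the
hypothesis `hinter`. -/
theorem IsHalfWillmore.transform (hW : IsHalfWillmore η U G F V q) (hU : IsOpen U)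
    (hV : IsSubbundleOn 4 U V) (hN : ∀ z ∈ U, IsNondeg (V z)) (hR : ContDiffOn ℝ ∞ R U)
    (hRo : ∀ z ∈ U, IsOrth (R z)) (hA : ContDiffOn ℝ ∞ rA U) (hAo : ∀ z ∈ U, IsOrth (rA z))
    (hAr : ∀ z ∈ U, refl (V z) * rA z = rA z * refl (V z))
    (hFo : ∀ z ∈ U, IsOrth (rF z))
    (hg : IsHalfGauge η U V F q R rA rF a b c)
    (hinter : IsSubbundleOn 1 U fun z =>
      image (Ring.inverse (R z) * rA z) (G z) ⊓ image (Ring.inverse (R z) * rF z) (F z))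
    (hqs : ∀ z ∈ U, ∀ v, pt η (qs z) v = Ring.inverse (R z) * c z v * R z) :
    IsHalfWillmore η U (fun z => image (Ring.inverse (R z) * rA z) (G z))
      (fun z => image (Ring.inverse (R z) * rF z) (F z))
      (fun z => image (Ring.inverse (R z)) (V z)) qs := by
  have hS := contDiffOn_inverse hR hRo
  have hSo (w) (hw : w ∈ U) := (hRo w hw).inverse
  have hSA := contDiffOn_mul hS hA
  have hSAo (w) (hw : w ∈ U) := (hSo w hw).mul (hAo w hw)
  have hSFo (w) (hw : w ∈ U) := (hSo w hw).mul (hFo w hw)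
  refine ⟨hW.bundleG.image hSA hSAo, fun z hz => (hSAo z hz).isIsotropic_image (hW.isotropicG z hz),
    fun z hz => (hSFo z hz).isIsotropic_image (hW.isotropicF z hz), fun z hz => ?_, fun z hz => ?_,
    hinter, ?_, ?_, ?_⟩
  · beta_reduce
    rw [image_mul]
    exact image_mono _ (image_le_of_comm (hN z hz) (hAr z hz) (hW.leG z hz))
  · beta_reduce
    rw [image_mul]
    exact image_mono _ (hg.loop z hz 0).le
  · intro O s hOU hs z hz v
    have hzU := hOU hz
    have hT := contDiffOn_inverse hSA hSAo
    set y : ℂ → Cn n := fun w => Ring.inverse (Ring.inverse (R w) * rA w) (s w) with hy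
    have hys : IsSectionOn G O y :=
      ⟨hs.isOpen, contDiffOn_apply (hT.mono hOU) hs.smooth,
        fun w hw => (hSAo w (hOU hw)).mem_image.1 (hs.mem w hw).1⟩
    have hsy (w) (hw : w ∈ O) : s w = (Ring.inverse (R w) * rA w) (y w) :=
      ((hSAo w (hOU hw)).apply_inverse _).symm
    have hcov := hW.covariant_mem hU hV hN hOU hys hz v
    -- A section of both new planes, pulled back by `R`, lies where the gauged `b` and `c` vanish.
    -- Its derivative is then governed by `a` alone, that is, by `coeffA` through `rA`.
    have hk : rA z (y z) ∈ image (rF z) (F z) := by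
      have h1 := (hs.mem z hz).2
      rw [SetLike.mem_coe, image_mul, (hSo z hzU).mem_image,
        Ring.inverse_inverse (hRo z hzU).isUnit, hsy z hz, mul_apply_eq_comp,
        (hRo z hzU).apply_inverse] at h1
      exact h1
    have hb := (hg.loop z hzU v).b_apply _ hk
    have hc := (hg.loop z hzU v).c_apply hk
    have dSA := hSA.differentiableAt_of_isOpen hU hzU
    have dS := hS.differentiableAt_of_isOpen hU hzU
    have dA := hA.differentiableAt_of_isOpen hU hzU
    have dy := hys.smooth.differentiableAt_of_isOpen hs.isOpen hz
    have hga := congrArg (fun X : Endo n => X (y z)) (hg.gauge z hzU v)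
    simp only [mul_apply_eq_comp, sub_apply] at hga
    refine ⟨_, hcov, ?_⟩
    rw [pder_congr hs.isOpen hsy hz, pder_apply η dSA dy, pder_mul η dS dA,
      pder_inverse hU hR hRo η hzU, hg.deriv z hzU v]
    have e2 : -(Ring.inverse (R z) * (-((a z v + b z v + c z v) * R z)) * Ring.inverse (R z)) =
        Ring.inverse (R z) * (a z v + b z v + c z v) := by
      rw [endo_mul_neg, endo_neg_mul, neg_neg, mul_assoc, mul_assoc, (hRo z hzU).mul_inverse,
        mul_one]
    rw [e2]
    change (Ring.inverse (R z) * rA z) (pder η y z v + coeffA η V q z v (y z)) = _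
    simp only [mul_apply_eq_comp, add_apply, map_add, hb, hc, hga, map_zero, map_sub]
    abel
  · rintro z hz v _ ⟨x, hx, rfl⟩
    beta_reduce
    rw [pt_formN_image hU hV hN hR hRo hg hz]
    change Ring.inverse (R z) (b z v (R z (Ring.inverse (R z) (rF z x)))) = 0
    have h0 := (hg.loop z hz v).b_apply (rF z x) ⟨x, hx, rfl⟩
    rw [(hRo z hz).apply_inverse, h0, map_zero]
  · intro z hz v
    beta_reduce
    rw [hqs z hz v, image_mul]
    exact wedge2_conj (hg.loop z hz v).mem_c (hSo z hz) (hRo z hz).inverse_mul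

end Transform

/-- On `V`, the endomorphism equal to `-1` on `L ⊕ ρL` and to `1` on its complement is a
reflection in a vector. -/
theorem exists_dress_neg_one {V L : Submodule ℂ (Cn n)} (hV : IsNondeg V) (hL : IsDressing V L) :
    ∃ w ∈ V, lor n w w ≠ 0 ∧
      ∀ x ∈ V, dress V L (-1) x = x - (2 * lor n w x / lor n w w) • w := by
  obtain ⟨l, rfl, h1, h3⟩ := hL
  have h2 := lor_refl_self hV h1
  have hw : lor n (l + refl V l) (l + refl V l) = 2 * lor n l (refl V l) := by
    simp only [map_add, LinearMap.add_apply, h1, h2, lor_symm (refl V l) l]; ring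
  refine ⟨l + refl V l, ?_, ?_, fun x hx => ?_⟩
  · rw [mem_iff_refl hV, map_add, refl_refl hV, add_comm]
  · rw [hw]; exact mul_ne_zero two_ne_zero h3
  · have e : lor n (refl V l) x = lor n l x := by rw [lor_refl hV, refl_of_mem hV hx]
    rw [dress_span_apply hV h1 h3, hw, map_add, LinearMap.add_apply, e]
    match_scalars
    · ring
    · field_simp; norm_num; ring
    · field_simp; norm_num; ring

/-- The first reflection moves `G` into the family of `F`, so the two planes are equal or disjoint;
reflecting `F` changes its family, and in either case the intersection becomes a line. -/
theorem finrank_dress_inf {V L L' G F : Submodule ℂ (Cn n)} (hV : IsNondeg V)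
    (h4 : Module.finrank ℂ V = 4) (hL : IsDressing V L) (hL' : IsDressing V L')
    (hG : IsIsotropic G) (hG2 : Module.finrank ℂ G = 2) (hGV : G ≤ V)
    (hF : IsIsotropic F) (hF2 : Module.finrank ℂ F = 2) (hFV : F ≤ V)
    (h1 : Module.finrank ℂ ↥(G ⊓ F) = 1) :
    Module.finrank ℂ ↥(image (dress V L (-1)) G ⊓ image (dress V L' (-1)) F) = 1 := by
  obtain ⟨w, hw, hww, hT⟩ := exists_dress_neg_one hV hL
  obtain ⟨w', hw', hww', hT'⟩ := exists_dress_neg_one hV hL'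
  have n1 : (-1 : ℂ) ≠ 0 := by norm_num
  have ho := isOrth_dress hV hL n1
  have hc : refl V * dress V L (-1) = dress V L (-1) * refl V := by
    rw [refl_mul_dress hV hL]; norm_num
  have hA := ho.isIsotropic_image hG
  have hA2 := (ho.finrank_image G).trans hG2
  have hAV := image_le_of_comm hV hc hGV
  rw [inf_comm]
  rcases reflect_eq_or_disjoint hV h4 hG hG2 hGV hF hF2 hFV hw hww hT h1 with h | h
  · rw [Submodule.eq_of_le_of_finrank_eq h (hA2.trans hF2.symm)]
    exact finrank_reflect_inf_self hV h4 hF hF2 hFV hw' hww' hT'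
  · exact finrank_reflect_inf_of_disjoint h4 hF hF2 hFV hA hA2 hAV hw' hww' hT'
      (by rw [inf_comm]; exact h)

theorem pt_adCov (T : Endo n) (A : ℂ →L[ℝ] Endo n) (η v : ℂ) :
    pt η (adCov T A) v = T * pt η A v * Ring.inverse T :=
  pt_comp η (ContinuousLinearMap.mulLeftRight ℂ (Endo n) T (Ring.inverse T)) A v

section Parts

variable {E : Type*} [NormedAddCommGroup E] [NormedSpace ℂ E] (θ : ℂ →L[ℝ] E) (v : ℂ)

theorem pt_one_part10 : pt 1 (part10 θ) v = pt 1 θ v := by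
  rw [pt_part10 (Or.inl rfl)]; norm_num

theorem pt_one_part01 : pt 1 (part01 θ) v = 0 := by
  rw [pt_part01 (Or.inl rfl)]; norm_num

theorem pt_neg_one_part10 : pt (-1) (part10 θ) v = 0 := by
  rw [pt_part10 (Or.inr rfl)]; norm_num

theorem pt_neg_one_part01 : pt (-1) (part01 θ) v = pt (-1) θ v := by
  rw [pt_part01 (Or.inr rfl)]; norm_num

end Parts

/-! ### The transformation over an open set, before reality -/

section Local

variable {U : Set ℂ} {V L L' L10 L01 : ℂ → Submodule ℂ (Cn n)} {q : ℂ → ℂ →L[ℝ] Endo n} {α β : ℂ}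

theorem rStar_zero {V L L' : Submodule ℂ (Cn n)} (hα : α ≠ 0) (hβ : β ≠ 0) :
    rStar V α β L L' 0 = dress V (hatL V α β L L') (-1) * dress V L 1 := by
  rw [rStar, qMap, pMap, zero_sub, zero_add, sub_zero, add_zero, neg_div, div_self hα, div_self hβ]

/-- The transform `Ad_{R⁻¹} (Ad_{r₀} θ^{1,0} + Ad_{r∞} θ^{0,1})` of a form. -/
def transformForm (R r₀ ri : Endo n) (θ : ℂ →L[ℝ] Endo n) : ℂ →L[ℝ] Endo n :=
  adCov (Ring.inverse R) (adCov r₀ (part10 θ) + adCov ri (part01 θ))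

/-- The two types are transformed separately, by the same `r*`, and then joined: their gauge
equations add up to one for the full loop, which carries flatness over. No reality is needed, only
that the second line is parallel at `β`. -/
theorem IsConstrainedWillmoreOn.transform (hU : IsOpen U)
    (hW : IsConstrainedWillmoreOn U L10 L01 V q) (hL : IsSubbundleOn 1 U L)
    (hD : ∀ z ∈ U, IsDressing (V z) (L z)) (hL' : IsSubbundleOn 1 U L')
    (hD' : ∀ z ∈ U, IsDressing (V z) (L' z))
    (hDh : ∀ z ∈ U, IsDressing (V z) (hatL (V z) α β (L z) (L' z)))
    (hα : α ≠ 0) (hβ : β ≠ 0) (hp : α + β ≠ 0) (hm : α - β ≠ 0)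
    (hα1 : α + 1 ≠ 0) (hα2 : α - 1 ≠ 0) (hβ1 : β + 1 ≠ 0) (hβ2 : β - 1 ≠ 0)
    (hpα : IsParallelOn U (formLoop V q α) L) (hpβ : IsParallelOn U (formLoop V q β) L') :
    IsConstrainedWillmoreOn U
      (fun z => image (Ring.inverse (rStar (V z) α β (L z) (L' z) 1)
        * rStarInf (V z) α β (L z) (L' z)) (L10 z))
      (fun z => image (Ring.inverse (rStar (V z) α β (L z) (L' z) 1)
        * rStar (V z) α β (L z) (L' z) 0) (L01 z))
      (fun z => image (Ring.inverse (rStar (V z) α β (L z) (L' z) 1)) (V z))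
      (fun z => transformForm (rStar (V z) α β (L z) (L' z) 1) (rStar (V z) α β (L z) (L' z) 0)
        (rStarInf (V z) α β (L z) (L' z)) (q z)) := by
  simp only [transformForm]
  have hV := hW.central.bundle
  have hN := hW.central.nondeg
  have hκ : (α - β) / (α + β) ≠ 0 := div_ne_zero hm hp
  have hLh := isSubbundleOn_hatL hV hN hL hD hL' hκ
  have hD10 := contDiffOn_formD hU hV hN
  have sq := hW.harmonic.smooth
  obtain ⟨a₁, b₁, c₁, hg₁, hr₁⟩ := exists_twoStep (η := 1) (by norm_num) hU hV hN hL hD hL' hD' hDh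
    hα hβ hp hm hα1 hα2 hβ1 hβ2 hW.half10 (Or.inl ⟨rfl, rfl⟩) (Or.inl ⟨rfl, rfl⟩)
    (isParallelProj_of_isParallelOn hU hV hN hL hD hpα 1)
    (isParallelProj_of_isParallelOn hU hV hN hL' hD' hpβ 1)
  obtain ⟨a₂, b₂, c₂, hg₂, hr₂⟩ := exists_twoStep (η := -1) (by norm_num) hU hV hN hL hD hL' hD' hDh
    hα hβ hp hm hα1 hα2 hβ1 hβ2 hW.half01 (Or.inr ⟨rfl, rfl⟩) (Or.inr ⟨rfl, rfl⟩)
    (isParallelProj_of_isParallelOn hU hV hN hL hD hpα (-1))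
    (isParallelProj_of_isParallelOn hU hV hN hL' hD' hpβ (-1))
  have n1 : (-1 : ℂ) ≠ 0 := by norm_num
  set Lh : ℂ → Submodule ℂ (Cn n) := fun z => hatL (V z) α β (L z) (L' z) with hLhdef
  set R : ℂ → Endo n := fun z => rStar (V z) α β (L z) (L' z) 1 with hRdef
  have e0 : (fun z => rStar (V z) α β (L z) (L' z) 0) =
      fun z => dress (V z) (Lh z) (-1) * dress (V z) (L z) 1 :=
    funext fun z => rStar_zero hα hβ
  have e1 : (fun z => rStarInf (V z) α β (L z) (L' z)) =
      fun z => dress (V z) (Lh z) 1 * dress (V z) (L z) (-1) := rfl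
  set r0 : ℂ → Endo n := fun z => rStar (V z) α β (L z) (L' z) 0 with hr0
  set ri : ℂ → Endo n := fun z => rStarInf (V z) α β (L z) (L' z) with hri
  rw [neg_neg, ← e0, ← e1] at hg₂
  rw [← e0, ← e1] at hg₁
  -- orthogonality and smoothness of the frames
  have sd (k : ℂ) := contDiffOn_dress hV hN hL hD k
  have sdh (k : ℂ) := contDiffOn_dress hV hN hLh hDh k
  have od {k : ℂ} (hk : k ≠ 0) (z) (hz : z ∈ U) := isOrth_dress (hN z hz) (hD z hz) hk
  have odh {k : ℂ} (hk : k ≠ 0) (z) (hz : z ∈ U) := isOrth_dress (hN z hz) (hDh z hz) hk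
  have smooth_r (l : ℂ) : ContDiffOn ℝ ∞ (fun z => rStar (V z) α β (L z) (L' z) l) U :=
    contDiffOn_mul (sdh _) (sd _)
  have orth_r {l : ℂ} (h1 : α + l ≠ 0) (h2 : α - l ≠ 0) (h3 : β + l ≠ 0) (h4 : β - l ≠ 0) (z)
      (hz : z ∈ U) : IsOrth (rStar (V z) α β (L z) (L' z) l) :=
    (odh (div_ne_zero (by rwa [← neg_sub, neg_ne_zero]) (by rwa [add_comm])) z hz).mul
      (od (div_ne_zero h2 h1) z hz)
  have sR : ContDiffOn ℝ ∞ R U := smooth_r 1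
  have oR : ∀ z ∈ U, IsOrth (R z) := orth_r hα1 hα2 hβ1 hβ2
  have sr0 : ContDiffOn ℝ ∞ r0 U := smooth_r 0
  have or0 : ∀ z ∈ U, IsOrth (r0 z) := orth_r (by simpa) (by simpa) (by simpa) (by simpa)
  have sri : ContDiffOn ℝ ∞ ri U := contDiffOn_mul (sdh 1) (sd (-1))
  have ori : ∀ z ∈ U, IsOrth (ri z) := fun z hz => (odh one_ne_zero z hz).mul (od n1 z hz)
  have i1 : ((-1 : ℂ))⁻¹ = -1 := by norm_num
  have comm0 : ∀ z ∈ U, refl (V z) * r0 z = r0 z * refl (V z) := fun z hz => by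
    rw [congrFun e0 z, ← mul_assoc, refl_mul_dress (hN z hz) (hDh z hz), mul_assoc,
      refl_mul_dress (hN z hz) (hD z hz), i1, inv_one, mul_assoc]
  have commi : ∀ z ∈ U, refl (V z) * ri z = ri z * refl (V z) := fun z hz => by
    rw [congrFun e1 z, ← mul_assoc, refl_mul_dress (hN z hz) (hDh z hz), mul_assoc,
      refl_mul_dress (hN z hz) (hD z hz), i1, inv_one, mul_assoc]
  -- the transformed form
  set qs : ℂ → ℂ →L[ℝ] Endo n := fun z => adCov (Ring.inverse (R z))
    (adCov (r0 z) (part10 (q z)) + adCov (ri z) (part01 (q z))) with hqs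
  have hqs₁ : ∀ z ∈ U, ∀ v, pt 1 (qs z) v = Ring.inverse (R z) * c₁ z v * R z := fun z hz v => by
    have e : c₁ z v = r0 z * pt 1 (q z) v * Ring.inverse (r0 z) := by
      rw [← hg₁.comm z hz v, mul_assoc, (or0 z hz).mul_inverse, mul_one]
    rw [hqs, pt_adCov, pt_add, pt_adCov, pt_adCov, pt_one_part10, pt_one_part01,
      Ring.inverse_inverse (oR z hz).isUnit, e, mul_zero, zero_mul, add_zero]
  have hqs₂ : ∀ z ∈ U, ∀ v, pt (-1) (qs z) v = Ring.inverse (R z) * c₂ z v * R z :=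
      fun z hz v => by
    have e : c₂ z v = ri z * pt (-1) (q z) v * Ring.inverse (ri z) := by
      rw [← hg₂.comm z hz v, mul_assoc, (ori z hz).mul_inverse, mul_one]
    rw [hqs, pt_adCov, pt_add, pt_adCov, pt_adCov, pt_neg_one_part10, pt_neg_one_part01,
      Ring.inverse_inverse (oR z hz).isUnit, e, mul_zero, zero_mul, zero_add]
  have sS := contDiffOn_inverse sR oR
  have oS (z) (hz : z ∈ U) := (oR z hz).inverse
  have sqs : ContDiffOn ℝ ∞ qs U := by
    have ad {T : ℂ → Endo n} {X : ℂ → ℂ →L[ℝ] Endo n} (hT : ContDiffOn ℝ ∞ T U)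
        (hTo : ∀ z ∈ U, IsOrth (T z)) (hX : ContDiffOn ℝ ∞ X U) :
        ContDiffOn ℝ ∞ (fun z => adCov (T z) (X z)) U := by
      rw [contDiffOn_form] at hX ⊢
      exact fun v => contDiffOn_mul (contDiffOn_mul hT (hX v)) (contDiffOn_inverse hT hTo)
    exact ad sS oS ((ad sr0 or0 (contDiffOn_part10 sq)).add (ad sri ori (contDiffOn_part01 sq)))
  -- the transformed bundles
  have hSi := contDiffOn_mul sS sri
  have hS0 := contDiffOn_mul sS sr0
  have oSi (z) (hz : z ∈ U) := (oS z hz).mul (ori z hz)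
  have oS0 (z) (hz : z ∈ U) := (oS z hz).mul (or0 z hz)
  have hVs := hV.image sS oS
  have hNs (z) (hz : z ∈ U) := (oS z hz).isNondeg_image (hN z hz)
  have le1 (z) (hz : z ∈ U) : image (Ring.inverse (R z) * ri z) (L10 z) ≤
      image (Ring.inverse (R z)) (V z) := by
    rw [image_mul]
    exact image_mono _ (image_le_of_comm (hN z hz) (commi z hz) (hW.half10.leG z hz))
  have le2 (z) (hz : z ∈ U) : image (Ring.inverse (R z) * r0 z) (L01 z) ≤
      image (Ring.inverse (R z)) (V z) := by
    rw [image_mul]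
    exact image_mono _ (image_le_of_comm (hN z hz) (comm0 z hz) (hW.half10.leF z hz))
  have hinter : IsSubbundleOn 1 U fun z => image (Ring.inverse (R z) * ri z) (L10 z) ⊓
      image (Ring.inverse (R z) * r0 z) (L01 z) := by
    refine isSubbundleOn_inf hNs (fun z hz => hVs.finrank hz) (hW.surface.bundle10.image hSi oSi)
      le1 (hW.surface.bundle01.image hS0 oS0)
      (fun z hz => (oS0 z hz).isIsotropic_image (hW.surface.isotropic01 z hz)) le2 fun z hz => ?_
    -- Here `r*(∞)` reduces to the factor `-1` of `L`, and `r*(0)` to the factor `-1` of `L̂`.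
    rw [image_mul, image_mul, ← (oS z hz).image_inf, (oS z hz).finrank_image, congrFun e0 z,
      congrFun e1 z, dress_one (hN z hz) (hDh z hz), dress_one (hN z hz) (hD z hz), one_mul,
      mul_one]
    exact finrank_dress_inf (hN z hz) (hV.finrank hz) (hD z hz) (hDh z hz)
      (hW.surface.isotropic10 z hz) (hW.surface.bundle10.finrank hz) (hW.half10.leG z hz)
      (hW.surface.isotropic01 z hz) (hW.surface.bundle01.finrank hz) (hW.half10.leF z hz)
      (hW.surface.bundle_inter.finrank hz)
  have half₁ := hW.half10.transform hU hV hN sR oR sri ori commi or0 hg₁ hinter hqs₁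
  have half₂ := hW.half01.transform hU hV hN sR oR sr0 or0 comm0 ori hg₂
    (by simpa only [inf_comm] using hinter) hqs₂
  refine ⟨⟨half₁.bundleG, half₂.bundleG, half₁.isotropicG, half₂.isotropicG, hinter, ?_, ?_⟩,
    ⟨hVs, hNs, fun z hz => sup_le (le1 z hz) (le2 z hz), ?_, ?_⟩, ⟨sqs, ?_, ?_⟩, ?_, ?_⟩
  · intro O s hO hs z hz v
    rw [part10_apply]; exact half₁.deriv O s hO hs z hz v
  · intro O s hO hs z hz v
    rw [part01_apply]; exact half₂.deriv O s hO (by simpa only [inf_comm] using hs) z hz v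
  · intro z hz v x hx
    rw [part10_apply]; exact half₁.central z hz v x hx
  · intro z hz v x hx
    rw [part01_apply]; exact half₂.central z hz v x hx
  · intro z hz v
    rw [← pt_add_pt (qs z) v]
    exact Submodule.mem_sup_left (Submodule.add_mem _
      (wedge2_mono (le2 z hz) (half₁.multiplier z hz v))
      (wedge2_mono (le1 z hz) (half₂.multiplier z hz v)))
  · intro l hl
    have hDs := contDiffOn_formD hU hVs hNs
    -- The excluded set consists of the zeros and poles of the two simple factors.
    refine isFlatOn_formLoop_of_cofinite hU hDs sqs
      (S := {α, -α, β, -β}) (Set.toFinite _) (fun l hlS hl => ?_) hl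
    simp only [Set.mem_insert_iff, Set.mem_singleton_iff, not_or] at hlS
    have k1 : α + l ≠ 0 := fun h => hlS.2.1 (by linear_combination h)
    have k2 : α - l ≠ 0 := fun h => hlS.1 (by linear_combination -h)
    have k3 : β + l ≠ 0 := fun h => hlS.2.2.2 (by linear_combination h)
    have k4 : β - l ≠ 0 := fun h => hlS.2.2.1 (by linear_combination -h)
    have g₁ := isGauge_formLoop hU hV hN sR oR hg₁ hqs₁ (Or.inl ⟨rfl, rfl⟩) (smooth_r l)
      (hr₁ l _ (Or.inl ⟨rfl, rfl⟩) hl k1 k2 k3 k4)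
    have g₂ := isGauge_formLoop hU hV hN sR oR hg₂ hqs₂ (Or.inr ⟨rfl, rfl⟩) (smooth_r l)
      (hr₂ l _ (Or.inr ⟨rfl, rfl⟩) hl k1 k2 k3 k4)
    have oSr (z) (hz : z ∈ U) := (oS z hz).mul (orth_r k1 k2 k3 k4 z hz)
    refine isFlatOn_gauge hU (contDiffOn_formLoop hD10 sq l) (contDiffOn_formLoop hDs sqs l)
      (contDiffOn_mul sS (smooth_r l)) (fun z hz => (oSr z hz).mul_inverse) (fun z hz v => ?_)
      (hW.harmonic.flat l hl)
    have h1 := g₁ z hz v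
    have h2 := g₂ z hz v
    beta_reduce at h1 h2
    rw [← pt_add_pt, ← pt_add_pt (formLoop V q l z), ← pt_add_pt (fderiv ℝ _ z), add_mul, h1, h2,
      mul_add]
    simp only [pder]
    abel
  · intro z hz v
    rw [part10_apply]; exact half₁.multiplier z hz v
  · intro z hz v
    rw [part01_apply]; exact half₂.multiplier z hz v

end Local

/-! ### Complex conjugation of endomorphisms -/

/-- The complex conjugate of an endomorphism. -/
def conjT (T : Endo n) : Endo n :=
  LinearMap.toContinuousLinearMap
    { toFun := fun x => conjE n (T (conjE n x))
      map_add' := fun x y => by simp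
      map_smul' := fun c x => by simp [conjE_smul] }

theorem conjT_apply (T : Endo n) (x : Cn n) : conjT T x = conjE n (T (conjE n x)) := rfl

theorem conjT_conjE (T : Endo n) (x : Cn n) : conjT T (conjE n x) = conjE n (T x) := by
  rw [conjT_apply, conjE_conjE]

theorem conjT_eq_iff {S T : Endo n} :
    conjT S = T ↔ ∀ x, conjE n (S x) = T (conjE n x) := by
  constructor
  · rintro rfl x; rw [conjT_conjE]
  · intro h; ext1 x; rw [conjT_apply, h, conjE_conjE]

theorem conjT_add (S T : Endo n) : conjT (S + T) = conjT S + conjT T := by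
  ext1 x; simp [conjT_apply]

theorem conjT_sub (S T : Endo n) : conjT (S - T) = conjT S - conjT T := by
  ext1 x; simp [conjT_apply]

theorem conjT_smul (c : ℂ) (T : Endo n) : conjT (c • T) = star c • conjT T := by
  ext1 x; simp [conjT_apply, conjE_smul]

theorem conjT_mul (S T : Endo n) : conjT (S * T) = conjT S * conjT T := by
  ext1 x; simp [conjT_apply]

theorem conjT_one : conjT (1 : Endo n) = 1 := by
  ext1 x; simp [conjT_apply]

theorem conjSub_image (T : Endo n) (F : Submodule ℂ (Cn n)) :
    conjSub (image T F) = image (conjT T) (conjSub F) := by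
  ext x
  rw [mem_conjSub, mem_image, mem_image]
  constructor
  · rintro ⟨y, hy, h⟩
    exact ⟨conjE n y, mem_conjSub.2 (by rwa [conjE_conjE]), by rw [conjT_conjE, h, conjE_conjE]⟩
  · rintro ⟨y, hy, rfl⟩
    exact ⟨conjE n y, mem_conjSub.1 hy, by rw [conjT_apply, conjE_conjE]⟩

theorem conjSub_inf (F G : Submodule ℂ (Cn n)) : conjSub (F ⊓ G) = conjSub F ⊓ conjSub G := by
  ext x; simp [mem_conjSub]

theorem ringInverse_eq {R : Type*} [Ring R] {X Y : R} (h : X * Y = 1) (h' : Y * X = 1) :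
    Ring.inverse X = Y := Ring.inverse_unit (⟨X, Y, h, h'⟩ : Rˣ)

theorem conjT_inverse {T : Endo n} (h : IsUnit T) :
    conjT (Ring.inverse T) = Ring.inverse (conjT T) := by
  symm
  apply ringInverse_eq
  · rw [← conjT_mul, Ring.mul_inverse_cancel T h, conjT_one]
  · rw [← conjT_mul, Ring.inverse_mul_cancel T h, conjT_one]

/-! ### Real planes -/

/-- Conjugation is only semilinear, so the dimension is bounded by conjugating a basis; being an
involution, it gives the reverse bound. -/
theorem finrank_conjSub (F : Submodule ℂ (Cn n)) :
    Module.finrank ℂ (conjSub F) = Module.finrank ℂ F := by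
  have key (F : Submodule ℂ (Cn n)) : Module.finrank ℂ (conjSub F) ≤ Module.finrank ℂ F := by
    let b := Module.finBasis ℂ F
    have h : conjSub F ≤ Submodule.span ℂ (Set.range fun i => conjE n (b i)) := by
      rintro _ ⟨x, hx, rfl⟩
      have e := b.sum_repr ⟨x, hx⟩
      have e2 := congrArg (fun y : F => conjE n (y : Cn n)) e
      simp only [Submodule.coe_sum, Submodule.coe_smul, map_sum, conjE_smul] at e2
      change conjE n x ∈ _
      rw [← e2]
      exact Submodule.sum_mem _ fun i _ => Submodule.smul_mem _ _ (Submodule.subset_span ⟨i, rfl⟩)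
    refine (Submodule.finrank_mono h).trans ((finrank_range_le_card _).trans ?_)
    rw [Fintype.card_fin]
  refine le_antisymm (key F) ?_
  conv_lhs => rw [← conjSub_conjSub F]
  exact key _

theorem conjSub_eq_of_le {F G : Submodule ℂ (Cn n)} (h : conjSub F ≤ G)
    (hFG : Module.finrank ℂ G = Module.finrank ℂ F) : conjSub F = G :=
  Submodule.eq_of_le_of_finrank_eq h ((finrank_conjSub F).trans hFG.symm)

/-- In a real space, the isotropic planes meeting in a real line are conjugate to each other. -/
theorem conjSub_isotropic {V A B : Submodule ℂ (Cn n)} (hV : IsNondeg V)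
    (h4 : Module.finrank ℂ V = 4) (hA : IsIsotropic A) (hA2 : Module.finrank ℂ A = 2)
    (hAV : A ≤ V) (hB : IsIsotropic B) (hB2 : Module.finrank ℂ B = 2) (hBV : B ≤ V)
    (hAB : Module.finrank ℂ ↥(A ⊓ B) = 1) (hr : conjSub V = V)
    (hr' : conjSub (A ⊓ B) = A ⊓ B) : conjSub A = B := by
  obtain ⟨e, he, he0, hmul⟩ := exists_of_finrank_eq_one hAB
  have hce : conjE n e ∈ A ⊓ B := by rw [← mem_conjSub, hr']; exact he
  -- a vector of `A` whose time component vanishes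
  obtain ⟨x, hxA, hx0, hxl⟩ : ∃ x ∈ A, x ≠ 0 ∧ x (Fin.last (n + 1)) = 0 := by
    let φ : A →ₗ[ℂ] ℂ := (EuclideanSpace.projₗ (𝕜 := ℂ) (Fin.last (n + 1))).comp A.subtype
    have h1 : 0 < Module.finrank ℂ (LinearMap.ker φ) := by
      have h2 := LinearMap.finrank_range_add_finrank_ker φ
      have h3 := (LinearMap.range φ).finrank_le
      rw [hA2] at h2
      rw [Module.finrank_self] at h3
      omega
    rw [Module.finrank_pos_iff] at h1
    obtain ⟨⟨⟨x, hx⟩, hk⟩, h0⟩ := exists_ne (0 : LinearMap.ker φ)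
    refine ⟨x, hx, fun h => h0 (by ext1; ext1; exact h), hk⟩
  -- If `x̄` were in the isotropic plane `A`, then `(x, x̄) = 0`, impossible for a non-zero vector
  -- without time component.
  have hcx : conjE n x ∉ A := fun h => hx0 (eq_zero_of_lor_conjE (hA x hxA _ h) hxl)
  have hxe : ∀ c : ℂ, c • e ≠ x := by
    rintro c rfl
    exact hcx (by rw [conjE_smul]; exact A.smul_mem _ hce.1)
  have hspan := span_pair_eq hA2 hxA he.1 he0 hxe
  have hcxV : conjE n x ∈ V := by rw [← mem_conjSub, hr]; exact hAV hxA
  -- `A + B` is the orthogonal of `e` in `V`, and `x̄ ⟂ e` because the line of `e` is real.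
  have hmem : conjE n x ∈ A ⊔ B := by
    rw [sup_eq_inf_perp hV h4 hA hA2 hAV hB hB2 hBV hAB he he0]
    refine ⟨hcxV, mem_perp.2 fun y hy => ?_⟩
    obtain ⟨c, rfl⟩ := Submodule.mem_span_singleton.1 hy
    have := lor_conjE (conjE n e) x
    rw [conjE_conjE, hA _ hce.1 x hxA, star_zero] at this
    simp [this]
  obtain ⟨a, ha, b, hb, hab⟩ := Submodule.mem_sup.1 hmem
  have h1 : lor n a b = 0 := by
    have h2 := lor_conjE x x
    rw [hA x hxA x hxA, star_zero, ← hab] at h2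
    simp only [map_add, LinearMap.add_apply, hA a ha a ha, hB b hb b hb, lor_symm b a] at h2
    linear_combination (1 / 2 : ℂ) * h2
  have hbA : b ∉ A := fun h => hcx (hab ▸ A.add_mem ha h)
  have hbe : ∀ c : ℂ, c • e ≠ b := by
    rintro c rfl; exact hbA (A.smul_mem _ he.1)
  -- As `x̄` is null, `a ⟂ b`; so `a` is orthogonal to the plane `B` spanned by `b` and `e`, hence
  -- lies in it.
  have haB : a ∈ B := by
    have h3 : a ∈ V ⊓ perp B := by
      refine ⟨hAV ha, mem_perp'.2 fun y hy => ?_⟩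
      rw [← span_pair_eq hB2 hb he.2 he0 hbe, Submodule.mem_span_pair] at hy
      obtain ⟨s, t, rfl⟩ := hy
      rw [map_add, map_smul, map_smul, h1, hA a ha e he.1, smul_zero, smul_zero, add_zero]
    rwa [isotropic_perp_eq hV h4 hB hB2 hBV] at h3
  have hcxB : conjE n x ∈ B := hab ▸ B.add_mem haB hb
  refine conjSub_eq_of_le ?_ (hB2.trans hA2.symm)
  rintro _ ⟨y, hy, rfl⟩
  rw [SetLike.mem_coe, ← hspan, Submodule.mem_span_pair] at hy
  obtain ⟨s, t, rfl⟩ := hy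
  change conjE n _ ∈ B
  rw [map_add, conjE_smul, conjE_smul]
  exact B.add_mem (B.smul_mem _ hcxB) (B.smul_mem _ hce.2)

/-! ### Reality of the Bäcklund transformation -/

/-- If `(l, ρl)` vanished, `ρl` would be a non-zero element of `ρL ∩ L^⊥`. -/
theorem IsDressing.of_transverse {V L : Submodule ℂ (Cn n)} (hV : IsNondeg V)
    (h1 : Module.finrank ℂ L = 1) (h2 : IsIsotropic L) (h3 : Backlund.image (refl V) L ⊓ perp L = ⊥) :
    IsDressing V L := by
  obtain ⟨l, hl, hl0, hmul⟩ := exists_of_finrank_eq_one h1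
  have hspan : L = Submodule.span ℂ {l} := by
    ext x
    rw [Submodule.mem_span_singleton]
    exact ⟨hmul x, fun ⟨c, hc⟩ => hc ▸ L.smul_mem c hl⟩
  refine ⟨l, hspan, h2 l hl l hl, fun h0 => hl0 ?_⟩
  have h4 : refl V l ∈ Backlund.image (refl V) L ⊓ perp L := by
    refine ⟨⟨l, hl, rfl⟩, mem_perp.2 fun y hy => ?_⟩
    obtain ⟨c, rfl⟩ := hmul y hy
    simp [h0]
  rw [h3, Submodule.mem_bot] at h4
  rw [← refl_refl hV l, h4, map_zero]

theorem conjT_part10 {θ : ℂ →L[ℝ] Endo n} (hθ : ∀ v, conjT (θ v) = θ v) (v : ℂ) :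
    conjT (part10 θ v) = part01 θ v := by
  have s1 : star (1 / 2 : ℂ) = 1 / 2 := by simp
  have s2 : star (1 * Complex.I) = -1 * Complex.I := by simp
  simp only [part10_apply, part01_apply, pt, conjT_smul, conjT_sub, hθ, s1, s2]

theorem conjT_part01 {θ : ℂ →L[ℝ] Endo n} (hθ : ∀ v, conjT (θ v) = θ v) (v : ℂ) :
    conjT (part01 θ v) = part10 θ v := by
  have s1 : star (1 / 2 : ℂ) = 1 / 2 := by simp
  have s2 : star (-1 * Complex.I) = 1 * Complex.I := by simp
  simp only [part10_apply, part01_apply, pt, conjT_smul, conjT_sub, hθ, s1, s2]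

/-! ### Arithmetic of the parameters `α` and `1/ᾱ` -/

section Parameter

variable {α : ℂ}

theorem star_mul_self_eq (α : ℂ) : α * star α = ((‖α‖ ^ 2 : ℝ) : ℂ) := by
  rw [← Complex.normSq_eq_norm_sq, ← Complex.mul_conj]; rfl

theorem add_star_inv_ne_zero (h0 : α ≠ 0) : α + (star α)⁻¹ ≠ 0 := by
  intro h
  have h2 : star α ≠ 0 := star_ne_zero.2 h0
  have h3 : α * star α = -1 := by field_simp at h; linear_combination h
  rw [star_mul_self_eq] at h3
  have h4 : ‖α‖ ^ 2 = -1 := by exact_mod_cast h3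
  nlinarith [sq_nonneg ‖α‖]

theorem sub_star_inv_ne_zero (h0 : α ≠ 0) (h1 : ‖α‖ ≠ 1) : α - (star α)⁻¹ ≠ 0 := by
  intro h
  have h2 : star α ≠ 0 := star_ne_zero.2 h0
  have h3 : α * star α = 1 := by field_simp at h; linear_combination h
  rw [star_mul_self_eq] at h3
  have h4 : ‖α‖ ^ 2 = 1 := by exact_mod_cast h3
  exact h1 ((pow_eq_one_iff_of_nonneg (norm_nonneg α) two_ne_zero).1 h4)

theorem add_one_ne_zero_of_norm (h1 : ‖α‖ ≠ 1) : α + 1 ≠ 0 := fun h =>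
  h1 (by rw [eq_neg_of_add_eq_zero_left h]; simp)

theorem sub_one_ne_zero_of_norm (h1 : ‖α‖ ≠ 1) : α - 1 ≠ 0 := fun h =>
  h1 (by rw [sub_eq_zero.1 h]; simp)

theorem norm_star_inv_ne_one (h1 : ‖α‖ ≠ 1) : ‖(star α)⁻¹‖ ≠ 1 := by
  rw [norm_inv, norm_star]; simpa using h1

end Parameter

/-! ### Reality of the transform at a point -/

section Point

variable {V L : Submodule ℂ (Cn n)} {α : ℂ}

/-- The conjugation of the values of `r*` introduces this constant factor. -/
def conjFactor (V L : Submodule ℂ (Cn n)) (α : ℂ) : Endo n :=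
  dress V (conjSub (hatL V α (star α)⁻¹ L (conjSub L))) (-1) * dress V L (-1)

variable (hV : IsNondeg V) (hr : conjSub V = V) (hL : IsDressing V L) (h0 : α ≠ 0)
  (h1 : ‖α‖ ≠ 1) (hL' : IsDressing V (hatL V α (star α)⁻¹ L (conjSub L)))

include hV hr hL hL'

theorem isOrth_conjFactor : IsOrth (conjFactor V L α) :=
  (isOrth_dress hV (hL'.conj hV hr) (by norm_num)).mul (isOrth_dress hV hL (by norm_num))

theorem refl_mul_conjFactor :
    refl V * conjFactor V L α = conjFactor V L α * refl V := by
  have i1 : ((-1 : ℂ))⁻¹ = -1 := by norm_num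
  rw [conjFactor, ← mul_assoc, refl_mul_dress hV (hL'.conj hV hr), mul_assoc,
    refl_mul_dress hV hL, i1, mul_assoc]

include h0 h1

/-- For `β = 1/ᾱ` the constant `κ = (α-β)/(α+β)` equals `(|α|²-1)/(|α|²+1)`, hence is real. The last
two hypotheses are those of permutability with denominators cleared. -/
theorem conjT_dressTwo {a b a' b' : ℂ} (ha : a ≠ 0) (hb : b ≠ 0) (ha' : a' = -star b)
    (hb' : b' = -star a) (hκa : α + (star α)⁻¹ + (α - (star α)⁻¹) * a' ≠ 0)
    (hab : (α - (star α)⁻¹) * (1 - a' * b') = (b' - a') * (α + (star α)⁻¹)) :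
    conjT (dressTwo V L (hatL V α (star α)⁻¹ L (conjSub L)) a b) =
      conjFactor V L α * dressTwo V L (hatL V α (star α)⁻¹ L (conjSub L)) a' b' := by
  have hp := add_star_inv_ne_zero h0
  have hm := sub_star_inv_ne_zero h0 h1
  rw [conjT_eq_iff]
  intro x
  refine conjE_dressTwo hV hr hL (div_ne_zero hm hp) ?_ hL' ha hb ha' hb' ?_ ?_ x
  · have h2 : star α ≠ 0 := star_ne_zero.2 h0
    have hp' : (star α : ℂ) + α⁻¹ ≠ 0 := by
      have := star_ne_zero.2 hp
      simpa using this
    rw [star_div₀, star_sub, star_add, star_inv₀, star_star, div_eq_div_iff hp' hp]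
    field_simp
  · intro h
    apply hκa
    generalize (star α)⁻¹ = β at hp h ⊢
    field_simp at h
    linear_combination h
  · rw [div_mul_eq_mul_div, hab, mul_div_assoc, div_self hp, mul_one]

/-- The point `λ = 1` is fixed by `λ ↦ 1 / conj λ`: the values `a', b'` coincide with `a, b`. -/
theorem conjT_rStar_one : conjT (rStar V α (star α)⁻¹ L (conjSub L) 1) =
    conjFactor V L α * rStar V α (star α)⁻¹ L (conjSub L) 1 := by
  have a1 := add_one_ne_zero_of_norm h1
  have a2 := sub_one_ne_zero_of_norm h1
  have b1 := add_one_ne_zero_of_norm (norm_star_inv_ne_one h1)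
  have b2 := sub_one_ne_zero_of_norm (norm_star_inv_ne_one h1)
  have s0 : star α ≠ 0 := star_ne_zero.2 h0
  have s1 : star α + 1 ≠ 0 := add_one_ne_zero_of_norm (by rwa [norm_star])
  have s2 : star α - 1 ≠ 0 := sub_one_ne_zero_of_norm (by rwa [norm_star])
  have e : rStar V α (star α)⁻¹ L (conjSub L) 1 =
      dressTwo V L (hatL V α (star α)⁻¹ L (conjSub L)) ((1 - α) / (1 + α))
        ((1 - star α) * -1 / (star α + 1)) := by
    rw [rStar, qMap, pMap, dressTwo]
    have e1 : (1 - (star α)⁻¹) / (1 + (star α)⁻¹) = (1 - star α) * -1 / (star α + 1) := by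
      rw [div_eq_div_iff (by rwa [add_comm]) s1]; field_simp; ring
    have e2 : (α - 1) / (α + 1) = -((1 - α) / (1 + α)) := by rw [add_comm α]; ring
    rw [e1, e2]
  have a1' : 1 + α ≠ 0 := by rwa [add_comm]
  have s1' : 1 + star α ≠ 0 := by rwa [add_comm]
  have a2' : 1 - α ≠ 0 := by rw [← neg_sub]; exact neg_ne_zero.2 a2
  have s2' : 1 - star α ≠ 0 := by rw [← neg_sub]; exact neg_ne_zero.2 s2
  rw [e]
  refine conjT_dressTwo hV hr hL h0 h1 hL' (div_ne_zero a2' a1')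
    (div_ne_zero (mul_ne_zero s2' (by norm_num)) s1) ?_ ?_ ?_ ?_
  · simp only [star_div₀, star_mul', star_sub, star_add, star_one, star_star, star_neg]
    field_simp; ring
  · simp only [star_div₀, star_sub, star_add, star_one]
    field_simp; ring
  · have : α + (star α)⁻¹ + (α - (star α)⁻¹) * ((1 - α) / (1 + α)) =
        2 * α * ((star α)⁻¹ + 1) / (1 + α) := by
      field_simp; ring
    rw [this]
    exact div_ne_zero (mul_ne_zero (mul_ne_zero two_ne_zero h0) b1) a1'
  · field_simp; ring

/-- The points `0` and `∞`, where `a = b = -1` and `a = b = 1`, are exchanged by `λ ↦ 1 / conj λ`.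
-/
theorem conjT_rStar_zero : conjT (rStar V α (star α)⁻¹ L (conjSub L) 0) =
    conjFactor V L α * rStarInf V α (star α)⁻¹ L (conjSub L) := by
  have s0 : star α ≠ 0 := star_ne_zero.2 h0
  have e := conjT_dressTwo hV hr hL h0 h1 hL' (a := -1) (b := -1) (a' := 1) (b' := 1)
    (by norm_num) (by norm_num) (by simp) (by simp)
    (by ring_nf; exact mul_ne_zero h0 two_ne_zero) (by ring)
  rw [rStar_zero h0 (inv_ne_zero s0)]
  rw [dressTwo, dressTwo, neg_neg] at e
  exact e

theorem conjT_rStarInf : conjT (rStarInf V α (star α)⁻¹ L (conjSub L)) =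
    conjFactor V L α * rStar V α (star α)⁻¹ L (conjSub L) 0 := by
  have s0 : star α ≠ 0 := star_ne_zero.2 h0
  have e := conjT_dressTwo hV hr hL h0 h1 hL' (a := 1) (b := 1) (a' := -1) (b' := -1)
    (by norm_num) (by norm_num) (by simp) (by simp)
    (by ring_nf; exact mul_ne_zero (inv_ne_zero s0) two_ne_zero) (by ring)
  rw [rStar_zero h0 (inv_ne_zero s0)]
  rw [dressTwo, dressTwo, neg_neg] at e
  exact e

omit hr h0 in
theorem isOrth_rStar_one : IsOrth (rStar V α (star α)⁻¹ L (conjSub L) 1) := by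
  have a1 := add_one_ne_zero_of_norm h1
  have a2 := sub_one_ne_zero_of_norm h1
  have b1 := add_one_ne_zero_of_norm (norm_star_inv_ne_one h1)
  have b2 := sub_one_ne_zero_of_norm (norm_star_inv_ne_one h1)
  refine (isOrth_dress hV hL' (div_ne_zero ?_ (by rwa [add_comm]))).mul
    (isOrth_dress hV hL (div_ne_zero a2 a1))
  rw [← neg_sub]; exact neg_ne_zero.2 b2

omit hr h1 in
theorem isOrth_rStar_zero : IsOrth (rStar V α (star α)⁻¹ L (conjSub L) 0) := by
  rw [rStar_zero h0 (inv_ne_zero (star_ne_zero.2 h0))]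
  exact (isOrth_dress hV hL' (by norm_num)).mul (isOrth_dress hV hL one_ne_zero)

omit hr h0 h1 in
theorem isOrth_rStarInf : IsOrth (rStarInf V α (star α)⁻¹ L (conjSub L)) :=
  (isOrth_dress hV hL' one_ne_zero).mul (isOrth_dress hV hL (by norm_num))

/-- The constant factor cancels here; this is why the normalisation by `r*(1)⁻¹` produces real
objects. -/
theorem conjT_inverse_rStar_one :
    conjT (Ring.inverse (rStar V α (star α)⁻¹ L (conjSub L) 1)) * conjFactor V L α =
      Ring.inverse (rStar V α (star α)⁻¹ L (conjSub L) 1) := by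
  have ho := isOrth_rStar_one hV hL h1 hL'
  have hK := isOrth_conjFactor hV hr hL hL'
  rw [conjT_inverse ho.isUnit, conjT_rStar_one hV hr hL h0 h1 hL']
  have e : Ring.inverse (conjFactor V L α * rStar V α (star α)⁻¹ L (conjSub L) 1) =
      Ring.inverse (rStar V α (star α)⁻¹ L (conjSub L) 1) * Ring.inverse (conjFactor V L α) := by
    apply ringInverse_eq
    · rw [mul_assoc, ← mul_assoc (rStar _ _ _ _ _ _), ho.mul_inverse, one_mul, hK.mul_inverse]
    · rw [mul_assoc, ← mul_assoc (Ring.inverse (conjFactor _ _ _)), hK.inverse_mul, one_mul,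
        ho.inverse_mul]
  rw [e, mul_assoc, hK.inverse_mul, mul_one]

/-- The constant factor commutes with `ρ` and therefore preserves `V`. -/
theorem conjSub_transform :
    conjSub (image (Ring.inverse (rStar V α (star α)⁻¹ L (conjSub L) 1)) V) =
      image (Ring.inverse (rStar V α (star α)⁻¹ L (conjSub L) 1)) V := by
  have hK := isOrth_conjFactor hV hr hL hL'
  have hKV : image (conjFactor V L α) V = V :=
    Submodule.eq_of_le_of_finrank_eq
      (image_le_of_comm hV (refl_mul_conjFactor hV hr hL hL') le_rfl) (hK.finrank_image V)
  rw [conjSub_image, hr]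
  nth_rewrite 2 [← hKV]
  rw [← image_mul, conjT_inverse_rStar_one hV hr hL h0 h1 hL']

theorem conjSub_transform10 (A : Submodule ℂ (Cn n)) :
    conjSub (image (Ring.inverse (rStar V α (star α)⁻¹ L (conjSub L) 1)
        * rStarInf V α (star α)⁻¹ L (conjSub L)) A) =
      image (Ring.inverse (rStar V α (star α)⁻¹ L (conjSub L) 1)
        * rStar V α (star α)⁻¹ L (conjSub L) 0) (conjSub A) := by
  rw [conjSub_image, conjT_mul, conjT_rStarInf hV hr hL h0 h1 hL', ← mul_assoc,
    conjT_inverse_rStar_one hV hr hL h0 h1 hL']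

/-- Conjugation exchanges the types of `θ` as well as `r*(0)` and `r*(∞)`, so the two summands are
interchanged. -/
theorem conjT_transformForm {θ : ℂ →L[ℝ] Endo n} (hθ : ∀ v, conjT (θ v) = θ v) (v : ℂ) :
    conjT (transformForm (rStar V α (star α)⁻¹ L (conjSub L) 1)
        (rStar V α (star α)⁻¹ L (conjSub L) 0) (rStarInf V α (star α)⁻¹ L (conjSub L)) θ v) =
      transformForm (rStar V α (star α)⁻¹ L (conjSub L) 1)
        (rStar V α (star α)⁻¹ L (conjSub L) 0) (rStarInf V α (star α)⁻¹ L (conjSub L)) θ v := by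
  have ho := isOrth_rStar_one hV hL h1 hL'
  have ho0 := isOrth_rStar_zero hV hL h0 hL'
  have hoi := isOrth_rStarInf hV hL hL'
  have hK := isOrth_conjFactor hV hr hL hL'
  have e0 := conjT_rStar_zero hV hr hL h0 h1 hL'
  have ei := conjT_rStarInf hV hr hL h0 h1 hL'
  have eS := conjT_inverse_rStar_one hV hr hL h0 h1 hL'
  have eR := conjT_rStar_one hV hr hL h0 h1 hL'
  have p10 := conjT_part10 hθ v
  have p01 := conjT_part01 hθ v
  have ad (T : Endo n) (A : ℂ →L[ℝ] Endo n) : adCov T A v = T * A v * Ring.inverse T := rfl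
  rw [transformForm, ad, add_apply, ad, ad, Ring.inverse_inverse ho.isUnit]
  have inv {X K Y : Endo n} (hX : IsOrth X) (hY : IsOrth Y) (hK : IsOrth K)
      (e : conjT X = K * Y) : conjT (Ring.inverse X) = Ring.inverse Y * Ring.inverse K := by
    rw [conjT_inverse hX.isUnit, e]
    apply ringInverse_eq
    · rw [mul_assoc, ← mul_assoc Y, hY.mul_inverse, one_mul, hK.mul_inverse]
    · rw [mul_assoc, ← mul_assoc (Ring.inverse K), hK.inverse_mul, one_mul, hY.inverse_mul]
  have i0 := inv ho0 hoi hK e0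
  have ii := inv hoi ho0 hK ei
  simp only [conjT_mul, conjT_add, p10, p01, e0, ei, i0, ii, eR]
  nth_rewrite 2 [← eS]
  have hK1 := hK.inverse_mul
  simp only [mul_add, add_mul, mul_assoc]
  simp only [← mul_assoc (Ring.inverse (conjFactor V L α)) (conjFactor V L α), hK1, one_mul]
  rw [add_comm]

end Point

/-! ### Conjugate bundles -/

/-- The conjugation as a continuous real linear map. -/
def conjL (n : ℕ) : Cn n →L[ℝ] Cn n :=
  LinearMap.toContinuousLinearMap
    { toFun := fun x => conjE n x
      map_add' := fun x y => map_add _ x y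
      map_smul' := fun r x => by ext i; simp }

theorem contDiffOn_conjE {f : ℂ → Cn n} {U : Set ℂ} (hf : ContDiffOn ℝ ∞ f U) :
    ContDiffOn ℝ ∞ (fun z => conjE n (f z)) U := (conjL n).contDiff.comp_contDiffOn hf

theorem fderiv_conjE {f : ℂ → Cn n} {z : ℂ} (hf : DifferentiableAt ℝ f z) (v : ℂ) :
    fderiv ℝ (fun w => conjE n (f w)) z v = conjE n (fderiv ℝ f z v) := by
  have h : HasFDerivAt (fun w => conjE n (f w)) ((conjL n).comp (fderiv ℝ f z)) z :=
    (conjL n).hasFDerivAt.comp z hf.hasFDerivAt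
  rw [h.fderiv]; rfl

theorem pder_conjE (η : ℂ) {f : ℂ → Cn n} {z : ℂ} (hf : DifferentiableAt ℝ f z) (v : ℂ) :
    pder η (fun w => conjE n (f w)) z v = conjE n (pder (-star η) f z v) := by
  simp only [pder, pt, fderiv_conjE hf, map_sub, conjE_smul]
  simp

section Conj

variable {U : Set ℂ} {V L : ℂ → Submodule ℂ (Cn n)} {k : ℕ} {q : ℂ → ℂ →L[ℝ] Endo n}

theorem IsSubbundleOn.conj (hL : IsSubbundleOn 1 U L) :
    IsSubbundleOn 1 U (fun z => conjSub (L z)) := by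
  refine isSubbundleOn_one fun z hz => ?_
  obtain ⟨O, hO, hzO, hOU, s, hs, hsp⟩ := hL.exists_frame_one hz
  refine ⟨O, hO, hzO, hOU, fun w => conjE n (s w), contDiffOn_conjE hs, fun w hw => ⟨?_, ?_⟩⟩
  · simpa using (hsp w hw).1
  · rw [(hsp w hw).2, conjSub_span_singleton]

/-- `𝒟`, `𝒩` and `q` are real, and conjugation exchanges types, so `λ⁻¹` on type (1,0) becomes `conj
λ⁻¹` on type (0,1). -/
theorem conjT_formLoop (hU : IsOpen U) (hV : IsSubbundleOn k U V) (hN : ∀ z ∈ U, IsNondeg (V z))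
    (hr : ∀ z ∈ U, conjSub (V z) = V z) {z : ℂ} (hz : z ∈ U)
    (hq : ∀ v, conjT (q z v) = q z v) (l v : ℂ) :
    conjT (formLoop V q l z v) = formLoop V q (star l)⁻¹ z v := by
  have hρ := hV.contDiffOn_refl hN
  have dρ := hρ.differentiableAt_of_isOpen hU hz
  have h1 (v) : conjT (fderiv ℝ (fun w => refl (V w)) z v) =
      fderiv ℝ (fun w => refl (V w)) z v := by
    rw [conjT_eq_iff]
    intro x
    have ap (x : Cn n) (u : ℂ) : fderiv ℝ (fun w => refl (V w) x) z u =
        fderiv ℝ (fun w => refl (V w)) z u x :=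
      fderiv_clm (ContinuousLinearMap.apply ℂ (Cn n) x) dρ u
    have dx : DifferentiableAt ℝ (fun w => refl (V w) x) z :=
      (contDiffOn_apply hρ contDiffOn_const).differentiableAt_of_isOpen hU hz
    rw [← ap, ← ap, ← fderiv_conjE dx]
    have e : (fun w => conjE n (refl (V w) x)) =ᶠ[nhds z] fun w => refl (V w) (conjE n x) :=
      Filter.eventuallyEq_of_mem (hU.mem_nhds hz) fun w hw => conjE_refl (hN w hw) (hr w hw) x
    rw [e.fderiv_eq]
  have h2 : conjT (refl (V z)) = refl (V z) :=
    conjT_eq_iff.2 fun x => conjE_refl (hN z hz) (hr z hz) x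
  have hD (v) : conjT (formD V z v) = formD V z v := by
    have s1 : star (1 / 2 : ℂ) = 1 / 2 := by simp
    rw [formD_apply hU hV hN hz, conjT_smul, conjT_mul, h1, h2, s1]
  have hN' (v) : conjT (formN V z v) = formN V z v := by
    have : formN V z v = (-1 : ℂ) • formD V z v := by rw [formN, neg_apply]; module
    rw [this, conjT_smul, hD]; simp
  simp only [formLoop, add_apply, smul_apply, conjT_add, conjT_smul, hD, conjT_part10 hN',
    conjT_part01 hN', conjT_part10 hq, conjT_part01 hq, star_sub, star_inv₀, star_pow, star_one,
    inv_inv, inv_pow]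
  abel

theorem IsParallelOn.conj (hU : IsOpen U) (hV : IsSubbundleOn k U V)
    (hN : ∀ z ∈ U, IsNondeg (V z)) (hr : ∀ z ∈ U, conjSub (V z) = V z)
    (hq : ∀ z ∈ U, ∀ v, conjT (q z v) = q z v) {l : ℂ} (h : IsParallelOn U (formLoop V q l) L) :
    IsParallelOn U (formLoop V q (star l)⁻¹) (fun z => conjSub (L z)) := by
  intro O s hO hs z hz v
  have h1 := h O (fun w => conjE n (s w)) hO
    ⟨hs.isOpen, contDiffOn_conjE hs.smooth, fun w hw => mem_conjSub.1 (hs.mem w hw)⟩ z hz v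
  rw [fderiv_conjE (hs.smooth.differentiableAt_of_isOpen hs.isOpen hz)] at h1
  rw [mem_conjSub, map_add, ← conjT_formLoop hU hV hN hr (hO hz) (hq z (hO hz)), conjT_apply,
    conjE_conjE]
  exact h1

end Conj

/-! ### The central sphere congruence of an immersed real surface is real -/

section Immersed

variable {U : Set ℂ} {V L10 L01 G F : ℂ → Submodule ℂ (Cn n)} {q : ℂ → ℂ →L[ℝ] Endo n}

/-- Centrality says that `dρ` of this type kills `F`; differentiating `ρ y = y` shows that the
derivative of `y` is fixed by `ρ`. -/
theorem IsHalfWillmore.pder_mem {η : ℂ} (hW : IsHalfWillmore η U G F V q) (hU : IsOpen U)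
    (hV : IsSubbundleOn 4 U V) (hN : ∀ z ∈ U, IsNondeg (V z)) {O : Set ℂ} (hOU : O ⊆ U)
    {y : ℂ → Cn n} (hy : IsSectionOn F O y) {z : ℂ} (hz : z ∈ O) (v : ℂ) :
    pder η y z v ∈ V z := by
  have hzU := hOU hz
  have dr := (hV.contDiffOn_refl hN).differentiableAt_of_isOpen hU hzU
  have dy := hy.smooth.differentiableAt_of_isOpen hy.isOpen hz
  have h1 := pder_apply η dr dy v
  rw [pder_congr hy.isOpen (g := y)
    (fun w hw => refl_of_mem (hN w (hOU hw)) (hW.leF w (hOU hw) (hy.mem w hw))) hz] at h1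
  have h2 := hW.central z hzU v _ (hy.mem z hz)
  rw [pt_formN hU hV hN hzU, smul_apply, smul_eq_zero, or_iff_right (by norm_num)] at h2
  have h3 : pder η (fun w => refl (V w)) z v (y z) = 0 := by
    rw [← refl_refl (hN z hzU) (pder η (fun w => refl (V w)) z v (y z))]
    change refl (V z) ((refl (V z) * pder η (fun w => refl (V w)) z v) (y z)) = 0
    rw [h2, map_zero]
  rw [h3, zero_add] at h1
  exact (mem_iff_refl (hN z hzU)).2 h1.symm

theorem contDiffOn_pder {O : Set ℂ} (hO : IsOpen O) {s : ℂ → Cn n} (hs : ContDiffOn ℝ ∞ s O)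
    (η v : ℂ) : ContDiffOn ℝ ∞ (fun w => pder η s w v) O := by
  have h : ContDiffOn ℝ ∞ (fderiv ℝ s) O := hs.fderiv_of_isOpen hO (by simp)
  rw [contDiffOn_clm_apply] at h
  simp only [pder, pt]
  exact ((h v).sub ((h _).const_smul _)).const_smul _

theorem fderiv_eq_pder (s : ℂ → Cn n) (z v : ℂ) :
    fderiv ℝ s z v = v • pder 1 s z 1 + star v • pder (-1) s z 1 := by
  have e : fderiv ℝ s z v = v.re • fderiv ℝ s z 1 + v.im • fderiv ℝ s z Complex.I := by
    rw [← map_smul, ← map_smul, ← map_add]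
    congr 1
    simp [Complex.re_add_im]
  have c (r : ℝ) (x : Cn n) : r • x = (r : ℂ) • x := rfl
  rw [e, c, c]
  simp only [pder, pt, mul_one]
  have h1 : star v = v.re - v.im * Complex.I := by
    apply Complex.ext <;> simp
  have h2 : v = v.re + v.im * Complex.I := (Complex.re_add_im v).symm
  rw [h1]
  nth_rewrite 3 [h2]
  match_scalars
  · ring
  · ring_nf; simp

/-- With `s` a section of `Λ`, the vectors `s, ∂s, ∂̄s, ∂̄∂s` form a frame of `V`. Their conjugates
are the corresponding derivatives of `s̄`, again a section of `Λ`, with `∂̄∂s` becoming `∂∂̄s̄`;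
they lie in `V` for the same reasons. -/
theorem IsConstrainedWillmoreOn.real_of_immersed (hU : IsOpen U)
    (hW : IsConstrainedWillmoreOn U L10 L01 V q)
    (hr : ∀ z ∈ U, conjSub (L10 z ⊓ L01 z) = L10 z ⊓ L01 z)
    (hi : IsImmersedOn U (fun z => L10 z ⊓ L01 z)) {z : ℂ} (hz : z ∈ U) :
    conjSub (V z) = V z := by
  have hV := hW.central.bundle
  have hN := hW.central.nondeg
  obtain ⟨O, hO, hzO, hOU, s, hs, hsp⟩ := hW.surface.bundle_inter.exists_frame_one hz
  have hsec : IsSectionOn (fun z => L10 z ⊓ L01 z) O s :=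
    ⟨hO, hs, fun w hw => by rw [(hsp w hw).2]; exact Submodule.mem_span_singleton_self _⟩
  have hsec' : IsSectionOn (fun z => L10 z ⊓ L01 z) O (fun w => conjE n (s w)) :=
    ⟨hO, contDiffOn_conjE hs, fun w hw => by
      rw [← mem_conjSub, hr w (hOU hw)]; exact hsec.mem w hw⟩
  have d10 {t : ℂ → Cn n} (ht : IsSectionOn (fun z => L10 z ⊓ L01 z) O t) :
      IsSectionOn L10 O (fun w => pder 1 t w 1) :=
    ⟨hO, contDiffOn_pder hO ht.smooth 1 1, fun w hw => hW.half10.deriv O t hOU ht w hw 1⟩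
  have d01 {t : ℂ → Cn n} (ht : IsSectionOn (fun z => L10 z ⊓ L01 z) O t) :
      IsSectionOn L01 O (fun w => pder (-1) t w 1) :=
    ⟨hO, contDiffOn_pder hO ht.smooth (-1) 1, fun w hw =>
      hW.half01.deriv O t hOU (by simpa only [inf_comm] using ht) w hw 1⟩
  -- a frame of `V` at `z`
  set a := s z
  set b := pder 1 s z 1 with hb
  set c := pder (-1) s z 1 with hc
  set d := pder (-1) (fun w => pder 1 s w 1) z 1 with hd
  have ha10 : a ∈ L10 z := (hsec.mem z hzO).1
  have ha01 : a ∈ L01 z := (hsec.mem z hzO).2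
  have hb10 : b ∈ L10 z := (d10 hsec).mem z hzO
  have hc01 : c ∈ L01 z := (d01 hsec).mem z hzO
  have le10 := hW.half10.leG z hz
  have le01 := hW.half10.leF z hz
  have hdV : d ∈ V z := hW.half01.pder_mem hU hV hN hOU (d10 hsec) hzO 1
  have ds := hs.differentiableAt_of_isOpen hO hzO
  have db := (d10 hsec).smooth.differentiableAt_of_isOpen hO hzO
  have dc := (d01 hsec).smooth.differentiableAt_of_isOpen hO hzO
  have haV := le10 ha10
  have hca : conjE n a ∈ V z := le10 (hsec'.mem z hzO).1
  have hcb : conjE n b ∈ V z := by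
    have h1 := pder_conjE (-1) ds 1
    rw [show -star (-1 : ℂ) = 1 by simp] at h1
    rw [hb, ← h1]
    exact le01 ((d01 hsec').mem z hzO)
  have hcc : conjE n c ∈ V z := by
    have h1 := pder_conjE 1 ds 1
    rw [show -star (1 : ℂ) = -1 by simp] at h1
    rw [hc, ← h1]
    exact le10 ((d10 hsec').mem z hzO)
  have hcd : conjE n d ∈ V z := by
    have h1 := pder_conjE 1 db 1
    rw [show -star (1 : ℂ) = -1 by simp] at h1
    rw [hd, ← h1]
    have h2 : ∀ w ∈ O, conjE n (pder 1 s w 1) = pder (-1) (fun w => conjE n (s w)) w 1 := by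
      intro w hw
      rw [pder_conjE (-1) (hs.differentiableAt_of_isOpen hO hw), show -star (-1 : ℂ) = 1 by simp]
    rw [pder_congr hO h2 hzO]
    exact hW.half10.pder_mem hU hV hN hOU (d01 hsec') hzO 1
  -- the span of `a, b, c` has dimension 3
  have h3 := hi O s hOU hsec (fun w hw => (hsp w hw).1) z hzO
  have hle : Submodule.span ℂ (insert a (Set.range fun v : ℂ => fderiv ℝ s z v)) ≤
      Submodule.span ℂ {a, b, c} := by
    rw [Submodule.span_le]
    rintro x (rfl | ⟨v, rfl⟩)
    · exact Submodule.subset_span (by simp)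
    · change fderiv ℝ s z v ∈ _
      rw [fderiv_eq_pder]
      exact Submodule.add_mem _ (Submodule.smul_mem _ _ (Submodule.subset_span (by simp [hb])))
        (Submodule.smul_mem _ _ (Submodule.subset_span (by simp [hc])))
  have h3' : 3 ≤ Module.finrank ℂ (Submodule.span ℂ {a, b, c}) := by
    rw [← h3]; exact Submodule.finrank_mono hle
  have hab := hW.surface.isotropic10 z hz a ha10 b hb10
  have haa := hW.surface.isotropic10 z hz a ha10 a ha10
  have hbb := hW.surface.isotropic10 z hz b hb10 b hb10
  have hac := hW.surface.isotropic01 z hz a ha01 c hc01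
  have hcc' := hW.surface.isotropic01 z hz c hc01 c hc01
  have hle3 : Submodule.span ℂ {a, b, c} ≤ V z := by
    rw [Submodule.span_le]
    rintro x (rfl | rfl | rfl)
    exacts [haV, le10 hb10, le01 hc01]
  -- Otherwise `s, ∂s, ∂̄s`, independent by immersion, would span an isotropic space of dimension
  -- three in `V`.
  have hbc : lor n b c ≠ 0 := by
    intro h0
    have hiso : IsIsotropic (Submodule.span ℂ {a, b, c}) := by
      intro x hx y hy
      rw [Submodule.mem_span_triple] at hx hy
      obtain ⟨x₁, x₂, x₃, rfl⟩ := hx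
      obtain ⟨y₁, y₂, y₃, rfl⟩ := hy
      simp only [map_add, map_smul, LinearMap.add_apply, LinearMap.smul_apply, smul_eq_mul, haa,
        hab, hac, hbb, h0, hcc', lor_symm b a, lor_symm c a, lor_symm c b]
      ring
    have := finrank_isotropic_le (hN z hz) (hV.finrank hz) hiso hle3
    omega
  -- Differentiate `(∂s, s) = 0`. As `a` is orthogonal to `a, b, c`, this makes `d` independent of
  -- them.
  have had : lor n d a = -lor n b c := by
    have h1 := pder_congr (η := -1) (f := fun w => lor n (pder 1 s w 1) (s w))
      (g := fun _ => (0 : ℂ)) hO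
      (fun w hw => hW.surface.isotropic10 w (hOU hw) _ ((d10 hsec).mem w hw) _ (hsec.mem w hw).1)
      hzO 1
    have h0 : pder (-1) (fun _ => (0 : ℂ)) z 1 = 0 := by simp [pder, pt]
    rw [pder_lor (-1) db ds, h0] at h1
    linear_combination h1
  have hd3 : d ∉ Submodule.span ℂ {a, b, c} := by
    intro h
    rw [Submodule.mem_span_triple] at h
    obtain ⟨x₁, x₂, x₃, h⟩ := h
    apply hbc
    rw [← h] at had
    simp only [map_add, map_smul, LinearMap.add_apply, LinearMap.smul_apply, smul_eq_mul, haa,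
      lor_symm b a, lor_symm c a, hab, hac] at had
    linear_combination had
  have hspan : Submodule.span ℂ {d, a, b, c} = V z := by
    apply Submodule.eq_of_le_of_finrank_le
    · rw [Submodule.span_le]
      rintro x (rfl | rfl | rfl | rfl)
      exacts [hdV, haV, le10 hb10, le01 hc01]
    · rw [hV.finrank hz]
      have hlt : Submodule.span ℂ {a, b, c} < Submodule.span ℂ {d, a, b, c} := by
        refine lt_of_le_of_ne (Submodule.span_mono (Set.subset_insert _ _)) fun h => hd3 ?_
        rw [h]; exact Submodule.subset_span (by simp)
      have := Submodule.finrank_lt_finrank_of_lt hlt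
      omega
  refine conjSub_eq_of_le ?_ rfl
  rintro _ ⟨x, hx, rfl⟩
  rw [SetLike.mem_coe, ← hspan] at hx
  change conjE n x ∈ V z
  refine Submodule.span_induction ?_ ?_ ?_ ?_ hx
  · rintro y (rfl | rfl | rfl | rfl)
    exacts [hcd, hca, hcb, hcc]
  · rw [map_zero]; exact (V z).zero_mem
  · intro x y _ _ h1 h2; rw [map_add]; exact (V z).add_mem h1 h2
  · intro r x _ h1; rw [conjE_smul]; exact (V z).smul_mem _ h1

end Immersed

/-! ### Passage to charts -/

section Charts

variable {M : Type*} [TopologicalSpace M] [ChartedSpace ℂ M]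

/-- The derivative of the inverse of a chart, as a map between copies of `ℂ`. -/
def chartDeriv (e : OpenPartialHomeomorph M ℂ) (z : ℂ) : ℂ →L[ℝ] ℂ :=
  mfderiv 𝓘(ℝ, ℂ) 𝓘(ℝ, ℂ) e.symm z

/-- The tangent space at a point is read in the preferred chart there, so the derivative is that of
a transition map. -/
theorem chartDeriv_eq_fderiv {e : OpenPartialHomeomorph M ℂ} {z : ℂ}
    (h : MDifferentiableAt 𝓘(ℝ, ℂ) 𝓘(ℝ, ℂ) e.symm z) :
    chartDeriv e z = fderiv ℝ (chartAt ℂ (e.symm z) ∘ e.symm) z := by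
  refine h.mfderiv.trans ?_
  simp only [writtenInExtChartAt, extChartAt, mfld_simps, fderivWithin_univ, chartAt_self_eq,
    Function.comp_id]
  rfl

theorem differentiableAt_chartAt_symm [IsManifold 𝓘(ℂ) ω M] {e : OpenPartialHomeomorph M ℂ}
    (he : e ∈ atlas ℂ M) {z : ℂ} (hz : z ∈ e.target) :
    DifferentiableAt ℂ (chartAt ℂ (e.symm z) ∘ e.symm) z := by
  have h := HasGroupoid.compatible (G := contDiffGroupoid ω 𝓘(ℂ)) he
    (chart_mem_atlas ℂ (e.symm z))
  have h1 : ContDiffOn ℂ ω (chartAt ℂ (e.symm z) ∘ e.symm)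
      (e.symm.trans (chartAt ℂ (e.symm z))).source := by
    simpa using (contMDiffOn_of_mem_contDiffGroupoid h).contDiffOn
  have hz' : z ∈ (e.symm.trans (chartAt ℂ (e.symm z))).source := by
    simp [hz]
  exact (h1.contDiffAt ((e.symm.trans (chartAt ℂ (e.symm z))).open_source.mem_nhds
    hz')).differentiableAt (by simp)

/-- The charts are compatible with the complex structure of the tangent spaces. -/
theorem chartDeriv_mul_I [IsManifold 𝓘(ℂ) ω M] {e : OpenPartialHomeomorph M ℂ}
    (he : e ∈ atlas ℂ M) {z : ℂ} (hz : z ∈ e.target) (v : ℂ) :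
    chartDeriv e z (Complex.I * v) = Complex.I * chartDeriv e z v := by
  by_cases h : MDifferentiableAt 𝓘(ℝ, ℂ) 𝓘(ℝ, ℂ) e.symm z
  · rw [chartDeriv_eq_fderiv h, (differentiableAt_chartAt_symm he hz).fderiv_restrictScalars ℝ]
    exact (fderiv ℂ (chartAt ℂ (e.symm z) ∘ e.symm) z).map_smul Complex.I v
  -- The default value of `mfderiv` is `0`, which also commutes with `i`; differentiability need not
  -- be shown.
  · have h0 : chartDeriv e z = 0 := mfderiv_zero_of_not_mdifferentiableAt h
    rw [h0]; simp

theorem part10_comp {A : ℂ →L[ℝ] Endo n} {J : ℂ →L[ℝ] ℂ}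
    (hJ : ∀ v, J (Complex.I * v) = Complex.I * J v) :
    part10 (A.comp J) = (part10 A).comp J := by
  ext1 v
  simp [part10, compJ, hJ]

theorem part01_comp {A : ℂ →L[ℝ] Endo n} {J : ℂ →L[ℝ] ℂ}
    (hJ : ∀ v, J (Complex.I * v) = Complex.I * J v) :
    part01 (A.comp J) = (part01 A).comp J := by
  ext1 v
  simp [part01, compJ, hJ]

/-- The value of a form at a point, as a covector on `ℂ`. -/
def covectorAt (q : FormField n M) (p : M) : ℂ →L[ℝ] Endo n := q p

theorem formInChart_eq (e : OpenPartialHomeomorph M ℂ) (q : FormField n M) (z : ℂ) :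
    formInChart e q z = (covectorAt q (e.symm z)).comp (chartDeriv e z) := rfl

theorem covectorAt_transformQ (V L : SubField n M) (α : ℂ) (q : FormField n M) (p : M) :
    covectorAt (transformQ V L α q) p =
      transformForm (realR V L α 1 p) (realR V L α 0 p) (realRInf V L α p) (covectorAt q p) := rfl

/-- Pull-back by a complex linear map preserves types, so the transform of a form may be computed in
any holomorphic chart. -/
theorem transformForm_comp (R r₀ ri : Endo n) {A : ℂ →L[ℝ] Endo n} {J : ℂ →L[ℝ] ℂ}
    (hJ : ∀ v, J (Complex.I * v) = Complex.I * J v) :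
    transformForm R r₀ ri (A.comp J) = (transformForm R r₀ ri A).comp J := by
  rw [transformForm, part10_comp hJ, part01_comp hJ]
  rfl

theorem formInChart_transformQ [IsManifold 𝓘(ℂ) ω M] {e : OpenPartialHomeomorph M ℂ}
    (he : e ∈ atlas ℂ M) {V L : SubField n M} {q : FormField n M} {α : ℂ} {z : ℂ}
    (hz : z ∈ e.target) :
    formInChart e (transformQ V L α q) z = transformForm (realR V L α 1 (e.symm z))
      (realR V L α 0 (e.symm z)) (realRInf V L α (e.symm z)) (formInChart e q z) := by
  rw [formInChart_eq, formInChart_eq, covectorAt_transformQ,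
    transformForm_comp _ _ _ (chartDeriv_mul_I he hz)]

end Charts

section Congr

variable {U : Set ℂ} {L10 L01 V : ℂ → Submodule ℂ (Cn n)} {q q' : ℂ → ℂ →L[ℝ] Endo n}

theorem IsConstrainedWillmoreOn.congr (hU : IsOpen U) (hW : IsConstrainedWillmoreOn U L10 L01 V q)
    (h : ∀ z ∈ U, q' z = q z) : IsConstrainedWillmoreOn U L10 L01 V q' := by
  refine ⟨hW.surface, hW.central, ⟨hW.harmonic.smooth.congr h, fun z hz => ?_, fun l hl z hz => ?_⟩,
    fun z hz => ?_, fun z hz => ?_⟩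
  · rw [h z hz]; exact hW.harmonic.mem z hz
  · have h1 : formLoop V q' l =ᶠ[nhds z] formLoop V q l := by
      filter_upwards [hU.mem_nhds hz] with w hw
      simp only [formLoop, h w hw]
    rw [h1.fderiv_eq, h1.eq_of_nhds]
    exact hW.harmonic.flat l hl z hz
  · rw [h z hz]; exact hW.multiplier10 z hz
  · rw [h z hz]; exact hW.multiplier01 z hz

end Congr

/-! ### The theorem on the Riemann surface -/

section Global

variable {M : Type*} [TopologicalSpace M] [ChartedSpace ℂ M]
  {L10 L01 V L : SubField n M} {q : FormField n M} {α : ℂ}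

theorem exists_chart (p : M) :
    ∃ e ∈ atlas ℂ M, ∃ z ∈ e.target, e.symm z = p :=
  ⟨chartAt ℂ p, chart_mem_atlas ℂ p, chartAt ℂ p p, mem_chart_target ℂ p,
    (chartAt ℂ p).left_inv (mem_chart_source ℂ p)⟩

theorem IsRealForm.conjT_eq (hq : IsRealForm q) (p : M) (v : TangentSpace 𝓘(ℝ, ℂ) p) :
    conjT (q p v) = q p v :=
  conjT_eq_iff.2 fun x => (hq p v x).symm

theorem IsRealForm.conjT_formInChart (hq : IsRealForm q) (e : OpenPartialHomeomorph M ℂ)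
    (z v : ℂ) : conjT (formInChart e q z v) = formInChart e q z v :=
  hq.conjT_eq (e.symm z) (chartDeriv e z v)

theorem IsRealConstrainedWillmore.isNondeg (hW : IsRealConstrainedWillmore L10 L01 V q) (p : M) :
    IsNondeg (V p) := by
  obtain ⟨e, he, z, hz, rfl⟩ := exists_chart p
  exact (hW.willmore e he).central.nondeg z hz

theorem IsRealConstrainedWillmore.isRealField (hW : IsRealConstrainedWillmore L10 L01 V q)
    (hV : IsImmersed (fun p => L10 p ⊓ L01 p) ∨ IsRealField V) : IsRealField V := by
  rcases hV with hi | hr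
  · intro p
    obtain ⟨e, he, z, hz, rfl⟩ := exists_chart p
    exact (hW.willmore e he).real_of_immersed e.open_target
      (fun z _ => hW.real_surface (e.symm z)) (hi e he) hz
  · exact hr

/-- The two isotropic bundles of a real surface in a real congruence are conjugate. -/
theorem IsRealConstrainedWillmore.conjSub_eq (hW : IsRealConstrainedWillmore L10 L01 V q)
    (hr : IsRealField V) (p : M) : conjSub (L10 p) = L01 p := by
  have hs := hW.real_surface p
  obtain ⟨e, he, z, hz, rfl⟩ := exists_chart p
  have hw := hW.willmore e he
  exact conjSub_isotropic (hw.central.nondeg z hz) (hw.central.bundle.finrank hz)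
    (hw.surface.isotropic10 z hz) (hw.surface.bundle10.finrank hz) (hw.half10.leG z hz)
    (hw.surface.isotropic01 z hz) (hw.surface.bundle01.finrank hz) (hw.half10.leF z hz)
    (hw.surface.bundle_inter.finrank hz) (hr _) hs

theorem IsBacklundParameter.isDressing (hL : IsBacklundParameter V q α L)
    (hN : ∀ p, IsNondeg (V p)) (p : M) : IsDressing (V p) (L p) := by
  refine .of_transverse (hN p) ?_ (hL.null p) (hL.transverse p)
  obtain ⟨e, he, z, hz, rfl⟩ := exists_chart p
  exact (hL.bundle e he).finrank hz

theorem IsBacklundParameter.isDressing_hat (hL : IsBacklundParameter V q α L)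
    (hN : ∀ p, IsNondeg (V p)) (p : M) :
    IsDressing (V p) (hatL (V p) α (star α)⁻¹ (L p) (conjSub (L p))) := by
  have hD := hL.isDressing hN p
  have ho : IsOrth (pMap (V p) α (L p) (star α)⁻¹) :=
    isOrth_dress (hN p) hD (div_ne_zero (sub_star_inv_ne_zero hL.ne_zero hL.not_unit)
      (add_star_inv_ne_zero hL.ne_zero))
  refine .of_transverse (hN p) ?_ ?_ (hL.transverse_hat p)
  · rw [hatL, ho.finrank_image, finrank_conjSub]
    obtain ⟨e, he, z, hz, rfl⟩ := exists_chart p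
    exact (hL.bundle e he).finrank hz
  · refine ho.isIsotropic_image fun x hx y hy => ?_
    have h := hL.null p _ (mem_conjSub.1 hx) _ (mem_conjSub.1 hy)
    rw [lor_conjE] at h
    exact star_eq_zero.1 h

/-- The Willmore condition is checked chart by chart, and reality pointwise. -/
theorem IsRealConstrainedWillmore.transform [IsManifold 𝓘(ℂ) ω M]
    (hW : IsRealConstrainedWillmore L10 L01 V q) (hr : IsRealField V)
    (hL : IsBacklundParameter V q α L) :
    IsRealConstrainedWillmore (transform10 V L α L10) (transform01 V L α L01)
      (transformV V L α) (transformQ V L α q) := by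
  have hN := hW.isNondeg
  have hD := hL.isDressing hN
  have hDh := hL.isDressing_hat hN
  have h0 := hL.ne_zero
  have h1 := hL.not_unit
  refine ⟨fun e he => ?_, fun p => ?_, fun p v x => ?_⟩
  · have hw := hW.willmore e he
    have hU := e.open_target
    have hVb := hw.central.bundle
    -- Reality of `V` and `q` makes `L̄` parallel at `1/ᾱ`, so it is the second line of the
    -- dressing.
    have hpar : IsParallelOn e.target (formLoop (inChart e V) (formInChart e q) (star α)⁻¹)
        (fun z => conjSub (inChart e L z)) :=
      (hL.parallel e he).conj (q := formInChart e q) hU hVb (fun z _ => hN (e.symm z)) (fun z _ => hr (e.symm z))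
        fun z _ => hW.real_form.conjT_formInChart e z
    have key := hw.transform (L := inChart e L) (L' := fun z => conjSub (inChart e L z)) hU
      (hL.bundle e he) (fun z _ => hD (e.symm z)) (hL.bundle e he).conj
      (fun z _ => (hD (e.symm z)).conj (hN (e.symm z)) (hr (e.symm z))) (fun z _ => hDh (e.symm z)) h0
      (inv_ne_zero (star_ne_zero.2 h0)) (add_star_inv_ne_zero h0) (sub_star_inv_ne_zero h0 h1)
      (add_one_ne_zero_of_norm h1) (sub_one_ne_zero_of_norm h1)
      (add_one_ne_zero_of_norm (norm_star_inv_ne_one h1))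
      (sub_one_ne_zero_of_norm (norm_star_inv_ne_one h1)) (hL.parallel e he) hpar
    exact key.congr hU fun z hz => formInChart_transformQ he hz
  · have hc := hW.conjSub_eq hr p
    -- The transformed planes are conjugate to each other, so their intersection is real.
    have h2 : conjSub (transform10 V L α L10 p) = transform01 V L α L01 p :=
      (conjSub_transform10 (hN p) (hr p) (hD p) h0 h1 (hDh p) (L10 p)).trans (by rw [hc]; rfl)
    have h3 : conjSub (transform01 V L α L01 p) = transform10 V L α L10 p := by
      rw [← h2, conjSub_conjSub]
    exact (conjSub_inf _ _).trans (by rw [h2, h3, inf_comm])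
  · exact (conjT_eq_iff.1 (conjT_transformForm (hN p) (hr p) (hD p) h0 h1 (hDh p)
      (hW.real_form.conjT_eq p) v) x).symm

theorem IsRealConstrainedWillmore.isRealField_transformV
    (hW : IsRealConstrainedWillmore L10 L01 V q) (hr : IsRealField V)
    (hL : IsBacklundParameter V q α L) : IsRealField (transformV V L α) := fun p =>
  conjSub_transform (hW.isNondeg p) (hr p) (hL.isDressing hW.isNondeg p) hL.ne_zero hL.not_unit
    (hL.isDressing_hat hW.isNondeg p)

end Global

end Backlund

end

theorem mainTheorem6 {n : ℕ} {M : Type*} [TopologicalSpace M] [ChartedSpace ℂ M]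
    [IsManifold 𝓘(ℂ) ω M]
    (L10 L01 V : Backlund.SubField n M) (q : Backlund.FormField n M)
    (hW : Backlund.IsRealConstrainedWillmore L10 L01 V q)
    (hV : Backlund.IsImmersed (fun p => L10 p ⊓ L01 p) ∨ Backlund.IsRealField V)
    (α : ℂ) (L : Backlund.SubField n M)
    (hL : Backlund.IsBacklundParameter V q α L) :
    Backlund.IsRealConstrainedWillmore
        (Backlund.transform10 V L α L10) (Backlund.transform01 V L α L01)
        (Backlund.transformV V L α) (Backlund.transformQ V L α q) ∧
      Backlund.IsRealField (Backlund.transformV V L α) := by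
  have hr := hW.isRealField hV
  exact ⟨hW.transform hr hL, hW.isRealField_transformV hr hL⟩
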